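/- Let $n\ge 1$. An instance of the Boolean hidden shift problem for $f:\mathbb{Z}_2^n\to\mathbb{Z}_2$ consists of $f$ and $g:\mathbb{Z}_2^n\to\mathbb{Z}_2$, given by the quantum oracles $O_f:|b\rangle|x\rangle\mapsto|b\oplus f(x)\rangle|x\rangle$ and $O_g:|b\rangle|x\rangle\mapsto|b\oplus g(x)\rangle|x\rangle$, such that (i) the only $t\in\mathbb{Z}_2^n$ with $f(x)=f(x+t)$ for all $x$ is $t=0$, and (ii) there is $s\in\mathbb{Z}_2^n$ with $g(x)=f(x+s)$ for all $x$. The (unique) $s$ is the solution of the instance. The minimum influence of $f$ is $$\gamma_f=\min_{v\in\mathbb{Z}_2^n\setminus\{0\}}\Pr_x[f(x)\ne f(x+v)],$$ where $x$ is uniform in $\mathbb{Z}_2^n$ (so $\gamma_f>0$). **Theorem.** There are a quantum algorithm (one fixed program for all $n$, $f$, $g$, which receives $n$ as input and has access to $f$ and $g$ only through $O_f$ and $O_g$), a constant $C$ and a polynomial $p$ such that on every instance, for every $n\ge1$: 1. the algorithm halts with probability $1$, and with probability $1$ its output is the solution $s$; 2. the expected number $Q$ of oracle queries (to $O_f$ and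 $O_g$ together) satisfies $Q\le C\,n/\sqrt{\gamma_f}$; 3. the expected running time of the algorithm is at most $p(Q)$. Here a quantum algorithm is a program for a random access machine that controls qubits, all initially $|0\rangle$. In one time step the machine performs one elementary classical operation (constants, addition, subtraction truncated at zero, indirect reads and writes, control flow), one gate from Hadamard, $X$, $Z$, CNOT, Toffoli, one single-qubit measurement in the computational basis, or one oracle query. -/

import Mathlib

open scoped ENNReal

namespace HiddenShift

noncomputable section

/-! ### The Boolean hidden shift problem and the minimum influence -/

/-- The group `ℤ₂ⁿ`. -/
abbrev Cube (n : ℕ) : Type := Fin n → ZMod 2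

/-- Boolean functions of `n` bits. -/
abbrev BoolFun (n : ℕ) : Type := Cube n → ZMod 2

/-- `(f, g)` is an instance of the Boolean hidden shift problem with solution `s`. -/
structure IsInstance {n : ℕ} (f g : BoolFun n) (s : Cube n) : Prop where
  aperiodic : ∀ t : Cube n, (∀ x, f x = f (x + t)) → t = 0
  shift : ∀ x, g x = f (x + s)

/-- The influence of `v` over `f`: the probability, for uniform `x`, that `f x ≠ f (x + v)`. -/
def influence {n : ℕ} (f : BoolFun n) (v : Cube n) : ℝ :=
  ((Finset.univ.filter fun x : Cube n => f x ≠ f (x + v)).card : ℝ) / 2 ^ n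

/-- The minimum influence over `f`, the minimum being over the nonzero vectors `v`
(the zero vector always has influence `0`). -/
def minInfluence {n : ℕ} (f : BoolFun n) : ℝ :=
  ⨅ v : {v : Cube n // v ≠ 0}, influence f v.1

/-! ### Quantum states

There is an unbounded supply of qubits, numbered by `ℕ` and all initially `|0⟩`, of which a
computation only touches finitely many.  A state is a finite linear combination of computational
basis states.  States need not be normalised: the state of a branch of a computation is the
projection onto the measurement outcomes seen so far, so that its squared norm is the probability
of the branch. -/

/-- Labels of the computational basis states. -/
abbrev Label : Type := ℕ → ZMod 2

/-- Pure states, not necessarily normalised. -/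
abbrev QState : Type := Label →₀ ℂ

/-- The basis state `|x⟩`. -/
def ket (x : Label) : QState := Finsupp.single x 1

/-- The linear operator with prescribed values on the basis states. -/
def linExt (U : Label → QState) : QState →ₗ[ℂ] QState := Finsupp.linearCombination ℂ U

/-- The squared norm of a state. -/
def normSq (ψ : QState) : ℝ≥0∞ := ψ.sum fun _ a => ENNReal.ofReal (‖a‖ ^ 2)

/-- Hadamard gate on qubit `q`. -/
def gateH (q : ℕ) : QState →ₗ[ℂ] QState :=
  linExt fun x => ((1 / Real.sqrt 2 : ℝ) : ℂ) •
    (ket (Function.update x q 0) + (-1 : ℂ) ^ (x q).val • ket (Function.update x q 1))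

/-- NOT gate on qubit `q`. -/
def gateX (q : ℕ) : QState →ₗ[ℂ] QState :=
  linExt fun x => ket (Function.update x q (x q + 1))

/-- Phase gate `|b⟩ ↦ (-1)ᵇ |b⟩` on qubit `q`. -/
def gateZ (q : ℕ) : QState →ₗ[ℂ] QState :=
  linExt fun x => (-1 : ℂ) ^ (x q).val • ket x

/-- Controlled NOT with control `c` and target `t`; no effect unless they are distinct. -/
def gateCNOT (c t : ℕ) : QState →ₗ[ℂ] QState :=
  if c = t then LinearMap.id else linExt fun x => ket (Function.update x t (x t + x c))

/-- Toffoli gate with controls `c`, `d` and target `t`; no effect unless the target is distinct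
from the controls. -/
def gateToffoli (c d t : ℕ) : QState →ₗ[ℂ] QState :=
  if c = t ∨ d = t then LinearMap.id
  else linExt fun x => ket (Function.update x t (x t + x c * x d))

/-- The oracle `|b⟩|x⟩ ↦ |b + h x⟩|x⟩` for `h`, with `b` in qubit `t` and `x` in the `n` qubits
`a, …, a + n - 1`; no effect if qubit `t` is one of the latter. -/
def gateOracle {n : ℕ} (h : BoolFun n) (t a : ℕ) : QState →ₗ[ℂ] QState :=
  if a ≤ t ∧ t < a + n then LinearMap.id
  else linExt fun x => ket (Function.update x t (x t + h fun i : Fin n => x (a + i)))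

/-- Projection onto the outcome `b` of a computational basis measurement of qubit `q`. -/
def project (q : ℕ) (b : ZMod 2) (ψ : QState) : QState := ψ.filter fun x => x q = b

/-! ### Quantum random access machines

Programs of a classical random access machine that controls the qubits.  The classical store
consists of registers (addressed by constants of the program) and of a memory (addressed by
the contents of registers), all holding natural numbers. -/

/-- Programs.  The arguments are numbers of registers, except for the constant `k` in `const`. -/
inductive Prog : Type
  /-- no operation -/
  | skip
  /-- `reg d := k` -/
  | const (d k : ℕ)
  /-- `reg d := reg a + reg b` -/
  | add (d a b : ℕ)
  /-- `reg d := reg a - reg b`, truncated at zero -/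
  | sub (d a b : ℕ)
  /-- `reg d := mem (reg a)` -/
  | load (d a : ℕ)
  /-- `mem (reg a) := reg b` -/
  | store (a b : ℕ)
  /-- Hadamard gate on qubit `reg a` -/
  | had (a : ℕ)
  /-- NOT gate on qubit `reg a` -/
  | not (a : ℕ)
  /-- phase gate on qubit `reg a` -/
  | phase (a : ℕ)
  /-- controlled NOT with control qubit `reg a` and target qubit `reg b` -/
  | cnot (a b : ℕ)
  /-- Toffoli gate with control qubits `reg a`, `reg b` and target qubit `reg d` -/
  | toffoli (a b d : ℕ)
  /-- one query to the first oracle, on target qubit `reg a` and the input qubits from `reg b` -/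
  | queryF (a b : ℕ)
  /-- one query to the second oracle, on target qubit `reg a` and the input qubits from `reg b` -/
  | queryG (a b : ℕ)
  /-- measure qubit `reg a` and put the outcome into register `d` -/
  | measure (d a : ℕ)
  /-- sequential composition -/
  | seq (P Q : Prog)
  /-- run `P` if `reg a ≠ 0` and `Q` otherwise -/
  | ite (a : ℕ) (P Q : Prog)
  /-- run `P` as long as `reg a ≠ 0` -/
  | while (a : ℕ) (P : Prog)

/-- A configuration of one branch of a computation: the stack of programs that remain to be
run, the classical store and the (unnormalised) quantum state. -/
structure Config : Type where
  stack : List Prog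
  reg : ℕ → ℕ
  mem : ℕ → ℕ
  state : QState

/-- The machine has halted. -/
def Config.Halted (c : Config) : Prop := c.stack = []

/-- The next step is an oracle query. -/
def Config.AtQuery (c : Config) : Prop :=
  ∃ a b K, c.stack = Prog.queryF a b :: K ∨ c.stack = Prog.queryG a b :: K

/-- The first `n` memory cells hold the bits of `s`. -/
def Config.Output {n : ℕ} (c : Config) (s : Cube n) : Prop :=
  ∀ i : Fin n, c.mem i = (s i).val

/-- One step of the machine with oracles for `f` and `g`: the list of the configurations that may
follow.  A measurement has two possible outcomes, every other step is deterministic; a machine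
that has halted stays as it is. -/
def step {n : ℕ} (f g : BoolFun n) : Config → List Config
  | ⟨[], r, m, ψ⟩ => [⟨[], r, m, ψ⟩]
  | ⟨.skip :: K, r, m, ψ⟩ => [⟨K, r, m, ψ⟩]
  | ⟨.const d k :: K, r, m, ψ⟩ => [⟨K, Function.update r d k, m, ψ⟩]
  | ⟨.add d a b :: K, r, m, ψ⟩ => [⟨K, Function.update r d (r a + r b), m, ψ⟩]
  | ⟨.sub d a b :: K, r, m, ψ⟩ => [⟨K, Function.update r d (r a - r b), m, ψ⟩]
  | ⟨.load d a :: K, r, m, ψ⟩ => [⟨K, Function.update r d (m (r a)), m, ψ⟩]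
  | ⟨.store a b :: K, r, m, ψ⟩ => [⟨K, r, Function.update m (r a) (r b), ψ⟩]
  | ⟨.had a :: K, r, m, ψ⟩ => [⟨K, r, m, gateH (r a) ψ⟩]
  | ⟨.not a :: K, r, m, ψ⟩ => [⟨K, r, m, gateX (r a) ψ⟩]
  | ⟨.phase a :: K, r, m, ψ⟩ => [⟨K, r, m, gateZ (r a) ψ⟩]
  | ⟨.cnot a b :: K, r, m, ψ⟩ => [⟨K, r, m, gateCNOT (r a) (r b) ψ⟩]
  | ⟨.toffoli a b d :: K, r, m, ψ⟩ => [⟨K, r, m, gateToffoli (r a) (r b) (r d) ψ⟩]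
  | ⟨.queryF a b :: K, r, m, ψ⟩ => [⟨K, r, m, gateOracle f (r a) (r b) ψ⟩]
  | ⟨.queryG a b :: K, r, m, ψ⟩ => [⟨K, r, m, gateOracle g (r a) (r b) ψ⟩]
  | ⟨.measure d a :: K, r, m, ψ⟩ =>
      [⟨K, Function.update r d 0, m, project (r a) 0 ψ⟩,
       ⟨K, Function.update r d 1, m, project (r a) 1 ψ⟩]
  | ⟨.seq P Q :: K, r, m, ψ⟩ => [⟨P :: Q :: K, r, m, ψ⟩]
  | ⟨.ite a P Q :: K, r, m, ψ⟩ => [⟨(if r a ≠ 0 then P else Q) :: K, r, m, ψ⟩]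
  | ⟨.while a P :: K, r, m, ψ⟩ =>
      [⟨if r a ≠ 0 then P :: .while a P :: K else K, r, m, ψ⟩]

/-- All branches of a computation after `T` steps. -/
def run {n : ℕ} (f g : BoolFun n) : ℕ → Config → List Config
  | 0, c => [c]
  | T + 1, c => (step f g c).flatMap (run f g T)

/-- The initial configuration: register `0` holds `n`, everything else is zero. -/
def start (P : Prog) (n : ℕ) : Config :=
  ⟨[P], Function.update (fun _ => 0) 0 n, fun _ => 0, ket fun _ => 0⟩

open Classical in
/-- The probability that the configuration of `P` after `T` steps has the property `E`: the total
squared norm of the branches with this property. -/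
def prob (P : Prog) {n : ℕ} (f g : BoolFun n) (T : ℕ) (E : Config → Prop) : ℝ≥0∞ :=
  ((run f g T (start P n)).map fun c => if E c then normSq c.state else 0).sum

/-- The expected running time of `P`, that is, the expected number of steps before it halts. -/
def expectedTime (P : Prog) {n : ℕ} (f g : BoolFun n) : ℝ≥0∞ :=
  ∑' T : ℕ, prob P f g T fun c => ¬ c.Halted

/-- The expected number of oracle queries of `P`, by linearity of the expectation. -/
def expectedQueries (P : Prog) {n : ℕ} (f g : BoolFun n) : ℝ≥0∞ :=
  ∑' T : ℕ, prob P f g T Config.AtQuery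

/-- With probability one, `P` halts with output `s`. -/
def Solves (P : Prog) {n : ℕ} (f g : BoolFun n) (s : Cube n) : Prop :=
  Filter.Tendsto (fun T => prob P f g T fun c => c.Halted ∧ c.Output s) Filter.atTop (nhds 1)

end

end HiddenShift

/-!
The state `2⁻ⁿ ∑_{w,x} (-1)^(w · x + f x) |w⟩ |f x + g x⟩`, which takes one query to each oracle, is
`∑_w F̂(w) |w⟩ |w · s⟩`, where `F̂` is the Fourier transform of `(-1)^f`: a shift of the function by
`s` multiplies the coefficient at `w` by `(-1)^(w · s)` (`sample_apply`).  So a measurement yields a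
random `w` together with `w · s`, a linear equation for `s`, and by Parseval's identity the
probability of `v · w = 1` is the influence of `v` (`successProb_eq_influence`).

The program keeps an affine space `R 0 + span (R 1, …, R k)` that contains `s`, at first all of
`ℤ₂ⁿ`.  A sample `w` with `w · R k = 1` cuts it down to a hyperplane transversal to `R k`, and one
step of elimination gives a basis of the hyperplane (`Rows.eliminate`).  After `n` such samples only
`s` is left.  As `R k ≠ 0`, a sample is good with probability `sin² θ ≥ γ`.  Amplitude amplification
with `r` steps raises this to `sin² ((2 r + 1) θ)` (`exists_iterate_ampStep`); whether `w · R k = 1`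
is copied to an additional qubit, the success flag, and measured first.

Since `θ` is unknown, the number of steps is searched for.  Level `j` takes `2 * 3 ^ j` queries and
succeeds with probability `sin² (3 ^ j θ)`, which is at least `1 / 2` for some level `q` with
`3 ^ q = O (1 / sin θ)` (`exists_good_level`).  Round `J = 0, 1, 2, …` of the search tries each of
the levels `0, …, J` twice.  Each round from `q` on fails with probability at most `1 / 4` and is
three times as expensive as the one before, so the expected number of queries of a search is
`O (3 ^ q)`; a potential function makes this precise (`potential_step`).  No level other than `q`
needs to succeed with any particular probability.

The machine model enters through `Runs` and `Triple`, which say that a program leads to a certain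
assertion within a given time and with a given number of queries, on all branches of nonzero norm,
and through the unitarity of its gates (`sum_normSq_step`), which turns such statements into bounds
for expectations (`Runs.queries_le`, `Runs.time_le`).  A trial of level `j` takes time
`O (3 ^ j n + n²)` for its `2 * 3 ^ j` queries, so the expected time is `O (n² Q)`, and `n ≤ Q` as
each of the `n` searches takes a query (`AtHead.le_queries`).

The qubits `0, …, n - 1` hold `w`, qubit `n` holds `w · s`, and qubit `n + 1` is the success flag.
The registers `0`, `1`, `7`, `8`, `9` hold the constants `n`, `1`, `n + 1`, `(n + 1)²`, `0`.
Register `2` holds the number `k` of directions left, and register `3` the address `k (n + 1)` of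
`R k`.  Registers `4`, `5`, `6` hold the state of the search (`SearchRegs`), and the registers from
`10` on are for temporary use.  The memory holds the rows `R j` at the addresses `j (n + 1)`, and the
latest sample at the address `(n + 1)²`.
-/

namespace HiddenShift

noncomputable section

/-! ### Expected costs -/

/-- The total squared norm of the branches that satisfy `E` after `T` steps from `c`. -/
def mass {n : ℕ} (f g : BoolFun n) (E : Config → Prop) (T : ℕ) (c : Config) : ℝ≥0∞ :=
  open Classical in ((run f g T c).map fun c => if E c then normSq c.state else 0).sum

/-- The expected number of visits to `E` during the first `T` steps from `c`. -/
def partialCost {n : ℕ} (f g : BoolFun n) (E : Config → Prop) (T : ℕ) (c : Config) : ℝ≥0∞ :=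
  ∑ t ∈ Finset.range T, mass f g E t c

/-- The expected number of visits to `E` from `c` on. -/
def totalCost {n : ℕ} (f g : BoolFun n) (E : Config → Prop) (c : Config) : ℝ≥0∞ :=
  ∑' t, mass f g E t c

section Costs

variable {n : ℕ} {f g : BoolFun n} {E : Config → Prop}

open Classical in
lemma mass_zero (c : Config) :
    mass f g E 0 c = if E c then normSq c.state else 0 := by
  simp [mass, run]

lemma sum_map_flatMap {α β : Type*} (L : List α) (F : α → List β) (w : β → ℝ≥0∞) :
    ((L.flatMap F).map w).sum = (L.map fun a => ((F a).map w).sum).sum := by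
  induction L with
  | nil => simp
  | cons a L ih => simp [ih]

lemma mass_succ (T : ℕ) (c : Config) :
    mass f g E (T + 1) c = ((step f g c).map (mass f g E T)).sum := by
  simp only [mass, run, sum_map_flatMap]
  rfl

lemma partialCost_succ (T : ℕ) (c : Config) :
    partialCost f g E (T + 1) c
      = mass f g E 0 c + ((step f g c).map (partialCost f g E T)).sum := by
  have h : ∀ L : List Config, (L.map (partialCost f g E T)).sum
      = ∑ t ∈ Finset.range T, (L.map (mass f g E t)).sum := by
    intro L
    induction L with
    | nil => simp
    | cons a L ih => simp [ih, Finset.sum_add_distrib, partialCost]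
  rw [h, partialCost, Finset.sum_range_succ', add_comm]
  simp only [mass_succ]

lemma partialCost_le_succ (T : ℕ) (c : Config) :
    partialCost f g E T c ≤ partialCost f g E (T + 1) c := by
  rw [partialCost, partialCost, Finset.sum_range_succ]
  exact le_self_add

lemma totalCost_eq (c : Config) :
    totalCost f g E c = mass f g E 0 c + ((step f g c).map (totalCost f g E)).sum := by
  have h : ∀ L : List Config, (L.map (totalCost f g E)).sum
      = ∑' t, (L.map (mass f g E t)).sum := by
    intro L
    induction L with
    | nil => simp
    | cons a L ih => simp [ih, ENNReal.tsum_add, totalCost]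
  rw [h, totalCost, tsum_eq_zero_add' ENNReal.summable]
  simp only [mass_succ]

lemma totalCost_eq_iSup (c : Config) :
    totalCost f g E c = ⨆ T, partialCost f g E T c :=
  ENNReal.tsum_eq_iSup_nat

end Costs

/-! ### Unitarity of the gates -/

/-- The character `b ↦ (-1)ᵇ` of `ℤ₂`. -/
def sgn (b : ZMod 2) : ℂ := (-1) ^ b.val

@[simp] lemma sgn_zero : sgn 0 = 1 := by simp [sgn]

@[simp] lemma sgn_one : sgn 1 = -1 := by simp [sgn, ZMod.val_one]

lemma zmod_two_cases (a : ZMod 2) : a = 0 ∨ a = 1 := by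
  revert a; decide

lemma zmod_two_add_self (a : ZMod 2) : a + a = 0 := CharTwo.add_self_eq_zero a

lemma sgn_add (a b : ZMod 2) : sgn (a + b) = sgn a * sgn b := by
  rcases zmod_two_cases a with rfl | rfl <;> rcases zmod_two_cases b with rfl | rfl <;>
    simp [zmod_two_add_self]

@[simp] lemma norm_sgn (a : ZMod 2) : ‖sgn a‖ = 1 := by
  simp [sgn]

@[simp] lemma linExt_ket (U : Label → QState) (x : Label) : linExt U (ket x) = U x := by
  simp [linExt, ket]

lemma linearMap_ext_ket {M : Type*} [AddCommMonoid M] [Module ℂ M] {U V : QState →ₗ[ℂ] M}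
    (h : ∀ x, U (ket x) = V (ket x)) : U = V := by
  refine Finsupp.lhom_ext fun x a => ?_
  have : Finsupp.single x a = a • ket x := by simp [ket]
  rw [this, map_smul, map_smul, h]

lemma normSq_eq_tsum (ψ : QState) : normSq ψ = ∑' x, ENNReal.ofReal (‖ψ x‖ ^ 2) := by
  rw [normSq, Finsupp.sum, tsum_eq_sum]
  intro x hx
  simp [Finsupp.notMem_support_iff.1 hx]

lemma normSq_ne_top (ψ : QState) : normSq ψ ≠ ⊤ := by
  simp [normSq, Finsupp.sum]

@[simp] lemma normSq_zero : normSq 0 = 0 := by simp [normSq]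

lemma normSq_smul_ket (a : ℂ) (x : Label) : normSq (a • ket x) = ENNReal.ofReal (‖a‖ ^ 2) := by
  simp [normSq, ket]

/-- A gate that permutes the basis states by an involution, up to phases, acts on amplitudes by
pulling back along the involution. -/
lemma linExt_perm_apply {σ : Label → Label} (hσ : Function.Involutive σ) (a : Label → ℂ)
    (ψ : QState) (y : Label) :
    linExt (fun x => a x • ket (σ x)) ψ y = a (σ y) * ψ (σ y) := by
  have : (Finsupp.lapply y).comp (linExt fun x => a x • ket (σ x))
      = a (σ y) • (Finsupp.lapply (σ y) : QState →ₗ[ℂ] ℂ) := by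
    refine linearMap_ext_ket fun x => ?_
    rw [LinearMap.comp_apply, linExt_ket]
    by_cases h : x = σ y
    · subst h
      simp [ket, hσ y]
    · have h' : σ x ≠ y := fun e => h (by rw [← e, hσ x])
      simp [ket, Ne.symm h, h']
  exact LinearMap.congr_fun this ψ

lemma normSq_linExt_perm {σ : Label → Label} (hσ : Function.Involutive σ) {a : Label → ℂ}
    (ha : ∀ x, ‖a x‖ = 1) (ψ : QState) :
    normSq (linExt (fun x => a x • ket (σ x)) ψ) = normSq ψ := by
  simp only [normSq_eq_tsum, linExt_perm_apply hσ, norm_mul, ha, one_mul]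
  exact (hσ.toPerm σ).tsum_eq fun x => ENNReal.ofReal (‖ψ x‖ ^ 2)

lemma normSq_linExt_ket {σ : Label → Label} (hσ : Function.Involutive σ) (ψ : QState) :
    normSq (linExt (fun x => ket (σ x)) ψ) = normSq ψ := by
  simpa using normSq_linExt_perm hσ (a := fun _ => 1) (by simp) ψ

lemma involutive_update_add (q : ℕ) (h : Label → ZMod 2)
    (hh : ∀ x b, h (Function.update x q b) = h x) :
    Function.Involutive fun x : Label => Function.update x q (x q + h x) := by
  intro x
  simp [hh, add_assoc, zmod_two_add_self]

lemma involutive_flip (q : ℕ) :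
    Function.Involutive fun x : Label => Function.update x q (x q + 1) :=
  involutive_update_add q (fun _ => 1) fun _ _ => rfl

lemma involutive_cnot {c t : ℕ} (h : c ≠ t) :
    Function.Involutive fun x : Label => Function.update x t (x t + x c) :=
  involutive_update_add t (fun x => x c) fun x b => by simp [h]

lemma involutive_toffoli {c d t : ℕ} (hc : c ≠ t) (hd : d ≠ t) :
    Function.Involutive fun x : Label => Function.update x t (x t + x c * x d) :=
  involutive_update_add t (fun x => x c * x d) fun x b => by simp [hc, hd]

lemma involutive_oracle {n : ℕ} (h : BoolFun n) {t a : ℕ} (ha : ¬ (a ≤ t ∧ t < a + n)) :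
    Function.Involutive fun x : Label =>
      Function.update x t (x t + h fun i : Fin n => x (a + i)) := by
  refine involutive_update_add t (fun x => h fun i : Fin n => x (a + i)) fun x b => ?_
  congr 1
  funext i
  exact Function.update_of_ne (by omega) _ _

lemma gateH_apply (q : ℕ) (ψ : QState) (y : Label) :
    gateH q ψ y = ((1 / Real.sqrt 2 : ℝ) : ℂ) *
      (ψ (Function.update y q 0) + sgn (y q) * ψ (Function.update y q 1)) := by
  classical
  have : (Finsupp.lapply y).comp (gateH q)
      = ((1 / Real.sqrt 2 : ℝ) : ℂ) • ((Finsupp.lapply (Function.update y q 0)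
        + sgn (y q) • Finsupp.lapply (Function.update y q 1) : QState →ₗ[ℂ] ℂ)) := by
    refine linearMap_ext_ket fun x => ?_
    have key : ∀ b, Function.update x q b = y ↔
        y q = b ∧ Function.update y q (x q) = x := by
      intro b
      constructor
      · rintro rfl
        simp
      · rintro ⟨rfl, h⟩
        rw [← h]
        simp
    have key' : ∀ b, x = Function.update y q b ↔ x q = b ∧ Function.update y q (x q) = x := by
      intro b
      constructor
      · rintro rfl
        simp
      · rintro ⟨rfl, h⟩
        exact h.symm
    rw [gateH, LinearMap.comp_apply, linExt_ket]
    simp only [LinearMap.smul_apply, LinearMap.add_apply, Finsupp.lapply_apply,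
      Finsupp.smul_apply, Finsupp.add_apply, ket, Finsupp.single_apply, key, key', smul_eq_mul]
    congr 1
    by_cases h : Function.update y q (x q) = x
    · rcases zmod_two_cases (x q) with h1 | h1 <;> rcases zmod_two_cases (y q) with h2 | h2 <;>
        simp [h1, h2, h1 ▸ h, sgn, ZMod.val_one]
    · simp [h]
  exact LinearMap.congr_fun this ψ

lemma normSq_gateH (q : ℕ) (ψ : QState) : normSq (gateH q ψ) = normSq ψ := by
  have par : ∀ φ : QState, 2 * normSq φ = ∑' y : Label, (ENNReal.ofReal
      (‖φ (Function.update y q 0)‖ ^ 2 + ‖φ (Function.update y q 1)‖ ^ 2)) := by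
    intro φ
    have h := ((involutive_flip q).toPerm _).tsum_eq fun y => ENNReal.ofReal (‖φ y‖ ^ 2)
    rw [two_mul]
    conv_lhs => rw [normSq_eq_tsum]
    nth_rewrite 1 [← h]
    rw [← ENNReal.tsum_add]
    refine tsum_congr fun y => ?_
    rw [← ENNReal.ofReal_add (by positivity) (by positivity)]
    congr 1
    have e : Function.update y q (y q) = y := by simp
    change ‖φ (Function.update y q (y q + 1))‖ ^ 2 + ‖φ y‖ ^ 2 = _
    rcases zmod_two_cases (y q) with h1 | h1
    · rw [h1] at e ⊢
      rw [e, zero_add, add_comm]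
    · rw [h1] at e ⊢
      rw [e, zmod_two_add_self]
  have h2 : 2 * normSq (gateH q ψ) = 2 * normSq ψ := by
    rw [par, par]
    refine tsum_congr fun y => ?_
    congr 1
    simp only [gateH_apply, Function.update_idem, Function.update_self, sgn_zero, sgn_one,
      norm_mul, mul_pow]
    have := parallelogram_law_with_norm ℝ (ψ (Function.update y q 0)) (ψ (Function.update y q 1))
    have hs : ‖((1 / Real.sqrt 2 : ℝ) : ℂ)‖ ^ 2 = 1 / 2 := by
      rw [Complex.norm_real, Real.norm_eq_abs, sq_abs, div_pow, Real.sq_sqrt (by norm_num)]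
      norm_num
    rw [hs, one_mul, neg_one_mul, ← sub_eq_add_neg]
    linarith
  exact (ENNReal.mul_right_inj (by norm_num) (by norm_num)).1 h2

lemma normSq_project_add (q : ℕ) (ψ : QState) :
    normSq (project q 0 ψ) + normSq (project q 1 ψ) = normSq ψ := by
  simp only [normSq_eq_tsum, ← ENNReal.tsum_add]
  refine tsum_congr fun x => ?_
  rcases zmod_two_cases (x q) with h | h <;> simp [project, h]

/-- The total squared norm is preserved by each step of the machine. -/
lemma sum_normSq_step {n : ℕ} (f g : BoolFun n) (c : Config) :
    ((step f g c).map fun c => normSq c.state).sum = normSq c.state := by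
  obtain ⟨S, r, m, ψ⟩ := c
  rcases S with _ | ⟨P, K⟩
  · simp [step]
  · cases P <;> simp only [step, List.map_cons, List.map_nil, List.sum_cons, List.sum_nil,
      add_zero, normSq_project_add, normSq_gateH]
    · exact normSq_linExt_ket (involutive_flip _) ψ
    · exact normSq_linExt_perm (σ := id) (fun _ => rfl) (fun x => norm_sgn _) ψ
    · rw [gateCNOT]
      split_ifs with h
      · rfl
      · exact normSq_linExt_ket (involutive_cnot h) ψ
    · rw [gateToffoli]
      split_ifs with h
      · rfl
      · exact normSq_linExt_ket (involutive_toffoli (fun e => h (Or.inl e))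
          fun e => h (Or.inr e)) ψ
    · rw [gateOracle]
      split_ifs with h
      · rfl
      · exact normSq_linExt_ket (involutive_oracle f h) ψ
    · rw [gateOracle]
      split_ifs with h
      · rfl
      · exact normSq_linExt_ket (involutive_oracle g h) ψ

/-! ### Terminating stretches of a computation -/

/-- `Runs f g Post τ κ c`: on every branch of nonzero norm, the computation from `c` reaches a
configuration satisfying `Post` after at most `τ` steps that include exactly `κ` queries. -/
inductive Runs {n : ℕ} (f g : BoolFun n) (Post : Config → Prop) : ℕ → ℕ → Config → Prop
  | zero {τ κ : ℕ} {c : Config} : c.state = 0 → Runs f g Post τ κ c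
  | done {τ : ℕ} {c : Config} : Post c → Runs f g Post τ 0 c
  | step {τ κ : ℕ} {c : Config} : ¬ c.Halted → ¬ c.AtQuery →
      (∀ c' ∈ step f g c, Runs f g Post τ κ c') → Runs f g Post (τ + 1) κ c
  | query {τ κ : ℕ} {c : Config} : c.AtQuery →
      (∀ c' ∈ HiddenShift.step f g c, Runs f g Post τ κ c') → Runs f g Post (τ + 1) (κ + 1) c

section Runs

variable {n : ℕ} {f g : BoolFun n} {E Post Post' : Config → Prop} {τ τ' κ κ' T : ℕ} {c : Config}

lemma Runs.weaken (h : Runs f g Post τ κ c) (hτ : τ ≤ τ') : Runs f g Post τ' κ c := by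
  induction h generalizing τ' with
  | zero h => exact .zero h
  | done h => exact .done h
  | step h1 h2 _ ih =>
    obtain ⟨σ, rfl⟩ : ∃ σ, τ' = σ + 1 := ⟨τ' - 1, by omega⟩
    exact .step h1 h2 fun c' hc' => ih c' hc' (by omega)
  | query h1 _ ih =>
    obtain ⟨σ, rfl⟩ : ∃ σ, τ' = σ + 1 := ⟨τ' - 1, by omega⟩
    exact .query h1 fun c' hc' => ih c' hc' (by omega)

lemma Runs.bind (h : Runs f g Post τ κ c) (h' : ∀ c, Post c → Runs f g Post' τ' κ' c) :
    Runs f g Post' (τ + τ') (κ + κ') c := by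
  induction h with
  | zero h => exact .zero h
  | done h => simpa using (h' _ h).weaken (Nat.le_add_left _ _)
  | step h1 h2 _ ih =>
    rw [Nat.add_right_comm]
    exact .step h1 h2 ih
  | query h1 _ ih =>
    rw [Nat.add_right_comm, Nat.add_right_comm _ 1 κ']
    exact .query h1 ih

lemma Runs.mono (h : Runs f g Post τ κ c) (h' : ∀ c, Post c → Post' c) :
    Runs f g Post' τ κ c :=
  h.bind (τ' := 0) (κ' := 0) fun _ hc => .done (h' _ hc)

lemma sum_map_le {α : Type*} {L : List α} {u v : α → ℝ≥0∞} (h : ∀ x ∈ L, u x ≤ v x) :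
    (L.map u).sum ≤ (L.map v).sum :=
  List.sum_le_sum h

lemma sum_map_const_mul {α : Type*} (L : List α) (a : ℝ≥0∞) (u : α → ℝ≥0∞) :
    (L.map fun x => a * u x).sum = a * (L.map u).sum :=
  List.sum_map_mul_left ..

lemma mass_le (T : ℕ) (c : Config) : mass f g E T c ≤ normSq c.state := by
  induction T generalizing c with
  | zero =>
    rw [mass_zero]
    split_ifs <;> simp
  | succ T ih =>
    rw [mass_succ, ← sum_normSq_step f g c]
    exact sum_map_le fun c' _ => ih c'

lemma partialCost_of_state_eq_zero (h : c.state = 0) : partialCost f g E T c = 0 := by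
  refine Finset.sum_eq_zero fun t _ => ?_
  simpa [h] using mass_le (f := f) (g := g) (E := E) t c

lemma Config.AtQuery.not_halted (h : c.AtQuery) : ¬ c.Halted := by
  rcases h with ⟨a, b, K, h | h⟩ <;> simp [Config.Halted, h]

/-- Upper bounds for expected costs along a stretch of a computation: `α` per step and
`β` extra per query. -/
lemma Runs.partialCost_le (h : Runs f g Post τ κ c) {α β Φ : ℝ≥0∞}
    (hα : ∀ c, ¬ c.Halted → ¬ c.AtQuery → mass f g E 0 c ≤ α * normSq c.state)
    (hβ : ∀ c, c.AtQuery → mass f g E 0 c ≤ (α + β) * normSq c.state)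
    (hΦ : ∀ c, Post c → partialCost f g E T c ≤ Φ * normSq c.state) :
    partialCost f g E T c ≤ (τ * α + κ * β + Φ) * normSq c.state := by
  induction h with
  | zero h => simp [partialCost_of_state_eq_zero h]
  | done h =>
    refine (hΦ _ h).trans ?_
    gcongr
    exact le_add_self
  | @step τ κ c h1 h2 _ ih =>
    refine (partialCost_le_succ T c).trans ?_
    rw [partialCost_succ]
    have := sum_map_le ih
    rw [sum_map_const_mul, sum_normSq_step] at this
    refine (add_le_add (hα _ h1 h2) this).trans (le_of_eq ?_)
    push_cast
    ring
  | @query τ κ c h1 _ ih =>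
    refine (partialCost_le_succ T c).trans ?_
    rw [partialCost_succ]
    have := sum_map_le ih
    rw [sum_map_const_mul, sum_normSq_step] at this
    refine (add_le_add (hβ _ h1) this).trans (le_of_eq ?_)
    push_cast
    ring

lemma Runs.queries_le (h : Runs f g Post τ κ c) {Φ : ℝ≥0∞}
    (hΦ : ∀ c, Post c → partialCost f g Config.AtQuery T c ≤ Φ * normSq c.state) :
    partialCost f g Config.AtQuery T c ≤ (κ + Φ) * normSq c.state := by
  have := h.partialCost_le (α := 0) (β := 1) (T := T) (Φ := Φ) (E := Config.AtQuery)
    (fun c _ h => by simp [mass_zero, h]) (fun c h => by simp [mass_zero, h]) hΦ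
  simpa using this

/-- Configurations that have halted with a wrong result cannot appear in such a stretch. -/
lemma Runs.halted_eq_zero (h : Runs f g Post τ κ c) {R : Config → Prop}
    (hΦ : ∀ c, Post c → partialCost f g (fun c => c.Halted ∧ R c) T c = 0) :
    partialCost f g (fun c => c.Halted ∧ R c) T c = 0 := by
  have := h.partialCost_le (α := 0) (β := 0) (T := T) (Φ := 0)
    (E := fun c => c.Halted ∧ R c)
    (fun c h _ => by simp [mass_zero, h])
    (fun c h => by simp [mass_zero, h.not_halted])
    (fun c hc => by simp [hΦ c hc])
  simpa using this

lemma Runs.le_totalCost (h : Runs f g Post τ κ c) {Φ : ℝ≥0∞}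
    (hΦ : ∀ c, Post c → Φ * normSq c.state ≤ totalCost f g Config.AtQuery c) :
    (κ + Φ) * normSq c.state ≤ totalCost f g Config.AtQuery c := by
  induction h with
  | zero h => simp [h]
  | done h => simpa using hΦ _ h
  | @step τ κ c h1 h2 _ ih =>
    rw [totalCost_eq]
    have := sum_map_le ih
    rw [sum_map_const_mul, sum_normSq_step] at this
    exact this.trans le_add_self
  | @query τ κ c h1 _ ih =>
    rw [totalCost_eq]
    have := sum_map_le ih
    rw [sum_map_const_mul, sum_normSq_step] at this
    have h2 : mass f g Config.AtQuery 0 c = normSq c.state := by simp [mass_zero, h1]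
    rw [h2]
    refine le_trans (le_of_eq ?_) (add_le_add_right this _)
    push_cast
    ring

/-- Comparison of the expected time with the expected number of queries. -/
lemma Runs.time_le (h : Runs f g Post τ κ c) {A : ℕ}
    (hA : ∀ c, Post c → partialCost f g (fun c => ¬ c.Halted) T c
      ≤ A * totalCost f g Config.AtQuery c + normSq c.state) :
    partialCost f g (fun c => ¬ c.Halted) T c + A * κ * normSq c.state
      ≤ τ * normSq c.state + (A * totalCost f g Config.AtQuery c + normSq c.state) := by
  have aux : ∀ {τ κ : ℕ} {c : Config}, (∀ c' ∈ HiddenShift.step f g c,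
      partialCost f g (fun c => ¬ c.Halted) T c' + A * κ * normSq c'.state
      ≤ τ * normSq c'.state + (A * totalCost f g Config.AtQuery c' + normSq c'.state)) →
      partialCost f g (fun c => ¬ c.Halted) T c + A * κ * normSq c.state
      ≤ normSq c.state + (τ * normSq c.state
        + (A * ((HiddenShift.step f g c).map (totalCost f g Config.AtQuery)).sum
          + normSq c.state)) := by
    intro τ κ c ih
    have h1 := sum_map_le ih
    simp only [List.sum_map_add, sum_map_const_mul, sum_normSq_step] at h1
    have h2 := partialCost_le_succ (f := f) (g := g) (E := fun c => ¬ c.Halted) T c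
    rw [partialCost_succ] at h2
    refine (add_le_add_left h2 _).trans ?_
    rw [add_assoc]
    exact add_le_add (mass_le 0 c) h1
  induction h with
  | zero h => simp [partialCost_of_state_eq_zero h, h]
  | done h =>
    refine le_trans ?_ ((hA _ h).trans le_add_self)
    simp
  | @step τ κ c h1 h2 _ ih =>
    refine (aux ih).trans ?_
    rw [totalCost_eq, ← add_assoc]
    gcongr
    · refine le_of_eq ?_
      push_cast
      ring
    · exact le_add_self
  | @query τ κ c h1 _ ih =>
    have h2 : mass f g Config.AtQuery 0 c = normSq c.state := by simp [mass_zero, h1]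
    rw [totalCost_eq, h2]
    calc _ = partialCost f g (fun c => ¬ c.Halted) T c + A * κ * normSq c.state
          + A * normSq c.state := by
          push_cast
          ring
      _ ≤ _ := add_le_add_left (aux ih) _
      _ = _ := by
        push_cast
        ring

end Runs

/-! ### A program logic -/

/-- Assertions about the registers, the memory and the quantum state. -/
abbrev Assn : Type := (ℕ → ℕ) → (ℕ → ℕ) → QState → Prop

/-- `Triple f g Pre P τ κ Post`: from a state satisfying `Pre`, on every branch of nonzero norm the
program `P` ends in a state satisfying `Post` after at most `τ` steps with exactly `κ` queries. -/
def Triple {n : ℕ} (f g : BoolFun n) (Pre : Assn) (P : Prog) (τ κ : ℕ) (Post : Assn) : Prop :=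
  ∀ K r m ψ, Pre r m ψ →
    Runs f g (fun c => c.stack = K ∧ Post c.reg c.mem c.state) τ κ ⟨P :: K, r, m, ψ⟩

/-- The weakest precondition of a program without loops and queries. -/
def wp : Prog → Assn → Assn
  | .skip, Q => Q
  | .const d k, Q => fun r m ψ => Q (Function.update r d k) m ψ
  | .add d a b, Q => fun r m ψ => Q (Function.update r d (r a + r b)) m ψ
  | .sub d a b, Q => fun r m ψ => Q (Function.update r d (r a - r b)) m ψ
  | .load d a, Q => fun r m ψ => Q (Function.update r d (m (r a))) m ψ
  | .store a b, Q => fun r m ψ => Q r (Function.update m (r a) (r b)) ψ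
  | .had a, Q => fun r m ψ => Q r m (gateH (r a) ψ)
  | .not a, Q => fun r m ψ => Q r m (gateX (r a) ψ)
  | .phase a, Q => fun r m ψ => Q r m (gateZ (r a) ψ)
  | .cnot a b, Q => fun r m ψ => Q r m (gateCNOT (r a) (r b) ψ)
  | .toffoli a b d, Q => fun r m ψ => Q r m (gateToffoli (r a) (r b) (r d) ψ)
  | .queryF _ _, _ => fun _ _ _ => False
  | .queryG _ _, _ => fun _ _ _ => False
  | .measure d a, Q => fun r m ψ =>
      Q (Function.update r d 0) m (project (r a) 0 ψ) ∧
      Q (Function.update r d 1) m (project (r a) 1 ψ)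
  | .seq P P', Q => wp P (wp P' Q)
  | .ite a P P', Q => fun r m ψ => (r a ≠ 0 → wp P Q r m ψ) ∧ (r a = 0 → wp P' Q r m ψ)
  | .while _ _, _ => fun _ _ _ => False

/-- The largest possible number of steps of a program without loops. -/
def duration : Prog → ℕ
  | .seq P Q => duration P + duration Q + 1
  | .ite _ P Q => max (duration P) (duration Q) + 1
  | _ => 1

section Triple

variable {n : ℕ} {f g : BoolFun n} {Pre Pre' Mid Post Post' : Assn} {P P' : Prog}
  {τ τ' κ κ' : ℕ}

lemma Triple.conseq (h : Triple f g Pre P τ κ Post) (hPre : ∀ r m ψ, Pre' r m ψ → Pre r m ψ)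
    (hPost : ∀ r m ψ, Post r m ψ → Post' r m ψ) (hτ : τ ≤ τ') :
    Triple f g Pre' P τ' κ Post' := fun K r m ψ hp =>
  ((h K r m ψ (hPre _ _ _ hp)).mono fun _ hc => ⟨hc.1, hPost _ _ _ hc.2⟩).weaken hτ

lemma runs_step {Q : Config → Prop} {K : List Prog} {r m : ℕ → ℕ} {ψ : QState}
    (h1 : ∀ a b, P ≠ .queryF a b) (h2 : ∀ a b, P ≠ .queryG a b)
    (h : ∀ c' ∈ step f g ⟨P :: K, r, m, ψ⟩, Runs f g Q τ κ c') :
    Runs f g Q (τ + 1) κ ⟨P :: K, r, m, ψ⟩ := by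
  refine .step (by simp [Config.Halted]) ?_ h
  rintro ⟨a, b, K', h | h⟩
  · exact h1 a b (List.cons.inj h).1
  · exact h2 a b (List.cons.inj h).1

lemma Triple.seq (h : Triple f g Pre P τ κ Mid) (h' : Triple f g Mid P' τ' κ' Post) :
    Triple f g Pre (.seq P P') (τ + τ' + 1) (κ + κ') Post := by
  intro K r m ψ hp
  refine runs_step (by simp) (by simp) fun c' hc' => ?_
  obtain rfl : c' = _ := by simpa [step] using hc'
  refine (h (P' :: K) r m ψ hp).bind ?_
  rintro ⟨S, r', m', ψ'⟩ ⟨rfl, hc⟩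
  exact h' K r' m' ψ' hc

lemma Triple.ite {a : ℕ} (h : Triple f g (fun r m ψ => Pre r m ψ ∧ r a ≠ 0) P τ κ Post)
    (h' : Triple f g (fun r m ψ => Pre r m ψ ∧ r a = 0) P' τ' κ Post) :
    Triple f g Pre (.ite a P P') (max τ τ' + 1) κ Post := by
  intro K r m ψ hp
  refine runs_step (by simp) (by simp) fun c' hc' => ?_
  obtain rfl : c' = _ := by simpa [step] using hc'
  by_cases ha : r a = 0
  · rw [if_pos ha]
    exact (h' K r m ψ ⟨hp, ha⟩).weaken (le_max_right _ _)
  · rw [if_neg ha]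
    exact (h K r m ψ ⟨hp, ha⟩).weaken (le_max_left _ _)

lemma Triple.queryF {a b : ℕ} (h : ∀ r m ψ, Pre r m ψ → Post r m (gateOracle f (r a) (r b) ψ)) :
    Triple f g Pre (.queryF a b) 1 1 Post := by
  intro K r m ψ hp
  refine .query ⟨a, b, K, Or.inl rfl⟩ fun c' hc' => ?_
  obtain rfl : c' = _ := by simpa [step] using hc'
  exact .done ⟨rfl, h r m ψ hp⟩

lemma Triple.queryG {a b : ℕ} (h : ∀ r m ψ, Pre r m ψ → Post r m (gateOracle g (r a) (r b) ψ)) :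
    Triple f g Pre (.queryG a b) 1 1 Post := by
  intro K r m ψ hp
  refine .query ⟨a, b, K, Or.inr rfl⟩ fun c' hc' => ?_
  obtain rfl : c' = _ := by simpa [step] using hc'
  exact .done ⟨rfl, h r m ψ hp⟩

/-- A program without loops and queries ends in `Q` if it starts in `wp P Q`. -/
lemma triple_wp (P : Prog) (Q : Assn) : Triple f g (wp P Q) P (duration P) 0 Q := by
  induction P generalizing Q with
  | seq P P' ih ih' => exact (ih _).seq (ih' Q)
  | ite a P P' ih ih' =>
    exact Triple.ite ((ih Q).conseq (fun r m ψ h => h.1.1 h.2) (fun _ _ _ h => h) le_rfl)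
      ((ih' Q).conseq (fun r m ψ h => h.1.2 h.2) (fun _ _ _ h => h) le_rfl)
  | measure d a =>
    intro K r m ψ h
    refine runs_step (τ := 0) (by simp) (by simp) fun c' hc' => ?_
    obtain rfl | rfl : c' = _ ∨ c' = _ := by simpa [step] using hc'
    · exact .done ⟨rfl, h.1⟩
    · exact .done ⟨rfl, h.2⟩
  | _ =>
    intro K r m ψ h
    first
    | exact False.elim h
    | refine runs_step (τ := 0) (by simp) (by simp) fun c' hc' => ?_
      obtain rfl : c' = _ := by simpa [step] using hc'
      exact .done ⟨rfl, h⟩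

lemma triple_of_wp (h : ∀ r m ψ, Pre r m ψ → wp P Post r m ψ) (hτ : duration P ≤ τ) :
    Triple f g Pre P τ 0 Post :=
  (triple_wp P Post).conseq h (fun _ _ _ h => h) hτ

/-- Branches on which the state vanishes may be ignored. -/
lemma Triple.of_ne_zero (h : Triple f g (fun r m ψ => ψ ≠ 0 ∧ Pre r m ψ) P τ κ Post) :
    Triple f g Pre P τ κ Post := by
  intro K r m ψ hp
  by_cases hψ : ψ = 0
  · exact .zero hψ
  · exact h K r m ψ ⟨hψ, hp⟩

end Triple

/-- For `i = N - 1, …, 0` with `N` the content of register `src`: put `i` into register `ctr` and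
run `P`.  The registers `1` and `9` are assumed to hold `1` and `0`. -/
def countdown (ctr src : ℕ) (P : Prog) : Prog :=
  .seq (.add ctr src 9) (.while ctr (.seq (.sub ctr ctr 1) P))

section Countdown

variable {n : ℕ} {f g : BoolFun n} {P : Prog} {τ κ : ℕ}

lemma triple_while_countdown {ctr N : ℕ} {I : ℕ → Assn}
    (hbody : ∀ i < N, Triple f g (fun r m ψ => I (i + 1) r m ψ ∧ r ctr = i + 1)
      P τ κ (fun r m ψ => I i r m ψ ∧ r ctr = i)) :
    Triple f g (fun r m ψ => I N r m ψ ∧ r ctr = N) (.while ctr P)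
      (N * (τ + 1) + 1) (N * κ) (I 0) := by
  induction N with
  | zero =>
    rintro K r m ψ ⟨h, hr⟩
    refine runs_step (by simp) (by simp) fun c' hc' => ?_
    obtain rfl : c' = _ := by simpa [step] using hc'
    rw [if_pos hr]
    simp only [zero_mul]
    exact .done ⟨rfl, h⟩
  | succ N ih =>
    rintro K r m ψ ⟨h, hr⟩
    have e1 : (N + 1) * (τ + 1) + 1 = τ + (N * (τ + 1) + 1) + 1 := by ring
    have e2 : (N + 1) * κ = κ + N * κ := by ring
    rw [e1, e2]
    refine runs_step (by simp) (by simp) fun c' hc' => ?_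
    obtain rfl : c' = _ := by simpa [step] using hc'
    rw [if_neg (by omega)]
    refine (hbody N N.lt_succ_self _ r m ψ ⟨h, hr⟩).bind ?_
    rintro ⟨S, r', m', ψ'⟩ ⟨rfl, hc⟩
    exact ih (fun i hi => hbody i (by omega)) _ r' m' ψ' hc

lemma triple_countdown {ctr src N : ℕ} {I : ℕ → Assn}
    (hsrc : ∀ r m ψ, I N r m ψ → r src = N ∧ r 9 = 0)
    (hone : ∀ i r m ψ, I i r m ψ → r 1 = 1)
    (hins : ∀ i r m ψ x, I i r m ψ → I i (Function.update r ctr x) m ψ)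
    (hbody : ∀ i < N, Triple f g (fun r m ψ => I (i + 1) r m ψ ∧ r ctr = i)
      P τ κ (fun r m ψ => I i r m ψ ∧ r ctr = i)) :
    Triple f g (I N) (countdown ctr src P) (N * (τ + 3) + 3) (N * κ) (I 0) := by
  have h1 : Triple f g (I N) (.add ctr src 9) 1 0 (fun r m ψ => I N r m ψ ∧ r ctr = N) := by
    refine triple_of_wp (fun r m ψ h => ⟨hins _ _ _ _ _ h, ?_⟩) le_rfl
    simp [hsrc r m ψ h]
  have h2 : ∀ i < N, Triple f g (fun r m ψ => I (i + 1) r m ψ ∧ r ctr = i + 1)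
      (.seq (.sub ctr ctr 1) P) (1 + τ + 1) (0 + κ) (fun r m ψ => I i r m ψ ∧ r ctr = i) := by
    intro i hi
    refine Triple.seq (Mid := fun r m ψ => I (i + 1) r m ψ ∧ r ctr = i)
      (triple_of_wp (fun r m ψ h => ⟨hins _ _ _ _ _ h.1, ?_⟩) le_rfl) (hbody i hi)
    simp [h.2, hone _ _ _ _ h.1]
  have h3 := h1.seq (triple_while_countdown h2)
  rw [zero_add, zero_add] at h3
  refine h3.conseq (fun _ _ _ h => h) (fun _ _ _ h => h) (le_of_eq ?_)
  ring

end Countdown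

/-- The registers below `d` have the same contents. -/
def SameBelow (d : ℕ) (r r' : ℕ → ℕ) : Prop := ∀ a < d, r a = r' a

lemma SameBelow.update {d ctr : ℕ} {r r' : ℕ → ℕ} (h : SameBelow d r r') (hd : d ≤ ctr) (x : ℕ) :
    SameBelow d (Function.update r ctr x) r' := fun a ha => by
  rw [Function.update_of_ne (by omega), h a ha]

lemma SameBelow.mono {d d' : ℕ} {r r' : ℕ → ℕ} (h : SameBelow d r r') (hd : d' ≤ d) :
    SameBelow d' r r' := fun a ha => h a (by omega)

lemma SameBelow.trans {d : ℕ} {r r' r'' : ℕ → ℕ} (h : SameBelow d r r') (h' : SameBelow d r' r'') :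
    SameBelow d r r'' := fun a ha => (h a ha).trans (h' a ha)

/-- With registers `r₀` and memory `m₀`, the program `P` applies the linear map `U` to the quantum
state; it changes no register below `d` and leaves the memory alone. -/
def Implements {n : ℕ} (f g : BoolFun n) (d : ℕ) (r₀ m₀ : ℕ → ℕ) (P : Prog) (τ κ : ℕ)
    (U : QState →ₗ[ℂ] QState) : Prop :=
  ∀ ψ₀, Triple f g (fun r m ψ => SameBelow d r r₀ ∧ m = m₀ ∧ ψ = ψ₀) P τ κ
    (fun r m ψ => SameBelow d r r₀ ∧ m = m₀ ∧ ψ = U ψ₀)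

/-- `G 0 ∘ ⋯ ∘ G (N - 1)` -/
def sweep (G : ℕ → QState →ₗ[ℂ] QState) : ℕ → QState →ₗ[ℂ] QState
  | 0 => LinearMap.id
  | N + 1 => (sweep G N).comp (G N)

section Implements

variable {n : ℕ} {f g : BoolFun n} {d d' τ τ' κ κ' : ℕ} {r₀ m₀ : ℕ → ℕ} {P P' : Prog}
  {U V : QState →ₗ[ℂ] QState}

lemma Implements.seq (h : Implements f g d r₀ m₀ P τ κ U)
    (h' : Implements f g d r₀ m₀ P' τ' κ' V) :
    Implements f g d r₀ m₀ (.seq P P') (τ + τ' + 1) (κ + κ') (V.comp U) :=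
  fun ψ₀ => (h ψ₀).seq (h' (U ψ₀))

lemma Implements.weaken (h : Implements f g d r₀ m₀ P τ κ U) (hτ : τ ≤ τ') :
    Implements f g d r₀ m₀ P τ' κ U :=
  fun ψ₀ => (h ψ₀).conseq (fun _ _ _ h => h) (fun _ _ _ h => h) hτ

lemma implements_of_wp (h : ∀ r ψ, SameBelow d r r₀ →
      wp P (fun r m φ => SameBelow d r r₀ ∧ m = m₀ ∧ φ = U ψ) r m₀ ψ) :
    Implements f g d r₀ m₀ P (duration P) 0 U := by
  intro ψ₀
  refine triple_of_wp ?_ le_rfl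
  rintro r m ψ ⟨hr, rfl, rfl⟩
  exact h r ψ hr

lemma implements_queryF {a b : ℕ} (ha : a < d) (hb : b < d) :
    Implements f g d r₀ m₀ (.queryF a b) 1 1 (gateOracle f (r₀ a) (r₀ b)) := by
  refine fun ψ₀ => Triple.queryF ?_
  rintro r m ψ ⟨hr, rfl, rfl⟩
  exact ⟨hr, rfl, by rw [hr a ha, hr b hb]⟩

lemma implements_queryG {a b : ℕ} (ha : a < d) (hb : b < d) :
    Implements f g d r₀ m₀ (.queryG a b) 1 1 (gateOracle g (r₀ a) (r₀ b)) := by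
  refine fun ψ₀ => Triple.queryG ?_
  rintro r m ψ ⟨hr, rfl, rfl⟩
  exact ⟨hr, rfl, by rw [hr a ha, hr b hb]⟩

lemma implements_countdown {ctr src N : ℕ} {G : ℕ → QState →ₗ[ℂ] QState}
    (hctr : d ≤ ctr) (hd' : ctr < d') (hd : 9 < d) (hsrc : src < d) (h1 : r₀ 1 = 1) (h9 : r₀ 9 = 0)
    (hN : r₀ src = N)
    (hbody : ∀ i < N, ∀ r₁, SameBelow d r₁ r₀ → r₁ ctr = i →
      Implements f g d' r₁ m₀ P τ κ (G i)) :
    Implements f g d r₀ m₀ (countdown ctr src P) (N * (τ + 3) + 3) (N * κ) (sweep G N) := by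
  intro ψ₀
  refine (triple_countdown (I := fun i r m ψ => SameBelow d r r₀ ∧ m = m₀ ∧
    sweep G i ψ = sweep G N ψ₀) ?_ ?_ ?_ ?_).conseq ?_ (fun _ _ _ h => h) le_rfl
  · rintro r m ψ ⟨hr, -, -⟩
    exact ⟨(hr _ hsrc).trans hN, (hr _ hd).trans h9⟩
  · rintro i r m ψ ⟨hr, -, -⟩
    exact (hr _ (by omega)).trans h1
  · rintro i r m ψ x ⟨hr, h⟩
    exact ⟨hr.update hctr x, h⟩
  · rintro i hi K r m ψ ⟨⟨hr, rfl, h⟩, hc⟩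
    refine (hbody i hi r hr hc ψ K r m ψ ⟨fun _ _ => rfl, rfl, rfl⟩).mono ?_
    rintro c ⟨hK, hr', hm, hψ⟩
    refine ⟨hK, ⟨(hr'.mono (by omega)).trans hr, hm, ?_⟩, (hr' _ (by omega)).trans hc⟩
    rw [hψ, ← h]
    rfl
  · rintro r m ψ ⟨hr, hm, rfl⟩
    exact ⟨hr, hm, rfl⟩

end Implements

/-! ### Amplitudes on the data qubits -/

/-- The label with `x` in the qubits `0, …, n - 1`, then `b`, then `c`, and zeros elsewhere. -/
def lab {n : ℕ} (x : Cube n) (b c : ZMod 2) : Label := fun q =>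
  if h : q < n then x ⟨q, h⟩ else if q = n then b else if q = n + 1 then c else 0

/-- Real amplitudes of the `n + 1` data qubits. -/
abbrev Amp (n : ℕ) : Type := Cube n × ZMod 2 → ℝ

/-- The real character `b ↦ (-1)ᵇ` of `ℤ₂`. -/
def rsgn (b : ZMod 2) : ℝ := (-1) ^ b.val

lemma sgn_eq_rsgn (b : ZMod 2) : sgn b = (rsgn b : ℂ) := by simp [sgn, rsgn]

@[simp] lemma rsgn_zero : rsgn 0 = 1 := by simp [rsgn]

@[simp] lemma rsgn_one : rsgn 1 = -1 := by simp [rsgn, ZMod.val_one]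

lemma rsgn_add (a b : ZMod 2) : rsgn (a + b) = rsgn a * rsgn b := by
  rcases zmod_two_cases a with rfl | rfl <;> rcases zmod_two_cases b with rfl | rfl <;>
    simp [zmod_two_add_self]

lemma rsgn_mul_self (a : ZMod 2) : rsgn a * rsgn a = 1 := by
  rw [← rsgn_add, zmod_two_add_self, rsgn_zero]

/-- The state with amplitudes `φ` in the data qubits and `c` in the qubit after them. -/
def emb {n : ℕ} (c : Cube n × ZMod 2 → ZMod 2) (φ : Amp n) : QState :=
  ∑ z, (φ z : ℂ) • ket (lab z.1 z.2 (c z))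

section Lab

variable {n : ℕ} {x : Cube n} {b c : ZMod 2}

@[simp] lemma lab_fin (i : Fin n) : lab x b c i = x i := by simp [lab]

@[simp] lemma lab_self : lab x b c n = b := by simp [lab]

@[simp] lemma lab_succ : lab x b c (n + 1) = c := by simp [lab]

lemma lab_of_gt {q : ℕ} (h : n + 1 < q) : lab x b c q = 0 := by
  have h1 : ¬ q < n := by omega
  have h2 : q ≠ n := by omega
  have h3 : q ≠ n + 1 := by omega
  simp [lab, h1, h2, h3]

lemma update_lab_self (b' : ZMod 2) : Function.update (lab x b c) n b' = lab x b' c := by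
  funext q
  by_cases h : q = n
  · subst h
    simp
  · simp [lab, h]

lemma update_lab_succ (c' : ZMod 2) : Function.update (lab x b c) (n + 1) c' = lab x b c' := by
  funext q
  by_cases h : q = n + 1
  · subst h
    simp
  · simp [lab, h]

lemma lab_zero : lab (0 : Cube n) 0 0 = fun _ => 0 := by
  funext q
  simp [lab]

lemma lab_injective (c : Cube n × ZMod 2 → ZMod 2) :
    Function.Injective fun z : Cube n × ZMod 2 => lab z.1 z.2 (c z) := by
  rintro ⟨x, b⟩ ⟨x', b'⟩ h
  ext i
  · simpa using congrFun h i
  · simpa using congrFun h n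

lemma emb_apply_lab (c : Cube n × ZMod 2 → ZMod 2) (φ : Amp n) (z : Cube n × ZMod 2) :
    emb c φ (lab z.1 z.2 (c z)) = φ z := by
  classical
  rw [emb, Finsupp.finsetSum_apply, Finset.sum_eq_single z]
  · simp [ket]
  · intro z' _ hz
    have : lab z'.1 z'.2 (c z') ≠ lab z.1 z.2 (c z) := fun e => hz (lab_injective c e)
    simp [ket, this]
  · simp

lemma emb_apply_of_ne (c : Cube n × ZMod 2 → ZMod 2) (φ : Amp n) {y : Label}
    (hy : ∀ z : Cube n × ZMod 2, lab z.1 z.2 (c z) ≠ y) : emb c φ y = 0 := by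
  classical
  rw [emb, Finsupp.finsetSum_apply]
  refine Finset.sum_eq_zero fun z _ => ?_
  simp [ket, hy z]

lemma normSq_smul_emb (a : ℂ) (c : Cube n × ZMod 2 → ZMod 2) (φ : Amp n) :
    normSq (a • emb c φ) = ENNReal.ofReal (‖a‖ ^ 2 * ∑ z, φ z ^ 2) := by
  rw [normSq_eq_tsum, ← (lab_injective c).tsum_eq, tsum_fintype, Finset.mul_sum,
    ENNReal.ofReal_sum_of_nonneg fun z _ => by positivity]
  · refine Finset.sum_congr rfl fun z _ => ?_
    simp [emb_apply_lab, mul_pow]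
  · intro y hy
    by_contra h
    refine hy ?_
    simp [emb_apply_of_ne c φ fun z e => h ⟨z, e⟩]

lemma exists_of_mem_support_emb {a : ℂ} {c : Cube n × ZMod 2 → ZMod 2} {φ : Amp n} {y : Label}
    (hy : (a • emb c φ) y ≠ 0) : ∃ z, φ z ≠ 0 ∧ y = lab z.1 z.2 (c z) := by
  by_cases h : ∃ z : Cube n × ZMod 2, lab z.1 z.2 (c z) = y
  · obtain ⟨z, rfl⟩ := h
    refine ⟨z, fun h0 => hy ?_, rfl⟩
    simp [emb_apply_lab, h0]
  · push Not at h
    exact absurd (by simp [emb_apply_of_ne c φ h]) hy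

open Classical in
lemma project_emb (a : ℂ) (c : Cube n × ZMod 2 → ZMod 2) (φ : Amp n) (b : ZMod 2) :
    project (n + 1) b (a • emb c φ) = a • emb c fun z => if c z = b then φ z else 0 := by
  ext y
  rw [project, Finsupp.filter_apply]
  by_cases h : ∃ z : Cube n × ZMod 2, lab z.1 z.2 (c z) = y
  · obtain ⟨z, rfl⟩ := h
    simp only [Finsupp.smul_apply, emb_apply_lab, lab_succ]
    split_ifs <;> simp
  · push Not at h
    simp [emb_apply_of_ne c _ h]

end Lab

/-! ### The effect of the gates on the amplitudes -/

section Gates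

variable {n : ℕ}

/-- The label `y` with the qubits `0, …, N - 1` replaced by `w`. -/
def overwrite {N : ℕ} (w : Cube N) (y : Label) : Label := fun q =>
  if h : q < N then w ⟨q, h⟩ else y q

lemma overwrite_update {N : ℕ} (w : Cube N) (y : Label) (b : ZMod 2) :
    overwrite w (Function.update y N b) = overwrite (Fin.snoc (α := fun _ => ZMod 2) w b) y := by
  funext q
  unfold overwrite
  rcases lt_trichotomy q N with h | rfl | h
  · simp [h, Nat.lt_succ_of_lt h, Fin.snoc]
  · simp [Fin.snoc]
  · have h1 : ¬ q < N := by omega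
    have h2 : ¬ q < N + 1 := by omega
    have h3 : q ≠ N := by omega
    simp [h1, h2, h3]

lemma overwrite_lab (w x : Cube n) (b c : ZMod 2) : overwrite w (lab x b c) = lab w b c := by
  funext q
  by_cases h : q < n <;> simp [overwrite, lab, h]

lemma sum_cube_succ {M : Type*} [AddCommMonoid M] {N : ℕ} (F : Cube (N + 1) → M) :
    ∑ w, F w = ∑ w : Cube N, ∑ b : ZMod 2, F (Fin.snoc (α := fun _ => ZMod 2) w b) := by
  rw [← (Fin.snocEquiv fun _ : Fin (N + 1) => ZMod 2).sum_comp, Fintype.sum_prod_type,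
    Finset.sum_comm]
  rfl

lemma sum_zmod_two {M : Type*} [AddCommMonoid M] (F : ZMod 2 → M) : ∑ b, F b = F 0 + F 1 :=
  Fin.sum_univ_two F

/-- The Hadamard transform of the first `N` qubits of a basis state. -/
lemma sweep_gateH_ket (N : ℕ) (y : Label) :
    sweep gateH N (ket y) = (((1 / Real.sqrt 2) ^ N : ℝ) : ℂ) •
      ∑ w : Cube N, sgn (∑ i : Fin N, w i * y i) • ket (overwrite w y) := by
  induction N generalizing y with
  | zero =>
    have : ∀ w : Cube 0, overwrite w y = y := fun w => by
      funext q
      simp [overwrite]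
    simp [sweep, this]
  | succ N ih =>
    have hy : ∀ (b : ZMod 2) (w : Cube N),
        ∑ i : Fin N, w i * Function.update y N b i = ∑ i : Fin N, w i * y i := fun b w =>
      Finset.sum_congr rfl fun i _ => by rw [Function.update_of_ne (by omega)]
    have hs : ((-1 : ℂ) ^ (y N).val) = sgn (y N) := rfl
    rw [sweep, LinearMap.comp_apply, gateH, linExt_ket, map_smul, map_add, map_smul, ih, ih,
      sum_cube_succ]
    simp only [sum_zmod_two, hy, overwrite_update, Fin.sum_univ_castSucc, Fin.snoc_castSucc,
      Fin.snoc_last, zero_mul, one_mul, Fin.val_last, Fin.val_castSucc, sgn_add, sgn_zero, mul_one, hs]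
    rw [smul_comm (sgn (y N)), ← smul_add, smul_smul, pow_succ, mul_comm, Complex.ofReal_mul,
      Finset.smul_sum, ← Finset.sum_add_distrib]
    congr 1
    refine Finset.sum_congr rfl fun w _ => ?_
    rw [smul_smul, mul_comm]

/-- Application of the phase gate to the qubits `i < N` with `v i = 1`. -/
def zGate (v : ℕ → ZMod 2) (i : ℕ) : QState →ₗ[ℂ] QState :=
  if v i = 0 then LinearMap.id else gateZ i

/-- Addition of qubit `i` to qubit `t` if `v i = 1`. -/
def parityGate (v : ℕ → ZMod 2) (t i : ℕ) : QState →ₗ[ℂ] QState :=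
  if v i = 0 then LinearMap.id else gateCNOT i t

lemma sweep_zGate_ket (v : ℕ → ZMod 2) (N : ℕ) (y : Label) :
    sweep (zGate v) N (ket y) = sgn (∑ i ∈ Finset.range N, v i * y i) • ket y := by
  induction N with
  | zero => simp [sweep]
  | succ N ih =>
    rw [sweep, LinearMap.comp_apply, Finset.sum_range_succ, sgn_add]
    rcases zmod_two_cases (v N) with h | h
    · simp [zGate, h, ih]
    · have : zGate v N (ket y) = sgn (y N) • ket y := by simp [zGate, h, gateZ, sgn]
      rw [this, map_smul, ih, smul_smul, h, one_mul, mul_comm]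

lemma sweep_parityGate_ket (v : ℕ → ZMod 2) {t N : ℕ} (ht : N ≤ t) (y : Label) :
    sweep (parityGate v t) N (ket y)
      = ket (Function.update y t (y t + ∑ i ∈ Finset.range N, v i * y i)) := by
  induction N generalizing y with
  | zero => simp [sweep]
  | succ N ih =>
    rw [sweep, LinearMap.comp_apply, Finset.sum_range_succ]
    rcases zmod_two_cases (v N) with h | h
    · simp [parityGate, h, ih (by omega)]
    · have hN : N ≠ t := by omega
      have : parityGate v t N (ket y) = ket (Function.update y t (y t + y N)) := by
        simp [parityGate, h, gateCNOT, hN]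
      rw [this, ih (by omega), h, one_mul, Function.update_idem, Function.update_self]
      congr 2
      rw [add_assoc, add_comm (y N)]
      congr 2
      refine Finset.sum_congr rfl fun i hi => ?_
      rw [Function.update_of_ne]
      have := Finset.mem_range.1 hi
      omega

/-- The inner product of vectors over `ℤ₂`. -/
def dot (v x : Cube n) : ZMod 2 := ∑ i, v i * x i

lemma dot_add (v x y : Cube n) : dot v (x + y) = dot v x + dot v y := by
  simp [dot, mul_add, Finset.sum_add_distrib]

lemma cube_add_self (x : Cube n) : x + x = 0 := funext fun i => zmod_two_add_self (x i)

lemma dot_comm (v x : Cube n) : dot v x = dot x v := by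
  simp [dot, mul_comm]

@[simp] lemma dot_zero (v : Cube n) : dot v 0 = 0 := by simp [dot]

lemma sum_range_mul_lab (v : ℕ → ZMod 2) (x : Cube n) (b c : ZMod 2) :
    ∑ i ∈ Finset.range n, v i * lab x b c i = dot (fun i : Fin n => v i) x := by
  rw [Finset.sum_range, dot]
  simp

/-- The Hadamard transform on `x`. -/
def hadAmp : Amp n →ₗ[ℝ] Amp n where
  toFun φ z := (1 / Real.sqrt 2) ^ n * ∑ x, rsgn (dot z.1 x) * φ (x, z.2)
  map_add' φ ψ := by
    funext z
    simp [mul_add, Finset.sum_add_distrib]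
  map_smul' a φ := by
    funext z
    simp only [Pi.smul_apply, smul_eq_mul, RingHom.id_apply, Finset.mul_sum]
    exact Finset.sum_congr rfl fun x _ => by ring

/-- A query to the oracle of `h`. -/
def queryAmp (h : BoolFun n) : Amp n →ₗ[ℝ] Amp n where
  toFun φ z := φ (z.1, z.2 + h z.1)
  map_add' _ _ := rfl
  map_smul' _ _ := rfl

/-- Phase gate on `b`. -/
def phaseAmp : Amp n →ₗ[ℝ] Amp n where
  toFun φ z := rsgn z.2 * φ z
  map_add' φ ψ := by
    funext z
    simp [mul_add]
  map_smul' a φ := by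
    funext z
    simp only [Pi.smul_apply, smul_eq_mul, RingHom.id_apply]
    ring

/-- The phases `(-1)^(v · x)`. -/
def charAmp (v : Cube n) : Amp n →ₗ[ℝ] Amp n where
  toFun φ z := rsgn (dot v z.1) * φ z
  map_add' φ ψ := by
    funext z
    simp [mul_add]
  map_smul' a φ := by
    funext z
    simp only [Pi.smul_apply, smul_eq_mul, RingHom.id_apply]
    ring

/-- Reflection in the basis state `|0⟩`, up to sign. -/
def reflectAmp : Amp n →ₗ[ℝ] Amp n where
  toFun φ z := if z = 0 then -φ z else φ z
  map_add' φ ψ := by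
    funext z
    by_cases h : z = 0 <;> simp [h, add_comm]
  map_smul' a φ := by
    funext z
    by_cases h : z = 0 <;> simp [h]

lemma sweep_gateH_emb (φ : Amp n) : sweep gateH n (emb 0 φ) = emb 0 (hadAmp φ) := by
  simp only [emb, map_sum, map_smul, sweep_gateH_ket, overwrite_lab, lab_fin, Pi.zero_apply,
    hadAmp, LinearMap.coe_mk, AddHom.coe_mk, Fintype.sum_prod_type, sgn_eq_rsgn]
  rw [Finset.sum_comm, Finset.sum_comm (s := (Finset.univ : Finset (Cube n)))]
  refine Finset.sum_congr rfl fun b _ => ?_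
  simp only [Finset.smul_sum, smul_smul]
  rw [Finset.sum_comm]
  refine Finset.sum_congr rfl fun w _ => ?_
  rw [← Finset.sum_smul]
  congr 1
  push_cast
  rw [Finset.mul_sum]
  refine Finset.sum_congr rfl fun x _ => ?_
  rw [dot]
  ring

lemma gateOracle_emb (h : BoolFun n) (φ : Amp n) :
    gateOracle h n 0 (emb 0 φ) = emb 0 (queryAmp h φ) := by
  have e : ∀ (x : Cube n) (b : ZMod 2),
      gateOracle h n 0 (ket (lab x b 0)) = ket (lab x (b + h x) 0) := by
    intro x b
    have : ¬ (0 ≤ n ∧ n < 0 + n) := by omega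
    rw [gateOracle, if_neg this, linExt_ket, lab_self, update_lab_self]
    simp
  simp only [emb, map_sum, map_smul, Pi.zero_apply, e, Fintype.sum_prod_type, queryAmp,
    LinearMap.coe_mk, AddHom.coe_mk]
  refine Finset.sum_congr rfl fun x _ => ?_
  refine Fintype.sum_equiv (Equiv.addRight (h x)) _ _ fun b => ?_
  simp [add_assoc, zmod_two_add_self]

lemma gateZ_emb (φ : Amp n) : gateZ n (emb 0 φ) = emb 0 (phaseAmp φ) := by
  simp only [emb, map_sum, map_smul, gateZ, linExt_ket, Pi.zero_apply, lab_self, phaseAmp,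
    LinearMap.coe_mk, AddHom.coe_mk, smul_smul]
  refine Finset.sum_congr rfl fun z _ => ?_
  rw [mul_comm, Complex.ofReal_mul, ← sgn_eq_rsgn]
  rfl

lemma sweep_zGate_emb (v : ℕ → ZMod 2) (φ : Amp n) :
    sweep (zGate v) n (emb 0 φ) = emb 0 (charAmp (fun i : Fin n => v i) φ) := by
  simp only [emb, map_sum, map_smul, sweep_zGate_ket, sum_range_mul_lab, charAmp,
    LinearMap.coe_mk, AddHom.coe_mk, smul_smul]
  refine Finset.sum_congr rfl fun z _ => ?_
  rw [mul_comm, Complex.ofReal_mul, ← sgn_eq_rsgn]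

lemma sweep_parityGate_emb (v : ℕ → ZMod 2) (φ : Amp n) :
    sweep (parityGate v (n + 1)) n (emb 0 φ)
      = emb (fun z => dot (fun i : Fin n => v i) z.1) φ := by
  simp only [emb, map_sum, map_smul, sweep_parityGate_ket v (Nat.le_succ n), sum_range_mul_lab,
    lab_succ, update_lab_succ, Pi.zero_apply, zero_add]

end Gates

/-! ### Fourier sampling and its amplification -/

section Fourier

variable {n : ℕ}

/-- The symmetric bilinear form `∑ φ ψ`. -/
def pair (φ ψ : Amp n) : ℝ := ∑ z, φ z * ψ z

lemma sum_rsgn_dot (x : Cube n) : ∑ w : Cube n, rsgn (dot w x) = if x = 0 then 2 ^ n else 0 := by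
  split_ifs with h
  · subst h
    simp [ZMod.card]
  · obtain ⟨i, hi⟩ : ∃ i, x i ≠ 0 := by
      by_contra h'
      push Not at h'
      exact h (funext h')
    have hi : x i = 1 := (zmod_two_cases _).resolve_left hi
    obtain ⟨e, hd⟩ : ∃ e : Cube n, dot x e = 1 :=
      ⟨Pi.single i 1, by simp [dot, Pi.single_apply, hi]⟩
    simp only [dot_comm _ x]
    have := Fintype.sum_equiv (Equiv.addRight e) (fun w => rsgn (dot x (w + e)))
      (fun w => rsgn (dot x w)) fun w => rfl
    simp only [dot_add, rsgn_add, hd, rsgn_one, mul_neg, mul_one,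
      Finset.sum_neg_distrib] at this
    linarith

lemma inv_sqrt_two_pow_sq (n : ℕ) : (1 / Real.sqrt 2) ^ n * (1 / Real.sqrt 2) ^ n * 2 ^ n = 1 := by
  rw [← mul_pow, ← mul_pow, div_mul_div_comm, Real.mul_self_sqrt (by norm_num)]
  norm_num

lemma hadAmp_hadAmp (φ : Amp n) : hadAmp (hadAmp φ) = φ := by
  funext ⟨w, b⟩
  simp only [hadAmp, LinearMap.coe_mk, AddHom.coe_mk, Finset.mul_sum]
  rw [Finset.sum_comm]
  have : ∀ y : Cube n, ∑ x, (1 / Real.sqrt 2) ^ n * (rsgn (dot w x) * ((1 / Real.sqrt 2) ^ n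
      * (rsgn (dot x y) * φ (y, b)))) = if y = w then φ (y, b) else 0 := by
    intro y
    have h1 : ∀ x, (1 / Real.sqrt 2) ^ n * (rsgn (dot w x) * ((1 / Real.sqrt 2) ^ n
        * (rsgn (dot x y) * φ (y, b)))) = ((1 / Real.sqrt 2) ^ n * (1 / Real.sqrt 2) ^ n
          * φ (y, b)) * rsgn (dot x (w + y)) := by
      intro x
      rw [dot_add, rsgn_add, dot_comm w x]
      ring
    simp only [h1]
    rw [← Finset.mul_sum, sum_rsgn_dot]
    have h2 : w + y = 0 ↔ y = w := by
      constructor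
      · intro h
        have := congrArg (w + ·) h
        simpa only [← add_assoc, cube_add_self, zero_add, add_zero] using this
      · rintro rfl
        exact cube_add_self y
    by_cases h : y = w
    · rw [if_pos (h2.2 h), if_pos h, mul_right_comm, inv_sqrt_two_pow_sq, one_mul]
    · rw [if_neg (mt h2.1 h), if_neg h, mul_zero]
  simp only [this]
  simp

lemma queryAmp_queryAmp (h : BoolFun n) (φ : Amp n) : queryAmp h (queryAmp h φ) = φ := by
  funext ⟨x, b⟩
  simp [queryAmp, add_assoc, zmod_two_add_self]

lemma phaseAmp_phaseAmp (φ : Amp n) : phaseAmp (phaseAmp φ) = φ := by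
  funext z
  simp [phaseAmp, ← mul_assoc, rsgn_mul_self]

lemma pair_hadAmp (φ ψ : Amp n) : pair (hadAmp φ) ψ = pair φ (hadAmp ψ) := by
  simp only [pair, hadAmp, LinearMap.coe_mk, AddHom.coe_mk, Fintype.sum_prod_type]
  rw [Finset.sum_comm, Finset.sum_comm (s := (Finset.univ : Finset (Cube n)))]
  refine Finset.sum_congr rfl fun b _ => ?_
  simp only [Finset.mul_sum, Finset.sum_mul]
  rw [Finset.sum_comm]
  refine Finset.sum_congr rfl fun x _ => Finset.sum_congr rfl fun y _ => ?_
  rw [dot_comm]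
  ring

lemma pair_queryAmp (h : BoolFun n) (φ ψ : Amp n) :
    pair (queryAmp h φ) ψ = pair φ (queryAmp h ψ) := by
  simp only [pair, queryAmp, LinearMap.coe_mk, AddHom.coe_mk, Fintype.sum_prod_type]
  refine Finset.sum_congr rfl fun x _ => ?_
  refine Fintype.sum_equiv (Equiv.addRight (h x)) _ _ fun b => ?_
  simp [add_assoc, zmod_two_add_self]

lemma pair_phaseAmp (φ ψ : Amp n) : pair (phaseAmp φ) ψ = pair φ (phaseAmp ψ) := by
  simp only [pair, phaseAmp, LinearMap.coe_mk, AddHom.coe_mk]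
  exact Finset.sum_congr rfl fun z _ => by ring

/-- The sampling unitary: its inverse is obtained by exchanging `f` and `g`. -/
def sampleAmp (f g : BoolFun n) : Amp n →ₗ[ℝ] Amp n :=
  hadAmp ∘ₗ queryAmp g ∘ₗ phaseAmp ∘ₗ queryAmp f ∘ₗ hadAmp

lemma sampleAmp_sampleAmp (f g : BoolFun n) (φ : Amp n) :
    sampleAmp f g (sampleAmp g f φ) = φ := by
  simp [sampleAmp, hadAmp_hadAmp, queryAmp_queryAmp, phaseAmp_phaseAmp]

lemma pair_sampleAmp (f g : BoolFun n) (φ ψ : Amp n) :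
    pair (sampleAmp f g φ) ψ = pair φ (sampleAmp g f ψ) := by
  simp [sampleAmp, pair_hadAmp, pair_queryAmp, pair_phaseAmp]

/-- The amplitudes of the basis state `|0⟩`. -/
def zeroAmp (n : ℕ) : Amp n := Pi.single 0 1

/-- The amplitudes of the sampling state. -/
def sample (f g : BoolFun n) : Amp n := sampleAmp f g (zeroAmp n)

lemma pair_zeroAmp (φ : Amp n) : pair (zeroAmp n) φ = φ 0 := by
  simp [pair, zeroAmp, Pi.single_apply]

lemma pair_sample (f g : BoolFun n) (φ : Amp n) : pair (sample f g) φ = sampleAmp g f φ 0 := by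
  rw [sample, pair_sampleAmp, pair_zeroAmp]

lemma pair_sample_self (f g : BoolFun n) : pair (sample f g) (sample f g) = 1 := by
  rw [pair_sample, sample, sampleAmp_sampleAmp]
  simp [zeroAmp]

lemma reflectAmp_eq (φ : Amp n) : reflectAmp φ = φ - (2 * φ 0) • zeroAmp n := by
  funext z
  by_cases h : z = 0
  · subst h
    simp [reflectAmp, zeroAmp]
    ring
  · simp [reflectAmp, zeroAmp, h]

/-- One step of amplitude amplification towards `v · w = 1`. -/
def ampStep (f g : BoolFun n) (v : Cube n) : Amp n →ₗ[ℝ] Amp n :=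
  sampleAmp f g ∘ₗ reflectAmp ∘ₗ sampleAmp g f ∘ₗ charAmp v

lemma ampStep_apply (f g : BoolFun n) (v : Cube n) (φ : Amp n) :
    ampStep f g v φ
      = charAmp v φ - (2 * pair (sample f g) (charAmp v φ)) • sample f g := by
  simp only [ampStep, LinearMap.comp_apply, reflectAmp_eq, map_sub, map_smul,
    sampleAmp_sampleAmp, ← pair_sample]
  rfl

/-- The Fourier coefficient of `(-1)^f` at `w`. -/
def fourier (f : BoolFun n) (w : Cube n) : ℝ :=
  (1 / Real.sqrt 2) ^ n * (1 / Real.sqrt 2) ^ n * ∑ x, rsgn (dot w x + f x)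

/-- The sampling state is `∑ F̂(w) |w⟩ |w · s⟩`: a shift of the function by `s` multiplies
the Fourier coefficient at `w` by `(-1)^(w · s)`. -/
lemma sample_apply {f g : BoolFun n} {s : Cube n} (hg : ∀ x, g x = f (x + s)) (w : Cube n)
    (b : ZMod 2) : sample f g (w, b) = if b = dot w s then fourier f w else 0 := by
  set S : ZMod 2 → ℝ := fun b => ∑ x, if b = f x + g x then rsgn (dot w x + f x) else 0 with hS
  have h1 : sample f g (w, b) = (1 / Real.sqrt 2) ^ n * (1 / Real.sqrt 2) ^ n * S b := by
    simp only [sample, sampleAmp, LinearMap.comp_apply, hS, mul_assoc]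
    conv_lhs => simp only [hadAmp, LinearMap.coe_mk, AddHom.coe_mk]
    simp only [queryAmp, phaseAmp, LinearMap.coe_mk, AddHom.coe_mk, zeroAmp, Finset.mul_sum]
    refine Finset.sum_congr rfl fun x _ => ?_
    rw [Finset.sum_eq_single 0]
    · simp only [Pi.single_apply, Prod.ext_iff, Prod.fst_zero, Prod.snd_zero, dot_zero,
        rsgn_zero, true_and]
      by_cases h : b = f x + g x
      · have e1 : b + g x + f x = 0 := by
          rw [h, add_assoc, add_comm (g x), zmod_two_add_self]
        have e2 : b + g x = f x := by rw [h, add_assoc, zmod_two_add_self, add_zero]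
        rw [if_pos h, if_pos e1, e2, rsgn_add]
        ring
      · have e1 : b + g x + f x ≠ 0 := by
          intro e
          apply h
          rw [add_assoc] at e
          rw [CharTwo.add_eq_zero.1 e, add_comm]
        rw [if_neg h, if_neg e1]
        ring
    · intro y _ hy
      simp [Prod.ext_iff, hy]
    · simp
  -- The substitution of `x + s` for `x` exchanges `f x` and `g x`, which differ by `b`.
  have h2 : ∀ b, S b = rsgn (dot w s + b) * S b := by
    intro b
    conv_lhs => rw [hS]
    simp only
    rw [hS, Finset.mul_sum]
    refine Fintype.sum_equiv (Equiv.addRight s) _ _ fun x => ?_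
    have e : f (x + s + s) = f x := by rw [add_assoc, cube_add_self, add_zero]
    simp only [Equiv.coe_addRight, hg, e, add_comm (f (x + s))]
    split_ifs with h
    · rw [← rsgn_add, dot_add]
      congr 1
      have : f (x + s) = f x + b := by
        rw [h, ← add_assoc, zmod_two_add_self, zero_add]
      rw [this]
      linear_combination -(zmod_two_add_self (dot w s)) - zmod_two_add_self b
    · simp
  have h3 : S (dot w s + 1) = 0 := by
    have := h2 (dot w s + 1)
    rw [← add_assoc, zmod_two_add_self, zero_add, rsgn_one] at this
    linarith
  have h4 : S (dot w s) + S (dot w s + 1) = ∑ x, rsgn (dot w x + f x) := by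
    rw [hS]
    simp only
    rw [← Finset.sum_add_distrib]
    refine Finset.sum_congr rfl fun x _ => ?_
    rcases zmod_two_cases (dot w s) with h | h <;>
      rcases zmod_two_cases (f x + g x) with h' | h' <;> simp [h, h', zmod_two_add_self]
  rw [h1]
  split_ifs with h
  · rw [fourier, ← h4, h3, h, add_zero]
  · have : b = dot w s + 1 := by
      have aux : ∀ a t : ZMod 2, a ≠ t → a = t + 1 := by decide
      exact aux _ _ h
    rw [this, h3, mul_zero]

/-- The probability that a sample `w` satisfies `v · w = 1`. -/
def successProb (f g : BoolFun n) (v : Cube n) : ℝ :=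
  ∑ z, if dot v z.1 = 1 then sample f g z ^ 2 else 0

lemma pair_sample_charAmp (f g : BoolFun n) (v : Cube n) :
    pair (sample f g) (charAmp v (sample f g)) = 1 - 2 * successProb f g v := by
  rw [← pair_sample_self f g, pair, pair, successProb, Finset.mul_sum, ← Finset.sum_sub_distrib]
  refine Finset.sum_congr rfl fun z _ => ?_
  rcases zmod_two_cases (dot v z.1) with h | h <;> simp [charAmp, h]
  ring

lemma sum_rsgn_mul_rsgn (f : BoolFun n) (v : Cube n) :
    ∑ x, rsgn (f x) * rsgn (f (x + v)) = 2 ^ n * (1 - 2 * influence f v) := by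
  have h : ∀ x, rsgn (f x) * rsgn (f (x + v)) = 1 - 2 * if f x ≠ f (x + v) then (1 : ℝ) else 0 := by
    intro x
    rcases zmod_two_cases (f x) with h | h <;> rcases zmod_two_cases (f (x + v)) with h' | h' <;>
      simp [h, h'] <;> norm_num
  simp only [h, Finset.sum_sub_distrib, ← Finset.mul_sum, Finset.sum_boole, influence]
  have h2 : (2 : ℝ) ^ n ≠ 0 := by positivity
  have : (∑ _x : Cube n, (1 : ℝ)) = 2 ^ n := by simp [ZMod.card]
  rw [this]
  field_simp

/-- The influence of `v` is the probability of `v · w = 1` under Fourier sampling. -/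
lemma successProb_eq_influence {f g : BoolFun n} {s : Cube n} (hg : ∀ x, g x = f (x + s))
    (v : Cube n) : successProb f g v = influence f v := by
  -- Parseval's identity for `(-1)^f` and its translate by `v`.
  set F : Amp n := fun z => if z.2 = 0 then rsgn (f z.1) else 0 with hF
  have h1 : ∀ w b, hadAmp F (w, b) * (1 / Real.sqrt 2) ^ n = if b = 0 then fourier f w else 0 := by
    intro w b
    simp only [hadAmp, LinearMap.coe_mk, AddHom.coe_mk, hF, fourier]
    split_ifs with h
    · simp only [rsgn_add]
      ring
    · simp
  have h2 : hadAmp (charAmp v (hadAmp F)) = fun z => F (z.1 + v, z.2) := by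
    have : charAmp v (hadAmp F) = hadAmp fun z => F (z.1 + v, z.2) := by
      funext ⟨w, b⟩
      simp only [hadAmp, charAmp, LinearMap.coe_mk, AddHom.coe_mk]
      rw [mul_left_comm, Finset.mul_sum]
      congr 1
      refine Fintype.sum_equiv (Equiv.addRight v) _ _ fun x => ?_
      simp only [Equiv.coe_addRight, dot_add, rsgn_add, dot_comm v w]
      rw [add_assoc, cube_add_self, add_zero]
      ring
    rw [this, hadAmp_hadAmp]
  have h3 : pair (hadAmp F) (charAmp v (hadAmp F)) = 2 ^ n * (1 - 2 * influence f v) := by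
    rw [pair_hadAmp, h2, ← sum_rsgn_mul_rsgn, pair, Fintype.sum_prod_type]
    exact Finset.sum_congr rfl fun x _ => by simp [hF]
  have h4 : pair (sample f g) (charAmp v (sample f g))
      = (1 / Real.sqrt 2) ^ n * (1 / Real.sqrt 2) ^ n
        * pair (hadAmp F) (charAmp v (hadAmp F)) := by
    simp only [pair, Fintype.sum_prod_type, Finset.mul_sum]
    refine Finset.sum_congr rfl fun w _ => ?_
    have e : ∀ b, (1 / Real.sqrt 2) ^ n * (1 / Real.sqrt 2) ^ n *
        (hadAmp F (w, b) * charAmp v (hadAmp F) (w, b))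
        = if b = 0 then rsgn (dot v w) * fourier f w ^ 2 else 0 := by
      intro b
      have := h1 w b
      simp only [charAmp, LinearMap.coe_mk, AddHom.coe_mk]
      calc _ = rsgn (dot v w) * (hadAmp F (w, b) * (1 / Real.sqrt 2) ^ n) ^ 2 := by ring
        _ = _ := by
          rw [this]
          split_ifs <;> simp
    have e' : ∀ b, sample f g (w, b) * charAmp v (sample f g) (w, b)
        = if b = dot w s then rsgn (dot v w) * fourier f w ^ 2 else 0 := by
      intro b
      simp only [charAmp, LinearMap.coe_mk, AddHom.coe_mk, sample_apply hg]
      split_ifs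
      · ring
      · simp
    simp only [e, e', Finset.sum_ite_eq', Finset.mem_univ, if_true]
  rw [pair_sample_charAmp, h3, ← mul_assoc, inv_sqrt_two_pow_sq] at h4
  linarith

lemma successProb_nonneg (f g : BoolFun n) (v : Cube n) : 0 ≤ successProb f g v :=
  Finset.sum_nonneg fun z _ => by split_ifs <;> positivity

lemma sum_sample_sq (f g : BoolFun n) : ∑ z, sample f g z ^ 2 = 1 := by
  simpa [pair, sq] using pair_sample_self f g

lemma successProb_le_one (f g : BoolFun n) (v : Cube n) : successProb f g v ≤ 1 := by
  rw [← sum_sample_sq f g, successProb]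
  refine Finset.sum_le_sum fun z _ => ?_
  split_ifs
  · exact le_rfl
  · positivity

lemma sum_sample_sq_of_dot_eq_zero (f g : BoolFun n) (v : Cube n) :
    (∑ z, if dot v z.1 = 0 then sample f g z ^ 2 else 0) = 1 - successProb f g v := by
  rw [eq_sub_iff_add_eq, successProb, ← Finset.sum_add_distrib, ← sum_sample_sq f g]
  refine Finset.sum_congr rfl fun z _ => ?_
  rcases zmod_two_cases (dot v z.1) with h | h <;> simp [h]

/-- The half angle of the rotation in the plane spanned by the two parts of the sampling state. -/
def angle (f g : BoolFun n) (v : Cube n) : ℝ := Real.arcsin (Real.sqrt (successProb f g v))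

lemma sin_angle_sq (f g : BoolFun n) (v : Cube n) :
    Real.sin (angle f g v) ^ 2 = successProb f g v := by
  have h := successProb_nonneg f g v
  rw [angle, Real.sin_arcsin (by linarith [Real.sqrt_nonneg (successProb f g v)])
    (Real.sqrt_le_one.2 (successProb_le_one f g v)), Real.sq_sqrt h]

/-- After `r` steps of amplification, the two parts of the sampling state have been rescaled so
that their weights are `cos² ((2 r + 1) θ)` and `sin² ((2 r + 1) θ)`. -/
lemma exists_iterate_ampStep (f g : BoolFun n) (v : Cube n) (r : ℕ) :
    ∃ a b : ℝ, ((ampStep f g v)^[r] (sample f g)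
        = fun z => (if dot v z.1 = 0 then a else b) * sample f g z) ∧
      a * Real.cos (angle f g v) = (-1) ^ r * Real.cos ((2 * r + 1) * angle f g v) ∧
      b * Real.sin (angle f g v) = (-1) ^ r * Real.sin ((2 * r + 1) * angle f g v) := by
  induction r with
  | zero => exact ⟨1, 1, by simp, by simp, by simp⟩
  | succ r ih =>
    obtain ⟨a, b, h, ha, hb⟩ := ih
    set p := successProb f g v with hp
    set θ := angle f g v with hθ
    have hs : Real.sin θ ^ 2 = p := sin_angle_sq f g v
    have hc : Real.cos θ ^ 2 = 1 - p := by rw [← hs, ← Real.sin_sq_add_cos_sq θ]; ring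
    have hchar : charAmp v ((ampStep f g v)^[r] (sample f g))
        = fun z => (if dot v z.1 = 0 then a else -b) * sample f g z := by
      rw [h]
      funext z
      rcases zmod_two_cases (dot v z.1) with h' | h' <;> simp [charAmp, h']
    have hpair : pair (sample f g) (charAmp v ((ampStep f g v)^[r] (sample f g)))
        = a * (1 - p) - b * p := by
      rw [hchar, hp, ← sum_sample_sq_of_dot_eq_zero, successProb, pair, Finset.mul_sum,
        Finset.mul_sum, ← Finset.sum_sub_distrib]
      refine Finset.sum_congr rfl fun z _ => ?_
      rcases zmod_two_cases (dot v z.1) with h' | h' <;> simp [h'] <;> ring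
    -- The step is a product of two reflections, a rotation by `2 θ`.
    refine ⟨a - 2 * (a * (1 - p) - b * p), -b - 2 * (a * (1 - p) - b * p), ?_, ?_, ?_⟩
    · rw [Function.iterate_succ_apply', ampStep_apply, hpair, hchar]
      funext z
      simp only [Pi.sub_apply, Pi.smul_apply, smul_eq_mul]
      split_ifs <;> ring
    · have e : (2 * ((r + 1 : ℕ) : ℝ) + 1) * θ = (2 * r + 1) * θ + 2 * θ := by
        push_cast
        ring
      rw [e, Real.cos_add, Real.cos_two_mul, Real.sin_two_mul, hc, pow_succ]
      linear_combination (1 - 2 * (1 - p)) * ha + 2 * Real.cos θ * Real.sin θ * hb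
        + 2 * b * Real.cos θ * (-hs)
    · have e : (2 * ((r + 1 : ℕ) : ℝ) + 1) * θ = (2 * r + 1) * θ + 2 * θ := by
        push_cast
        ring
      rw [e, Real.sin_add, Real.cos_two_mul, Real.sin_two_mul, hc, pow_succ]
      linear_combination (1 - 2 * (1 - p)) * hb - 2 * Real.cos θ * Real.sin θ * ha
        + 2 * a * Real.sin θ * hc

end Fourier

/-! ### The reflection in the all-zero state -/

section Reflection

/-- One rung of the ladder of Toffoli gates which computes the conjunction of the negations of the
qubits `0, …, N - 1`, with scratch qubits `N, …, 2 N`. -/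
def rung (N i : ℕ) : QState →ₗ[ℂ] QState :=
  (gateToffoli i (N + i + 1) (N + i)).comp (gateX i)

/-- The inverse of `rung N i`. -/
def rungInv (N i : ℕ) : QState →ₗ[ℂ] QState :=
  (gateX i).comp (gateToffoli i (N + i + 1) (N + i))

/-- The phase `-1` on the basis states that vanish in the qubits `0, …, n`. -/
def reflection (n : ℕ) : QState →ₗ[ℂ] QState :=
  (gateX (n + 1 + (n + 1))).comp ((sweep (fun i => rungInv (n + 1) (n - i)) (n + 1)).comp
    ((gateZ (n + 1)).comp ((sweep (rung (n + 1)) (n + 1)).comp (gateX (n + 1 + (n + 1))))))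

lemma gateX_ket (q : ℕ) (y : Label) : gateX q (ket y) = ket (Function.update y q (y q + 1)) := by
  rw [gateX, linExt_ket]

lemma gateX_gateX (q : ℕ) (ψ : QState) : gateX q (gateX q ψ) = ψ := by
  have : (gateX q).comp (gateX q) = LinearMap.id := linearMap_ext_ket fun y => by
    rw [LinearMap.comp_apply, gateX_ket, gateX_ket]
    exact congrArg ket (involutive_flip q y)
  exact LinearMap.congr_fun this ψ

lemma gateToffoli_ket {c d t : ℕ} (hc : c ≠ t) (hd : d ≠ t) (y : Label) :
    gateToffoli c d t (ket y) = ket (Function.update y t (y t + y c * y d)) := by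
  rw [gateToffoli, if_neg (by tauto), linExt_ket]

lemma gateToffoli_gateToffoli {c d t : ℕ} (hc : c ≠ t) (hd : d ≠ t) (ψ : QState) :
    gateToffoli c d t (gateToffoli c d t ψ) = ψ := by
  have : (gateToffoli c d t).comp (gateToffoli c d t) = LinearMap.id :=
    linearMap_ext_ket fun y => by
      rw [LinearMap.comp_apply, gateToffoli_ket hc hd, gateToffoli_ket hc hd]
      exact congrArg ket (involutive_toffoli hc hd y)
  exact LinearMap.congr_fun this ψ

lemma rungInv_rung {N i : ℕ} (hi : i < N) (ψ : QState) : rungInv N i (rung N i ψ) = ψ := by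
  simp only [rung, rungInv, LinearMap.comp_apply]
  rw [gateToffoli_gateToffoli (by omega) (by omega), gateX_gateX]

lemma sweep_succ' (G : ℕ → QState →ₗ[ℂ] QState) (N : ℕ) (ψ : QState) :
    sweep G (N + 1) ψ = G 0 (sweep (fun i => G (i + 1)) N ψ) := by
  induction N generalizing ψ with
  | zero => rfl
  | succ N ih => exact ih (G (N + 1) ψ)

lemma sweep_congr {G G' : ℕ → QState →ₗ[ℂ] QState} {N : ℕ} (h : ∀ i < N, G i = G' i) :
    sweep G N = sweep G' N := by
  induction N with
  | zero => rfl
  | succ N ih => rw [sweep, sweep, ih fun i hi => h i (by omega), h N (by omega)]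

lemma sweep_inv {G B : ℕ → QState →ₗ[ℂ] QState} {N : ℕ}
    (h : ∀ i < N, ∀ ψ, B i (G i ψ) = ψ) (ψ : QState) :
    sweep (fun i => B (N - 1 - i)) N (sweep G N ψ) = ψ := by
  induction N generalizing G B with
  | zero => rfl
  | succ N ih =>
    rw [sweep_succ' G, sweep, LinearMap.comp_apply, Nat.add_sub_cancel, Nat.sub_self,
      h 0 N.succ_pos]
    have : sweep (fun i => B (N - i)) N = sweep (fun i => (fun j => B (j + 1)) (N - 1 - i)) N :=
      sweep_congr fun i hi => by
        simp only
        congr 1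
        omega
    rw [this]
    exact ih fun i hi => h (i + 1) (by omega)

/-- The ladder computes the conjunction into qubit `N`. -/
lemma exists_sweep_rung {N M : ℕ} (hM : M ≤ N) (y : Label) (hy : ∀ i < M, y (N + i) = 0) :
    ∃ y', sweep (rung N) M (ket y) = ket y' ∧
      y' N = y (N + M) * ∏ i ∈ Finset.range M, (y i + 1) := by
  induction M generalizing y with
  | zero => exact ⟨y, rfl, by simp⟩
  | succ M ih =>
    set y₁ := Function.update y M (y M + 1) with hy₁
    set y₂ := Function.update y₁ (N + M) (y (N + M + 1) * (y M + 1)) with hy₂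
    have h1 : rung N M (ket y) = ket y₂ := by
      rw [rung, LinearMap.comp_apply, gateX_ket, gateToffoli_ket (by omega) (by omega), hy₂]
      congr 2
      have e1 : Function.update y M (y M + 1) (N + M) = 0 := by
        rw [Function.update_of_ne (by omega), hy M (by omega)]
      have e2 : Function.update y M (y M + 1) (N + M + 1) = y (N + M + 1) :=
        Function.update_of_ne (by omega) _ _
      rw [e1, e2, Function.update_self, zero_add, mul_comm]
    have h2 : ∀ q, q ≠ M → q ≠ N + M → y₂ q = y q := fun q hq hq' => by
      rw [hy₂, Function.update_of_ne hq', hy₁, Function.update_of_ne hq]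
    obtain ⟨y', h, h'⟩ := ih (by omega) y₂ fun i hi => by
      rw [h2 _ (by omega) (by omega), hy i (by omega)]
    refine ⟨y', by rw [sweep, LinearMap.comp_apply, h1, h], ?_⟩
    rw [h', Finset.prod_range_succ, hy₂, Function.update_self, ← hy₂,
      Finset.prod_congr rfl fun i hi => ?_, add_assoc N M 1]
    · ring
    · have := Finset.mem_range.1 hi
      rw [h2 i (by omega) (by omega)]

variable {n : ℕ}

lemma prod_lab_add_one (z : Cube n × ZMod 2) (c : ZMod 2) :
    ∏ i ∈ Finset.range (n + 1), (lab z.1 z.2 c i + 1) = if z = 0 then 1 else 0 := by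
  split_ifs with h
  · subst h
    refine Finset.prod_eq_one fun i hi => ?_
    have hi' := Finset.mem_range.1 hi
    have : lab (0 : Cube n) 0 c i = 0 := by
      have : i ≠ n + 1 := by omega
      simp [lab, this]
    simp [this]
  · obtain ⟨i, hi, h1⟩ : ∃ i, i < n + 1 ∧ lab z.1 z.2 c i ≠ 0 := by
      by_contra h'
      push Not at h'
      refine h (Prod.ext (funext fun i => ?_) ?_)
      · simpa using h' i (by omega)
      · simpa using h' n (by omega)
    refine Finset.prod_eq_zero (Finset.mem_range.2 hi) ?_
    rw [(zmod_two_cases _).resolve_left h1, zmod_two_add_self]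

lemma reflection_ket (z : Cube n × ZMod 2) :
    reflection n (ket (lab z.1 z.2 0))
      = (if z = 0 then (-1 : ℂ) else 1) • ket (lab z.1 z.2 0) := by
  set y := lab z.1 z.2 0 with hy
  set y₁ := Function.update y (n + 1 + (n + 1)) (y (n + 1 + (n + 1)) + 1) with hy₁
  have e1 : ∀ i < n + 1 + (n + 1), y₁ i = y i := fun i hi => by
    rw [hy₁, Function.update_of_ne (by omega)]
  have e2 : y₁ (n + 1 + (n + 1)) = 1 := by
    rw [hy₁, Function.update_self, hy, lab_of_gt (by omega), zero_add]
  obtain ⟨y₂, h2, h3⟩ := exists_sweep_rung (le_refl (n + 1)) y₁ fun i hi => by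
    rw [e1 _ (by omega), hy]
    rcases Nat.eq_zero_or_pos i with rfl | hi
    · simp
    · rw [lab_of_gt (by omega)]
  rw [e2, one_mul, Finset.prod_congr rfl fun i hi => by
    rw [e1 i (by have := Finset.mem_range.1 hi; omega)], hy, prod_lab_add_one] at h3
  have h4 : gateZ (n + 1) (ket y₂) = sgn (y₂ (n + 1)) • ket y₂ := by
    rw [gateZ, linExt_ket]
    rfl
  have h5 := sweep_inv (G := rung (n + 1)) (B := rungInv (n + 1)) (N := n + 1)
    (fun i hi ψ => rungInv_rung hi ψ) (ket y₁)
  rw [h2, Nat.add_sub_cancel] at h5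
  simp only [reflection, LinearMap.comp_apply]
  rw [gateX_ket, ← hy₁, h2, h4, map_smul, h5, map_smul, hy₁, ← gateX_ket, gateX_gateX, h3]
  split_ifs <;> simp

lemma reflection_emb (φ : Amp n) : reflection n (emb 0 φ) = emb 0 (reflectAmp φ) := by
  simp only [emb, map_sum, map_smul, Pi.zero_apply, reflection_ket, smul_smul, reflectAmp,
    LinearMap.coe_mk, AddHom.coe_mk]
  refine Finset.sum_congr rfl fun z _ => ?_
  split_ifs <;> simp

end Reflection

/-! ### The quantum subroutines -/

/-- Hadamard gates on the first `n` qubits. -/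
def hadamards : Prog := countdown 12 0 (.had 12)

/-- The sampling unitary. -/
def sampling : Prog :=
  .seq hadamards (.seq (.queryF 0 9) (.seq (.phase 0) (.seq (.queryG 0 9) hadamards)))

/-- The inverse of the sampling unitary. -/
def samplingInv : Prog :=
  .seq hadamards (.seq (.queryG 0 9) (.seq (.phase 0) (.seq (.queryF 0 9) hadamards)))

/-- Phase gates on the qubits where row `k` has a one. -/
def rowPhases : Prog :=
  countdown 12 0 (.seq (.add 13 3 12) (.seq (.load 13 13) (.ite 13 (.phase 12) .skip)))

/-- Addition to qubit `n + 1` of the qubits where row `k` has a one. -/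
def rowParity : Prog :=
  countdown 12 0 (.seq (.add 13 3 12) (.seq (.load 13 13) (.ite 13 (.cnot 12 7) .skip)))

/-- The reflection in the all-zero state. -/
def reflectionProg : Prog :=
  .seq (.seq (.add 14 7 7) (.not 14)) (.seq
    (countdown 12 7 (.seq (.not 12) (.seq (.add 13 7 12) (.seq (.add 14 13 1)
      (.toffoli 12 14 13))))) (.seq
    (.phase 7) (.seq
    (countdown 12 7 (.seq (.sub 15 0 12) (.seq (.add 13 7 15) (.seq (.add 14 13 1)
      (.seq (.toffoli 15 14 13) (.not 15)))))) (.seq (.add 14 7 7) (.not 14)))))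

/-- One step of amplitude amplification. -/
def ampStepProg : Prog :=
  .seq rowPhases (.seq samplingInv (.seq reflectionProg sampling))

/-- The quantum part of a trial up to the measurements. -/
def trialUnitary : Prog := .seq sampling (.seq (countdown 10 4 ampStepProg) rowParity)

/-- The registers with constant contents. -/
structure Layout (n : ℕ) (r : ℕ → ℕ) : Prop where
  r0 : r 0 = n
  r1 : r 1 = 1
  r7 : r 7 = n + 1
  r8 : r 8 = (n + 1) * (n + 1)
  r9 : r 9 = 0

lemma Layout.of_sameBelow {n d : ℕ} {r r₀ : ℕ → ℕ} (h : Layout n r₀) (hd : 9 < d)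
    (hr : SameBelow d r r₀) : Layout n r :=
  ⟨(hr 0 (by omega)).trans h.r0, (hr 1 (by omega)).trans h.r1, (hr 7 (by omega)).trans h.r7,
    (hr 8 (by omega)).trans h.r8, (hr 9 (by omega)).trans h.r9⟩

/-- The memory holds the vector `V` from address `a` on. -/
def HasRow (n : ℕ) (m : ℕ → ℕ) (a : ℕ) (V : ℕ → ZMod 2) : Prop := ∀ i ≤ n, m (a + i) = (V i).val

section Subroutines

variable {n : ℕ} {f g : BoolFun n} {r₀ m₀ : ℕ → ℕ} {V : ℕ → ZMod 2}

lemma sameBelow_update_iff {d a x : ℕ} {r r' : ℕ → ℕ} (h : d ≤ a) :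
    SameBelow d (Function.update r a x) r' ↔ SameBelow d r r' := by
  refine forall₂_congr fun b hb => ?_
  rw [Function.update_of_ne (by omega)]

lemma implements_hadamards (h : Layout n r₀) :
    Implements f g 12 r₀ m₀ hadamards (n * 4 + 3) 0 (sweep gateH n) := by
  refine implements_countdown (d' := 13) (κ := 0) le_rfl (by omega) (by omega) (by omega)
    h.r1 h.r9 h.r0 fun i hi r₁ _ hi' => implements_of_wp (P := .had 12) fun r ψ hr => ?_
  simp [wp, hr 12 (by omega), hi', hr]

lemma implements_phase {d a : ℕ} (ha : a < d) :
    Implements f g d r₀ m₀ (.phase a) 1 0 (gateZ (r₀ a)) :=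
  implements_of_wp (P := .phase a) fun r ψ hr => by simp [wp, hr a ha, hr]

lemma implements_sampling (h : Layout n r₀) :
    Implements f g 12 r₀ m₀ sampling (8 * n + 13) 2
      ((sweep gateH n).comp ((gateOracle g n 0).comp ((gateZ n).comp
        ((gateOracle f n 0).comp (sweep gateH n))))) := by
  have hF := implements_queryF (f := f) (g := g) (r₀ := r₀) (m₀ := m₀) (d := 12) (a := 0) (b := 9)
    (by omega) (by omega)
  have hG := implements_queryG (f := f) (g := g) (r₀ := r₀) (m₀ := m₀) (d := 12) (a := 0) (b := 9)
    (by omega) (by omega)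
  have hZ := implements_phase (f := f) (g := g) (r₀ := r₀) (m₀ := m₀) (d := 12) (a := 0) (by omega)
  rw [h.r0] at hF hG hZ
  rw [h.r9] at hF hG
  have hH := implements_hadamards (f := f) (g := g) (m₀ := m₀) h
  exact (hH.seq (hF.seq (hZ.seq (hG.seq hH)))).weaken (by omega)

lemma implements_samplingInv (h : Layout n r₀) :
    Implements f g 12 r₀ m₀ samplingInv (8 * n + 13) 2
      ((sweep gateH n).comp ((gateOracle f n 0).comp ((gateZ n).comp
        ((gateOracle g n 0).comp (sweep gateH n))))) := by
  have hF := implements_queryF (f := f) (g := g) (r₀ := r₀) (m₀ := m₀) (d := 12) (a := 0) (b := 9)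
    (by omega) (by omega)
  have hG := implements_queryG (f := f) (g := g) (r₀ := r₀) (m₀ := m₀) (d := 12) (a := 0) (b := 9)
    (by omega) (by omega)
  have hZ := implements_phase (f := f) (g := g) (r₀ := r₀) (m₀ := m₀) (d := 12) (a := 0) (by omega)
  rw [h.r0] at hF hG hZ
  rw [h.r9] at hF hG
  have hH := implements_hadamards (f := f) (g := g) (m₀ := m₀) h
  exact (hH.seq (hG.seq (hZ.seq (hF.seq hH)))).weaken (by omega)

lemma implements_rowPhases (h : Layout n r₀) (hV : HasRow n m₀ (r₀ 3) V) :
    Implements f g 12 r₀ m₀ rowPhases (n * 9 + 3) 0 (sweep (zGate V) n) := by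
  refine implements_countdown (d' := 13) (κ := 0) le_rfl (by omega) (by omega) (by omega)
    h.r1 h.r9 h.r0 fun i hi r₁ hr₁ hi' => implements_of_wp fun r ψ hr => ?_
  have h3 : r 3 = r₀ 3 := (hr 3 (by omega)).trans (hr₁ 3 (by omega))
  have h12 : r 12 = i := (hr 12 (by omega)).trans hi'
  rcases zmod_two_cases (V i) with hv | hv <;>
    simp [wp, h3, h12, hV i hi.le, sameBelow_update_iff, hr, zGate, hv, ZMod.val_one]

lemma implements_rowParity (h : Layout n r₀) (hV : HasRow n m₀ (r₀ 3) V) :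
    Implements f g 12 r₀ m₀ rowParity (n * 9 + 3) 0 (sweep (parityGate V (n + 1)) n) := by
  refine implements_countdown (d' := 13) (κ := 0) le_rfl (by omega) (by omega) (by omega)
    h.r1 h.r9 h.r0 fun i hi r₁ hr₁ hi' => implements_of_wp fun r ψ hr => ?_
  have h3 : r 3 = r₀ 3 := (hr 3 (by omega)).trans (hr₁ 3 (by omega))
  have h7 : r 7 = n + 1 := (hr 7 (by omega)).trans ((hr₁ 7 (by omega)).trans h.r7)
  have h12 : r 12 = i := (hr 12 (by omega)).trans hi'
  rcases zmod_two_cases (V i) with hv | hv <;>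
    simp [wp, h3, h7, h12, hV i hi.le, sameBelow_update_iff, hr, parityGate, hv, ZMod.val_one]

lemma implements_reflectionProg (h : Layout n r₀) :
    Implements f g 12 r₀ m₀ reflectionProg (22 * n + 39) 0 (reflection n) := by
  have hX : Implements f g 12 r₀ m₀ (.seq (.add 14 7 7) (.not 14)) 3 0
      (gateX (n + 1 + (n + 1))) := implements_of_wp (P := .seq (.add 14 7 7) (.not 14))
    fun r ψ hr => by
      have h7 : r 7 = n + 1 := (hr 7 (by omega)).trans h.r7
      simp [wp, h7, sameBelow_update_iff, hr]
  have hZ := implements_phase (f := f) (g := g) (r₀ := r₀) (m₀ := m₀) (d := 12) (a := 7) (by omega)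
  rw [h.r7] at hZ
  have hC : Implements f g 12 r₀ m₀ (countdown 12 7 (.seq (.not 12) (.seq (.add 13 7 12)
      (.seq (.add 14 13 1) (.toffoli 12 14 13))))) ((n + 1) * 10 + 3) 0
      (sweep (rung (n + 1)) (n + 1)) := by
    refine implements_countdown (d' := 13) (κ := 0) le_rfl (by omega) (by omega) (by omega)
      h.r1 h.r9 h.r7 fun i hi r₁ hr₁ hi' => implements_of_wp fun r ψ hr => ?_
    have h1 : r 1 = 1 := (hr 1 (by omega)).trans ((hr₁ 1 (by omega)).trans h.r1)
    have h7 : r 7 = n + 1 := (hr 7 (by omega)).trans ((hr₁ 7 (by omega)).trans h.r7)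
    have h12 : r 12 = i := (hr 12 (by omega)).trans hi'
    simp [wp, h1, h7, h12, sameBelow_update_iff, hr, rung]
  have hU : Implements f g 12 r₀ m₀ (countdown 12 7 (.seq (.sub 15 0 12) (.seq (.add 13 7 15)
      (.seq (.add 14 13 1) (.seq (.toffoli 15 14 13) (.not 15)))))) ((n + 1) * 12 + 3) 0
      (sweep (fun i => rungInv (n + 1) (n - i)) (n + 1)) := by
    refine implements_countdown (d' := 13) (κ := 0) le_rfl (by omega) (by omega) (by omega)
      h.r1 h.r9 h.r7 fun i hi r₁ hr₁ hi' => implements_of_wp fun r ψ hr => ?_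
    have h0 : r 0 = n := (hr 0 (by omega)).trans ((hr₁ 0 (by omega)).trans h.r0)
    have h1 : r 1 = 1 := (hr 1 (by omega)).trans ((hr₁ 1 (by omega)).trans h.r1)
    have h7 : r 7 = n + 1 := (hr 7 (by omega)).trans ((hr₁ 7 (by omega)).trans h.r7)
    have h12 : r 12 = i := (hr 12 (by omega)).trans hi'
    simp [wp, h0, h1, h7, h12, sameBelow_update_iff, hr, rungInv]
  exact (hX.seq (hC.seq (hZ.seq (hU.seq hX)))).weaken (by omega)

end Subroutines

section Trial

variable {n : ℕ} {f g : BoolFun n} {r₀ m₀ : ℕ → ℕ} {V : ℕ → ZMod 2}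

lemma Implements.lower {d d' τ κ : ℕ} {P : Prog} {U : QState →ₗ[ℂ] QState} (hd : d ≤ d')
    (h : ∀ r, SameBelow d r r₀ → Implements f g d' r m₀ P τ κ U) :
    Implements f g d r₀ m₀ P τ κ U := by
  rintro ψ₀ K r m ψ ⟨hr, rfl, rfl⟩
  refine (h r hr ψ K r m ψ ⟨fun _ _ => rfl, rfl, rfl⟩).mono ?_
  rintro c ⟨hK, hr', hm, hψ⟩
  exact ⟨hK, (hr'.mono hd).trans hr, hm, hψ⟩

lemma HasRow.congr_addr {m : ℕ → ℕ} {a b : ℕ} (h : HasRow n m a V) (hab : a = b) :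
    HasRow n m b V := hab ▸ h

/-- One step of amplitude amplification, as a linear map. -/
def ampStepMap (f g : BoolFun n) (V : ℕ → ZMod 2) : QState →ₗ[ℂ] QState :=
  ((sweep gateH n).comp ((gateOracle g n 0).comp ((gateZ n).comp
    ((gateOracle f n 0).comp (sweep gateH n))))).comp ((reflection n).comp
  (((sweep gateH n).comp ((gateOracle f n 0).comp ((gateZ n).comp
    ((gateOracle g n 0).comp (sweep gateH n))))).comp (sweep (zGate V) n)))

lemma implements_ampStepProg (h : Layout n r₀) (hV : HasRow n m₀ (r₀ 3) V) :
    Implements f g 12 r₀ m₀ ampStepProg (47 * n + 71) 4 (ampStepMap f g V) :=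
  (((implements_rowPhases h hV).seq ((implements_samplingInv h).seq
    ((implements_reflectionProg h).seq (implements_sampling h))))).weaken (by omega)

lemma implements_trialUnitary (h : Layout n r₀) (hV : HasRow n m₀ (r₀ 3) V) :
    Implements f g 10 r₀ m₀ trialUnitary ((r₀ 4 + 1) * (47 * n + 74)) (2 * (2 * r₀ 4 + 1))
      ((sweep (parityGate V (n + 1)) n).comp ((sweep (fun _ => ampStepMap f g V) (r₀ 4)).comp
        ((sweep gateH n).comp ((gateOracle g n 0).comp ((gateZ n).comp
          ((gateOracle f n 0).comp (sweep gateH n))))))) := by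
  have h1 : Implements f g 10 r₀ m₀ sampling _ _ _ := Implements.lower (d' := 12) (by omega)
    fun r hr => implements_sampling (h.of_sameBelow (by omega) hr)
  have h3 : Implements f g 10 r₀ m₀ rowParity _ _ _ := Implements.lower (d' := 12) (by omega)
    fun r hr => implements_rowParity (h.of_sameBelow (by omega) hr)
      (hV.congr_addr (hr 3 (by omega)).symm)
  have h2 : Implements f g 10 r₀ m₀ (countdown 10 4 ampStepProg)
      (r₀ 4 * (47 * n + 71 + 3) + 3) (r₀ 4 * 4) (sweep (fun _ => ampStepMap f g V) (r₀ 4)) :=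
    implements_countdown (d' := 12) (by omega) (by omega) (by omega) (by omega) h.r1 h.r9 rfl
      fun i _ r hr _ => implements_ampStepProg (h.of_sameBelow (by omega) hr)
        (hV.congr_addr (hr 3 (by omega)).symm)
  have h4 := h1.seq (h2.seq h3)
  have e : 2 + (r₀ 4 * 4 + 0) = 2 * (2 * r₀ 4 + 1) := by ring
  rw [e] at h4
  refine h4.weaken ?_
  nlinarith

lemma ampStepMap_emb (φ : Amp n) :
    ampStepMap f g V (emb 0 φ) = emb 0 (ampStep f g (fun i : Fin n => V i) φ) := by
  simp only [ampStepMap, LinearMap.comp_apply, sweep_zGate_emb, sweep_gateH_emb, gateOracle_emb,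
    gateZ_emb, reflection_emb, ampStep, sampleAmp]

lemma sweep_ampStepMap_emb (N : ℕ) (φ : Amp n) :
    sweep (fun _ => ampStepMap f g V) N (emb 0 φ)
      = emb 0 ((ampStep f g (fun i : Fin n => V i))^[N] φ) := by
  induction N generalizing φ with
  | zero => rfl
  | succ N ih => rw [sweep, LinearMap.comp_apply, ampStepMap_emb, ih, Function.iterate_succ_apply]

lemma emb_zeroAmp : emb 0 (zeroAmp n) = ket fun _ => 0 := by
  rw [emb, Finset.sum_eq_single 0]
  · simp [zeroAmp, lab_zero]
  · intro z _ hz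
    simp [zeroAmp, hz]
  · simp

/-- The outcome of the quantum part of a trial. -/
lemma triple_trialUnitary (h : Layout n r₀) (hV : HasRow n m₀ (r₀ 3) V) (a : ℂ) :
    Triple f g (fun r m ψ => SameBelow 10 r r₀ ∧ m = m₀ ∧ ψ = a • ket fun _ => 0)
      trialUnitary ((r₀ 4 + 1) * (47 * n + 74)) (2 * (2 * r₀ 4 + 1))
      (fun r m ψ => SameBelow 10 r r₀ ∧ m = m₀ ∧
        ψ = a • emb (fun z => dot (fun i : Fin n => V i) z.1)
          ((ampStep f g (fun i : Fin n => V i))^[r₀ 4] (sample f g))) := by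
  refine (implements_trialUnitary h hV (a • ket fun _ => 0)).conseq (fun _ _ _ h => h) ?_ le_rfl
  rintro r m ψ ⟨hr, hm, rfl⟩
  refine ⟨hr, hm, ?_⟩
  rw [map_smul, ← emb_zeroAmp (n := n)]
  simp only [LinearMap.comp_apply, sweep_gateH_emb, gateOracle_emb, gateZ_emb,
    sweep_ampStepMap_emb, sweep_parityGate_emb]
  rfl

open Classical in
lemma normSq_project_trial (a : ℂ) (v : Cube n) (r : ℕ) (b : ZMod 2) :
    normSq (project (n + 1) b (a • emb (fun z => dot v z.1) ((ampStep f g v)^[r] (sample f g))))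
      = ENNReal.ofReal (‖a‖ ^ 2 * if b = 0 then Real.cos ((2 * r + 1) * angle f g v) ^ 2
          else Real.sin ((2 * r + 1) * angle f g v) ^ 2) := by
  obtain ⟨A, B, h, hA, hB⟩ := exists_iterate_ampStep f g v r
  rw [project_emb, normSq_smul_emb, h]
  congr 2
  have hs := sin_angle_sq f g v
  have hc : Real.cos (angle f g v) ^ 2 = 1 - successProb f g v := by
    rw [← hs, ← Real.sin_sq_add_cos_sq (angle f g v)]
    ring
  have hone : ((-1 : ℝ) ^ r) ^ 2 = 1 := by rw [← pow_mul, mul_comm, pow_mul]; simp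
  rcases zmod_two_cases b with rfl | rfl
  · have : Real.cos ((2 * r + 1) * angle f g v) ^ 2
        = (A * Real.cos (angle f g v)) ^ 2 := by rw [hA, mul_pow, hone, one_mul]
    rw [if_pos rfl, this, mul_pow, hc, ← sum_sample_sq_of_dot_eq_zero, Finset.mul_sum]
    refine Finset.sum_congr rfl fun z _ => ?_
    rcases zmod_two_cases (dot v z.1) with h' | h' <;> simp [h']
    ring
  · have : Real.sin ((2 * r + 1) * angle f g v) ^ 2
        = (B * Real.sin (angle f g v)) ^ 2 := by rw [hB, mul_pow, hone, one_mul]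
    rw [if_neg one_ne_zero, this, mul_pow, hs, successProb, Finset.mul_sum]
    refine Finset.sum_congr rfl fun z _ => ?_
    rcases zmod_two_cases (dot v z.1) with h' | h' <;> simp [h']
    ring

/-- The labels that remain after the measurement of the success flag. -/
lemma exists_of_mem_support_project {s : Cube n} (hg : ∀ x, g x = f (x + s)) {a : ℂ} {v : Cube n}
    {r : ℕ} {b : ZMod 2} {x : Label}
    (hx : project (n + 1) b
      (a • emb (fun z => dot v z.1) ((ampStep f g v)^[r] (sample f g))) x ≠ 0) :
    ∃ w : Cube n, x = lab w (dot w s) b ∧ dot v w = b := by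
  classical
  rw [project_emb] at hx
  obtain ⟨⟨w, b'⟩, hz, rfl⟩ := exists_of_mem_support_emb hx
  obtain ⟨A, B, h, -, -⟩ := exists_iterate_ampStep f g v r
  simp only [h, ne_eq, ite_eq_right_iff, Classical.not_imp] at hz
  obtain ⟨hb, hz⟩ := hz
  have := right_ne_zero_of_mul hz
  rw [sample_apply hg] at this
  have hb' : b' = dot w s := by
    by_contra hne
    simp [hne] at this
  exact ⟨w, by rw [hb', hb], hb⟩

end Trial

/-! ### Reading out a sample -/

/-- Measure the data qubits, reset them, and put the outcomes into the memory from address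
`(n + 1)²` on. -/
def collect : Prog :=
  countdown 12 7 (.seq (.measure 13 12) (.seq (.add 14 8 12) (.seq (.store 14 13)
    (.ite 13 (.not 12) .skip))))

section Collect

variable {n : ℕ} {f g : BoolFun n} {r₀ m₀ : ℕ → ℕ}

lemma gateX_apply (q : ℕ) (ψ : QState) (y : Label) :
    gateX q ψ y = ψ (Function.update y q (y q + 1)) := by
  simpa [gateX] using linExt_perm_apply (involutive_flip q) (fun _ => 1) ψ y

lemma of_project_ne_zero {q : ℕ} {b : ZMod 2} {ψ : QState} {x : Label}
    (h : project q b ψ x ≠ 0) : ψ x ≠ 0 ∧ x q = b := by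
  classical
  rw [project, Finsupp.filter_apply] at h
  exact ⟨fun h' => h (by simp [h']), by by_contra h'; simp [h'] at h⟩

/-- Whatever the outcomes, a label `x` in the support of the final state comes from a label `y` of
the initial support, whose first `n + 1` bits have been moved to the memory. -/
lemma triple_collect (h : Layout n r₀) (D : Label → Prop) :
    Triple f g (fun r m ψ => SameBelow 12 r r₀ ∧ (∀ a < (n + 1) * (n + 1), m a = m₀ a) ∧
        ∀ x, ψ x ≠ 0 → D x)
      collect ((n + 1) * 11 + 3) 0
      (fun r m ψ => SameBelow 12 r r₀ ∧ (∀ a < (n + 1) * (n + 1), m a = m₀ a) ∧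
        ∀ x, ψ x ≠ 0 → ∃ y, D y ∧
          (∀ l ≤ n, m ((n + 1) * (n + 1) + l) = (y l).val ∧ x l = 0) ∧
          ∀ l, n < l → x l = y l) := by
  set W := (n + 1) * (n + 1) with hW
  refine (triple_countdown (κ := 0) (N := n + 1) (I := fun i r m ψ => SameBelow 12 r r₀ ∧
    (∀ a < W, m a = m₀ a) ∧ ∀ x, ψ x ≠ 0 → ∃ y, D y ∧
      (∀ l ≤ n, i ≤ l → m (W + l) = (y l).val ∧ x l = 0) ∧
      ∀ l, l < i ∨ n < l → x l = y l) ?_ ?_ ?_ ?_).conseq ?_ ?_ le_rfl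
  · rintro r m ψ ⟨hr, -⟩
    exact ⟨(hr 7 (by omega)).trans h.r7, (hr 9 (by omega)).trans h.r9⟩
  · rintro i r m ψ ⟨hr, -⟩
    exact (hr 1 (by omega)).trans h.r1
  · rintro i r m ψ x ⟨hr, h'⟩
    exact ⟨hr.update le_rfl x, h'⟩
  · refine fun i hi => triple_of_wp ?_ (le_of_eq rfl)
    rintro r m ψ ⟨⟨hr, hm, hψ⟩, h12⟩
    have h8 : r 8 = W := (hr 8 (by omega)).trans h.r8
    simp only [wp, sameBelow_update_iff, Function.update_self, ne_eq, one_ne_zero, not_true_eq_false,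
      not_false_eq_true, forall_const, false_implies, true_and, and_true, h12, hr, h8,
      Function.update_of_ne, show (12 : ℕ) ≠ 13 by omega, show (12 : ℕ) ≠ 14 by omega,
      show (8 : ℕ) ≠ 13 by omega, show (13 : ℕ) ≠ 14 by omega,
      show (12 : ℕ) ≤ 13 by omega, show (12 : ℕ) ≤ 14 by omega]
    -- The outcomes `0` and `1`; after the latter, the qubit is flipped.
    constructor
    · refine ⟨fun a ha => by rw [Function.update_of_ne (by omega), hm a ha], fun x hx => ?_⟩
      obtain ⟨hx, hx0⟩ := of_project_ne_zero hx
      obtain ⟨y, hD, h1, h2⟩ := hψ x hx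
      refine ⟨y, hD, fun l hl hil => ?_, fun l hl => h2 l (by omega)⟩
      rcases hil.eq_or_lt with rfl | hil
      · rw [Function.update_self, ← h2 i (by omega), hx0]
        exact ⟨rfl, rfl⟩
      · rw [Function.update_of_ne (by omega)]
        exact h1 l hl hil
    · refine ⟨fun a ha => by rw [Function.update_of_ne (by omega), hm a ha], fun x hx => ?_⟩
      rw [gateX_apply] at hx
      obtain ⟨hx, hx1⟩ := of_project_ne_zero hx
      rw [Function.update_self] at hx1
      obtain ⟨y, hD, h1, h2⟩ := hψ _ hx
      refine ⟨y, hD, fun l hl hil => ?_, fun l hl => ?_⟩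
      · rcases hil.eq_or_lt with rfl | hil
        · rw [Function.update_self, ← h2 i (by omega), Function.update_self, hx1]
          exact ⟨by simp [ZMod.val_one], by simpa using hx1⟩
        · rw [Function.update_of_ne (by omega)]
          have := h1 l hl hil
          rwa [Function.update_of_ne (by omega)] at this
      · rw [← h2 l (by omega), Function.update_of_ne (by omega)]
  · rintro r m ψ ⟨hr, hm, hψ⟩
    exact ⟨hr, hm, fun x hx => ⟨x, hψ x hx, fun l hl hl' => by omega, fun l _ => rfl⟩⟩
  · rintro r m ψ ⟨hr, hm, hψ⟩
    refine ⟨hr, hm, fun x hx => ?_⟩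
    obtain ⟨y, hD, h1, h2⟩ := hψ x hx
    exact ⟨y, hD, fun l hl => h1 l hl (Nat.zero_le l), fun l hl => h2 l (Or.inr hl)⟩

lemma eq_smul_ket_of_support {ψ : QState} (h : ∀ x, ψ x ≠ 0 → x = fun _ => 0) :
    ψ = ψ (fun _ => 0) • ket fun _ => 0 := by
  classical
  ext x
  by_cases hx : x = fun _ => 0
  · subst hx
    simp [ket]
  · have : ψ x = 0 := by
      by_contra h'
      exact hx (h x h')
    simp [ket, this, Ne.symm hx]

/-- Reset of the success flag. -/
def resetFlag : Prog := .ite 11 (.not 7) .skip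

/-- Reading out a sample, once the flag has been measured. -/
lemma triple_readout (h : Layout n r₀) (s v : Cube n) {b : ZMod 2} (hb : r₀ 11 = b.val) :
    Triple f g (fun r m ψ => SameBelow 12 r r₀ ∧ m = m₀ ∧
        ∀ x, ψ x ≠ 0 → ∃ w : Cube n, x = lab w (dot w s) b ∧ dot v w = b)
      (.seq resetFlag collect) (11 * n + 17) 0
      (fun r m ψ => SameBelow 12 r r₀ ∧ (∀ a < (n + 1) * (n + 1), m a = m₀ a) ∧
        (∃ a : ℂ, ψ = a • ket fun _ => 0) ∧ (ψ ≠ 0 → ∃ w : Cube n, dot v w = b ∧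
          (∀ i : Fin n, m ((n + 1) * (n + 1) + i) = (w i).val) ∧
          m ((n + 1) * (n + 1) + n) = (dot w s).val)) := by
  have h1 : Triple f g (fun r m ψ => SameBelow 12 r r₀ ∧ m = m₀ ∧
        ∀ x, ψ x ≠ 0 → ∃ w : Cube n, x = lab w (dot w s) b ∧ dot v w = b) resetFlag 2 0
      (fun r m ψ => SameBelow 12 r r₀ ∧ (∀ a < (n + 1) * (n + 1), m a = m₀ a) ∧
        ∀ x, ψ x ≠ 0 → ∃ w : Cube n, x = lab w (dot w s) 0 ∧ dot v w = b) := by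
    refine triple_of_wp ?_ (le_of_eq rfl)
    rintro r m ψ ⟨hr, rfl, hψ⟩
    have h11 : r 11 = b.val := (hr 11 (by omega)).trans hb
    have h7 : r 7 = n + 1 := (hr 7 (by omega)).trans h.r7
    rcases zmod_two_cases b with rfl | rfl
    · refine ⟨fun h' => absurd (by simpa using h11) h', fun _ => ⟨hr, fun _ _ => rfl, hψ⟩⟩
    · refine ⟨fun _ => ⟨hr, fun _ _ => rfl, fun x hx => ?_⟩, fun h' => ?_⟩
      · rw [h7, gateX_apply] at hx
        obtain ⟨w, hw, hv⟩ := hψ _ hx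
        refine ⟨w, ?_, hv⟩
        have := congrArg (fun y => Function.update y (n + 1) (y (n + 1) + 1)) hw
        simpa [update_lab_succ, zmod_two_add_self, add_assoc] using this
      · simp [h11, ZMod.val_one] at h'
  refine (h1.seq (triple_collect h fun x => ∃ w : Cube n, x = lab w (dot w s) 0 ∧
    dot v w = b)).conseq (fun _ _ _ h => h) ?_ (by omega)
  rintro r m ψ ⟨hr, hm, hψ⟩
  have hz : ∀ x, ψ x ≠ 0 → x = fun _ => 0 := by
    intro x hx
    obtain ⟨y, ⟨w, rfl, -⟩, h2, h3⟩ := hψ x hx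
    funext l
    rcases le_or_gt l n with hl | hl
    · exact (h2 l hl).2
    · rw [h3 l hl]
      rcases (Nat.succ_le_of_lt hl).eq_or_lt with rfl | hl
      · simp
      · exact lab_of_gt hl
  refine ⟨hr, hm, ⟨_, eq_smul_ket_of_support hz⟩, fun h0 => ?_⟩
  obtain ⟨x, hx⟩ : ∃ x, ψ x ≠ 0 := by
    by_contra h'
    push Not at h'
    exact h0 (Finsupp.ext h')
  obtain ⟨y, ⟨w, rfl, hv⟩, h2, -⟩ := hψ x hx
  refine ⟨w, hv, fun i => ?_, ?_⟩
  · simpa using (h2 i i.2.le).1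
  · simpa using (h2 n le_rfl).1

end Collect

/-! ### Elimination -/

section Elimination

/-- The hidden shift `s` lies in the affine space `R 0 + span (R 1, …, R k)`, where row `j + 1` has
its first nonzero coordinate at `j`.  The coordinate `n` is used to treat all rows alike: it is `1`
for row `0`, and `0` for the other rows. -/
structure Rows {n : ℕ} (s : Cube n) (k : ℕ) (R : ℕ → ℕ → ZMod 2) : Prop where
  lead : ∀ j < k, R (j + 1) j = 1
  below : ∀ j < k, ∀ i < j, R (j + 1) i = 0
  dir : ∀ j < k, R (j + 1) n = 0
  aff : R 0 n = 1
  span : ∃ a : ℕ → ZMod 2, ∀ i : Fin n, s i = R 0 i + ∑ j ∈ Finset.range k, a j * R (j + 1) i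

/-- The value of row `j` on the sample `w`. -/
def rowDot (n : ℕ) (R : ℕ → ℕ → ZMod 2) (w : ℕ → ZMod 2) (j : ℕ) : ZMod 2 :=
  ∑ l ∈ Finset.range (n + 1), R j l * w l

/-- The rows after elimination of row `k` with the sample `w`. -/
def eliminated (n k : ℕ) (R : ℕ → ℕ → ZMod 2) (w : ℕ → ZMod 2) : ℕ → ℕ → ZMod 2 :=
  fun j i => R j i + rowDot n R w j * R k i

/-- A sample `w` with `w · R k = 1`, together with the value `w · s`, cuts the affine space down to
a hyperplane that is transversal to `R k`. -/
lemma Rows.eliminate {n k : ℕ} {s : Cube n} {R : ℕ → ℕ → ZMod 2} {w : ℕ → ZMod 2}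
    (h : Rows s (k + 1) R) (hw : w n = ∑ i : Fin n, w i * s i)
    (hk : ∑ i : Fin n, R (k + 1) i * w i = 1) : Rows s k (eliminated n (k + 1) R w) := by
  have hdot : rowDot n R w (k + 1) = 1 := by
    rw [rowDot, Finset.sum_range_succ, Finset.sum_range, hk, h.dir k (by omega), zero_mul, add_zero]
  refine ⟨fun j hj => ?_, fun j hj i hi => ?_, fun j hj => ?_, ?_, ?_⟩
  · rw [eliminated, h.lead j (by omega), h.below k (by omega) j hj, mul_zero, add_zero]
  · rw [eliminated, h.below j (by omega) i hi, h.below k (by omega) i (by omega), mul_zero,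
      add_zero]
  · rw [eliminated, h.dir j (by omega), h.dir k (by omega), mul_zero, add_zero]
  · rw [eliminated, h.aff, h.dir k (by omega), mul_zero, add_zero]
  · obtain ⟨a, ha⟩ := h.span
    refine ⟨a, fun i => ?_⟩
    have key : rowDot n R w 0 + ∑ j ∈ Finset.range (k + 1), a j * rowDot n R w (j + 1) = 0 := by
      have e1 : rowDot n R w 0 = (∑ l : Fin n, R 0 l * w l) + w n := by
        rw [rowDot, Finset.sum_range_succ, Finset.sum_range, h.aff, one_mul]
      have e2 : ∑ j ∈ Finset.range (k + 1), a j * rowDot n R w (j + 1)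
          = ∑ l : Fin n, (∑ j ∈ Finset.range (k + 1), a j * R (j + 1) l) * w l := by
        simp only [Finset.sum_mul]
        rw [Finset.sum_comm]
        refine Finset.sum_congr rfl fun j hj => ?_
        rw [rowDot, Finset.sum_range_succ, Finset.sum_range, h.dir j (Finset.mem_range.1 hj),
          zero_mul, add_zero, Finset.mul_sum]
        exact Finset.sum_congr rfl fun l _ => by ring
      have e3 : (∑ l : Fin n, R 0 l * w l)
          + ∑ l : Fin n, (∑ j ∈ Finset.range (k + 1), a j * R (j + 1) l) * w l = w n := by
        rw [← Finset.sum_add_distrib, hw]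
        refine Finset.sum_congr rfl fun l _ => ?_
        rw [ha l]
        ring
      rw [e1, e2, add_right_comm, e3, zmod_two_add_self]
    rw [Finset.sum_range_succ, hdot, mul_one, ← add_assoc] at key
    have e4 : ∑ j ∈ Finset.range k, a j * eliminated n (k + 1) R w (j + 1) i
        = (∑ j ∈ Finset.range k, a j * R (j + 1) i)
          + (∑ j ∈ Finset.range k, a j * rowDot n R w (j + 1)) * R (k + 1) i := by
      rw [Finset.sum_mul, ← Finset.sum_add_distrib]
      refine Finset.sum_congr rfl fun j _ => ?_
      rw [eliminated]
      ring
    rw [e4, ha i, Finset.sum_range_succ, eliminated]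
    have e5 : a k = rowDot n R w 0 + ∑ j ∈ Finset.range k, a j * rowDot n R w (j + 1) :=
      (CharTwo.add_eq_zero.1 key).symm
    rw [e5]
    ring

end Elimination

/-! ### The elimination program -/

/-- Put the value of the row at address `reg 11` on the sample into register `12`. -/
def rowDotProg : Prog :=
  .seq (.const 12 0) (countdown 13 7 (.seq (.add 14 11 13) (.seq (.load 14 14)
    (.seq (.add 15 8 13) (.seq (.load 15 15) (.ite 14 (.ite 15 (.sub 12 1 12) .skip) .skip))))))

/-- Add row `k` to the row at address `reg 11`. -/
def addRowProg : Prog :=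
  countdown 13 7 (.seq (.add 14 11 13) (.seq (.add 15 3 13) (.seq (.load 15 15)
    (.ite 15 (.seq (.load 16 14) (.seq (.sub 16 1 16) (.store 14 16))) .skip))))

/-- Elimination of row `k`, and reset of the search. -/
def eliminateProg : Prog :=
  .seq (.seq (.add 11 3 9) (countdown 10 2 (.seq (.sub 11 11 7) (.seq rowDotProg
    (.ite 12 addRowProg .skip))))) (.seq (.sub 2 2 1) (.seq (.sub 3 3 7)
      (.seq (.const 4 0) (.seq (.const 5 0) (.const 6 0)))))

section EliminateProg

variable {n : ℕ} {f g : BoolFun n} {r₀ m₀ : ℕ → ℕ} {ψ₀ : QState}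

lemma triple_rowDotProg (h : Layout n r₀) {A w : ℕ → ZMod 2} (hA : HasRow n m₀ (r₀ 11) A)
    (hw : HasRow n m₀ ((n + 1) * (n + 1)) w) :
    Triple f g (fun r m ψ => SameBelow 12 r r₀ ∧ m = m₀ ∧ ψ = ψ₀) rowDotProg (14 * n + 19) 0
      (fun r m ψ => (SameBelow 12 r r₀ ∧ m = m₀ ∧ ψ = ψ₀) ∧
        r 12 = (∑ l ∈ Finset.range (n + 1), A l * w l).val) := by
  set I : ℕ → Assn := fun i r m ψ => (SameBelow 12 r r₀ ∧ m = m₀ ∧ ψ = ψ₀) ∧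
    r 12 = (∑ l ∈ Finset.Ico i (n + 1), A l * w l).val with hI
  have h0 : Triple f g (fun r m ψ => SameBelow 12 r r₀ ∧ m = m₀ ∧ ψ = ψ₀) (.const 12 0) 1 0
      (I (n + 1)) := by
    refine triple_of_wp ?_ (le_of_eq rfl)
    rintro r m ψ ⟨hr, hm, hψ⟩
    refine ⟨⟨hr.update le_rfl _, hm, hψ⟩, ?_⟩
    simp
  have h1 : Triple f g (I (n + 1)) (countdown 13 7 (.seq (.add 14 11 13) (.seq (.load 14 14)
      (.seq (.add 15 8 13) (.seq (.load 15 15) (.ite 14 (.ite 15 (.sub 12 1 12) .skip)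
        .skip)))))) ((n + 1) * (11 + 3) + 3) ((n + 1) * 0) (I 0) := by
    refine triple_countdown ?_ ?_ ?_ ?_
    · rintro r m ψ ⟨⟨hr, -⟩, -⟩
      exact ⟨(hr 7 (by omega)).trans h.r7, (hr 9 (by omega)).trans h.r9⟩
    · rintro i r m ψ ⟨⟨hr, -⟩, -⟩
      exact (hr 1 (by omega)).trans h.r1
    · rintro i r m ψ x ⟨⟨hr, h'⟩, h''⟩
      exact ⟨⟨hr.update (by omega) x, h'⟩, by simpa using h''⟩
    · refine fun i hi => triple_of_wp ?_ (le_of_eq rfl)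
      rintro r m ψ ⟨⟨⟨hr, rfl, rfl⟩, h12⟩, h13⟩
      have h1 : r 1 = 1 := (hr 1 (by omega)).trans h.r1
      have h8 : r 8 = (n + 1) * (n + 1) := (hr 8 (by omega)).trans h.r8
      have h11 : r 11 = r₀ 11 := hr 11 (by omega)
      have hs : ∑ l ∈ Finset.Ico i (n + 1), A l * w l
          = A i * w i + ∑ l ∈ Finset.Ico (i + 1) (n + 1), A l * w l :=
        Finset.sum_eq_sum_Ico_succ_bot hi _
      have hsub : ∀ t : ZMod 2, 1 - t.val = (1 + t).val := by decide
      rcases zmod_two_cases (A i) with ha | ha <;> rcases zmod_two_cases (w i) with hb | hb <;>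
        simp [wp, hI, h1, h8, h11, h12, h13, hA i (by omega), hw i (by omega),
          sameBelow_update_iff, hr, hs, ha, hb, ZMod.val_one, hsub]
  refine (h0.seq h1).conseq (fun _ _ _ h => h) ?_ (by omega)
  rintro r m ψ h'
  simpa [hI, Nat.Ico_zero_eq_range] using h'

lemma triple_addRowProg (h : Layout n r₀) {A B : ℕ → ZMod 2} (hA : HasRow n m₀ (r₀ 11) A)
    (hB : HasRow n m₀ (r₀ 3) B) (hsep : r₀ 11 + n < r₀ 3) :
    Triple f g (fun r m ψ => SameBelow 12 r r₀ ∧ m = m₀ ∧ ψ = ψ₀) addRowProg (15 * n + 18) 0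
      (fun r m ψ => SameBelow 12 r r₀ ∧ ψ = ψ₀ ∧ HasRow n m (r₀ 11) (fun l => A l + B l) ∧
        ∀ a, a < r₀ 11 ∨ r₀ 11 + n < a → m a = m₀ a) := by
  refine (triple_countdown (κ := 0) (N := n + 1) (τ := 12) (I := fun i r m ψ =>
    SameBelow 12 r r₀ ∧ ψ = ψ₀ ∧
      (∀ l ≤ n, m (r₀ 11 + l) = (if i ≤ l then A l + B l else A l).val) ∧
      ∀ a, a < r₀ 11 ∨ r₀ 11 + n < a → m a = m₀ a) ?_ ?_ ?_ ?_).conseq ?_ ?_ (by omega)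
  · rintro r m ψ ⟨hr, -⟩
    exact ⟨(hr 7 (by omega)).trans h.r7, (hr 9 (by omega)).trans h.r9⟩
  · rintro i r m ψ ⟨hr, -⟩
    exact (hr 1 (by omega)).trans h.r1
  · rintro i r m ψ x ⟨hr, h'⟩
    exact ⟨hr.update (by omega) x, h'⟩
  · refine fun i hi => triple_of_wp ?_ (le_of_eq rfl)
    rintro r m ψ ⟨⟨hr, rfl, hm, hm'⟩, h13⟩
    have h1 : r 1 = 1 := (hr 1 (by omega)).trans h.r1
    have h3 : r 3 = r₀ 3 := hr 3 (by omega)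
    have h11 : r 11 = r₀ 11 := hr 11 (by omega)
    have hBi : m (r₀ 3 + i) = (B i).val := by rw [hm' _ (by omega), hB i (by omega)]
    have hAi : m (r₀ 11 + i) = (A i).val := by rw [hm i (by omega), if_neg (by omega)]
    have hsub : ∀ t : ZMod 2, 1 - t.val = (t + 1).val := by decide
    rcases zmod_two_cases (B i) with hb | hb
    · simp only [wp, h3, h11, h13, hBi, hb, sameBelow_update_iff, hr, ZMod.val_zero, ne_eq,
        Function.update_self, not_true_eq_false, false_implies, forall_const, true_and, and_true,
        Function.update_of_ne, show (13 : ℕ) ≠ 14 by omega, show (3 : ℕ) ≠ 14 by omega,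
        show (13 : ℕ) ≠ 15 by omega, show (12 : ℕ) ≤ 14 by omega, show (12 : ℕ) ≤ 15 by omega,
        not_false_eq_true]
      refine ⟨fun l hl => ?_, hm'⟩
      rw [hm l hl]
      rcases eq_or_ne i l with rfl | hil
      · simp [hb]
      · have : i + 1 ≤ l ↔ i ≤ l := by omega
        simp [this]
    · simp only [wp, h1, h3, h11, h13, hBi, hb, sameBelow_update_iff, hr, ZMod.val_one, ne_eq,
        Function.update_self, false_implies, forall_const, true_and, and_true,
        Function.update_of_ne, show (13 : ℕ) ≠ 14 by omega, show (3 : ℕ) ≠ 14 by omega,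
        show (13 : ℕ) ≠ 15 by omega, show (13 : ℕ) ≠ 16 by omega,
        show (12 : ℕ) ≤ 14 by omega, show (12 : ℕ) ≤ 15 by omega,
        show (12 : ℕ) ≤ 16 by omega, show (14 : ℕ) ≠ 15 by omega, show (14 : ℕ) ≠ 16 by omega,
        show (1 : ℕ) ≠ 14 by omega, show (1 : ℕ) ≠ 15 by omega, show (1 : ℕ) ≠ 16 by omega,
        one_ne_zero, not_false_eq_true, hAi, hsub]
      refine ⟨fun l hl => ?_, fun a ha => ?_⟩
      · rcases eq_or_ne i l with rfl | hil
        · simp [hb]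
        · have : i + 1 ≤ l ↔ i ≤ l := by omega
          rw [Function.update_of_ne (by omega), hm l hl]
          simp [this]
      · rw [Function.update_of_ne (by omega), hm' a ha]
  · rintro r m ψ ⟨hr, rfl, hψ⟩
    exact ⟨hr, hψ, fun l hl => by rw [if_neg (by omega), hA l hl], fun _ _ => rfl⟩
  · rintro r m ψ ⟨hr, hψ, hm, hm'⟩
    exact ⟨hr, hψ, fun l hl => by rw [hm l hl, if_pos (Nat.zero_le l)], hm'⟩

/-- The contents of the registers at the start of a trial: `k` directions are left, the next trial
takes `ρ` amplification steps, the current round goes up to `B` steps, and `e = 1` if `ρ` steps have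
already been tried once in this round. -/
structure SearchRegs (n k ρ B e : ℕ) (r : ℕ → ℕ) : Prop extends Layout n r where
  r2 : r 2 = k
  r3 : r 3 = k * (n + 1)
  r4 : r 4 = ρ
  r5 : r 5 = B
  r6 : r 6 = e

lemma SearchRegs.of_sameBelow {k ρ B e d : ℕ} {r : ℕ → ℕ} (h : SearchRegs n k ρ B e r₀)
    (hd : 9 < d) (hr : SameBelow d r r₀) : SearchRegs n k ρ B e r :=
  ⟨h.toLayout.of_sameBelow hd hr, (hr 2 (by omega)).trans h.r2, (hr 3 (by omega)).trans h.r3,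
    (hr 4 (by omega)).trans h.r4, (hr 5 (by omega)).trans h.r5, (hr 6 (by omega)).trans h.r6⟩

lemma row_lt {j j' l : ℕ} (h : j < j') (hl : l ≤ n) : j * (n + 1) + l < j' * (n + 1) := by
  have := Nat.mul_le_mul_right (n + 1) (Nat.succ_le_of_lt h)
  rw [Nat.succ_mul] at this
  omega

/-- The elimination program replaces the rows by `eliminated`, with the sample `w` in the memory, and
puts the search back to its first trial. -/
lemma triple_eliminateProg {k ρ B e : ℕ} (hk : k + 1 ≤ n) {R : ℕ → ℕ → ZMod 2} {w : ℕ → ZMod 2} :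
    Triple f g (fun r m ψ => SearchRegs n (k + 1) ρ B e r ∧ ψ = ψ₀ ∧
        (∀ j ≤ k + 1, HasRow n m (j * (n + 1)) (R j)) ∧ HasRow n m ((n + 1) * (n + 1)) w)
      eliminateProg ((n + 1) * (29 * n + 46) + 15) 0
      (fun r m ψ => SearchRegs n k 0 0 0 r ∧ ψ = ψ₀ ∧
        ∀ j ≤ k, HasRow n m (j * (n + 1)) (eliminated n (k + 1) R w j)) := by
  set I : ℕ → Assn := fun i r m ψ => SearchRegs n (k + 1) ρ B e r ∧ ψ = ψ₀ ∧
    r 11 = i * (n + 1) ∧ (∀ j ≤ k + 1, HasRow n m (j * (n + 1))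
      (if i ≤ j ∧ j ≤ k then eliminated n (k + 1) R w j else R j)) ∧
    HasRow n m ((n + 1) * (n + 1)) w with hI
  have h1 : Triple f g (fun r m ψ => SearchRegs n (k + 1) ρ B e r ∧ ψ = ψ₀ ∧
      (∀ j ≤ k + 1, HasRow n m (j * (n + 1)) (R j)) ∧ HasRow n m ((n + 1) * (n + 1)) w)
      (.add 11 3 9) 1 0 (I (k + 1)) := by
    refine triple_of_wp ?_ (le_of_eq rfl)
    rintro r m ψ ⟨hr, hψ, hR, hw⟩
    refine ⟨hr.of_sameBelow (d := 10) (by omega) ?_, hψ, by simp [hr.r3, hr.r9], ?_, hw⟩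
    · exact (sameBelow_update_iff (by omega)).2 fun _ _ => rfl
    · intro j hj
      rw [if_neg (by omega)]
      exact hR j hj
  have h2 : Triple f g (I (k + 1)) (countdown 10 2 (.seq (.sub 11 11 7) (.seq rowDotProg
      (.ite 12 addRowProg .skip)))) ((k + 1) * (29 * n + 43 + 3) + 3) ((k + 1) * 0) (I 0) := by
    refine triple_countdown ?_ ?_ ?_ ?_
    · rintro r m ψ ⟨hr, -⟩
      exact ⟨hr.r2, hr.r9⟩
    · rintro i r m ψ ⟨hr, -⟩
      exact hr.r1
    · rintro i r m ψ x ⟨hr, h1, h2, h3⟩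
      refine ⟨hr.of_sameBelow (d := 10) (by omega) ?_, h1, by simpa using h2, h3⟩
      exact (sameBelow_update_iff (by omega)).2 fun _ _ => rfl
    · rintro i hi K r m ψ ⟨⟨hr, rfl, h11, hR, hw⟩, h10⟩
      -- The row `i` is still the old one; it is compared with the sample and perhaps changed.
      set r₁ := Function.update r 11 (i * (n + 1)) with hr₁
      have hr₁' : SearchRegs n (k + 1) ρ B e r₁ := hr.of_sameBelow (d := 10) (by omega)
        ((sameBelow_update_iff (by omega)).2 fun _ _ => rfl)
      have h11' : r₁ 11 = i * (n + 1) := by simp [hr₁]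
      have hRi : HasRow n m (r₁ 11) (R i) := by
        have := hR i (by omega)
        rwa [if_neg (by omega), ← h11'] at this
      have hRk : HasRow n m (r₁ 3) (R (k + 1)) := by
        have := hR (k + 1) le_rfl
        rwa [if_neg (by omega), ← hr₁'.r3] at this
      have t1 : Triple f g (fun r' m' ψ' => r' = r ∧ m' = m ∧ ψ' = ψ) (.sub 11 11 7) 1 0
          (fun r' m' ψ' => SameBelow 12 r' r₁ ∧ m' = m ∧ ψ' = ψ) := by
        refine triple_of_wp ?_ (le_of_eq rfl)
        rintro r' m' ψ' ⟨rfl, rfl, rfl⟩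
        have : r' 11 - r' 7 = i * (n + 1) := by
          rw [h11, hr.r7, Nat.succ_mul, Nat.add_sub_cancel]
        refine ⟨?_, rfl, rfl⟩
        rw [this]
        exact fun _ _ => rfl
      have t2 := triple_rowDotProg (f := f) (g := g) (ψ₀ := ψ) hr₁'.toLayout hRi hw
      have t3 : Triple f g (fun r' m' ψ' => (SameBelow 12 r' r₁ ∧ m' = m ∧ ψ' = ψ) ∧
          r' 12 = (rowDot n R w i).val) (.ite 12 addRowProg .skip) (15 * n + 19) 0
          (fun r' m' ψ' => SameBelow 12 r' r₁ ∧ ψ' = ψ ∧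
            HasRow n m' (r₁ 11) (eliminated n (k + 1) R w i) ∧
            ∀ a, a < r₁ 11 ∨ r₁ 11 + n < a → m' a = m a) := by
        rcases zmod_two_cases (rowDot n R w i) with hd | hd
        · refine (Triple.ite (τ := 1) (τ' := 1) (fun K r' m' ψ' h => ?_)
            (triple_of_wp ?_ (le_of_eq rfl))).conseq (fun _ _ _ h => h) (fun _ _ _ h => h)
            (by omega)
          · exact absurd (by simpa [hd] using h.1.2) h.2
          · rintro r' m' ψ' ⟨⟨⟨hr', rfl, hψ'⟩, -⟩, -⟩
            refine ⟨hr', hψ', fun l hl => ?_, fun _ _ => rfl⟩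
            rw [eliminated, hd, zero_mul, add_zero, hRi l hl]
        · refine (Triple.ite (τ := 15 * n + 18) (τ' := 1) ((triple_addRowProg (f := f) (g := g)
            (ψ₀ := ψ) hr₁'.toLayout hRi hRk ?_).conseq (fun _ _ _ h => h.1.1) ?_ le_rfl)
            (fun K r' m' ψ' h => ?_)).conseq (fun _ _ _ h => h) (fun _ _ _ h => h) (by omega)
          · rw [h11', hr₁'.r3]
            exact row_lt (by omega) le_rfl
          · rintro r' m' ψ' ⟨hr', hψ', hm', hm⟩
            refine ⟨hr', hψ', fun l hl => ?_, hm⟩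
            rw [eliminated, hd, one_mul, hm' l hl]
          · exact absurd h.2 (by simp [h.1.2, hd, ZMod.val_one])
      suffices t4 : Triple f g (fun r' m' ψ' => r' = r ∧ m' = m ∧ ψ' = ψ) (.seq (.sub 11 11 7)
          (.seq rowDotProg (.ite 12 addRowProg .skip))) (29 * n + 43) 0
          (fun r m φ => I i r m φ ∧ r 10 = i) from t4 K r m ψ ⟨rfl, rfl, rfl⟩
      refine (t1.seq (t2.seq t3)).conseq (fun _ _ _ h => h) ?_ (by omega)
      rintro r' m' ψ' ⟨hr', hψ', hm', hm⟩
      rw [h11'] at hm' hm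
      refine ⟨⟨hr₁'.of_sameBelow (by omega) hr', hψ', (hr' 11 (by omega)).trans h11', ?_, ?_⟩,
        (hr' 10 (by omega)).trans (by simpa [hr₁] using h10)⟩
      · intro j hj
        rcases lt_trichotomy j i with hji | rfl | hji
        · have := hR j hj
          rw [if_neg (by omega)] at this ⊢
          intro l hl
          rw [hm _ (Or.inl (by have := row_lt hji hl; omega)), this l hl]
        · rw [if_pos ⟨le_rfl, by omega⟩]
          exact hm'
        · have := hR j hj
          have e : (i ≤ j ∧ j ≤ k) ↔ (i + 1 ≤ j ∧ j ≤ k) := by omega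
          rw [if_congr e rfl rfl]
          intro l hl
          rw [hm _ (Or.inr (by have := row_lt hji (le_refl n); omega)), this l hl]
      · intro l hl
        rw [hm _ (Or.inr (by have := row_lt (show i < n + 1 by omega) (le_refl n); omega)), hw l hl]
  have h3 : Triple f g (I 0) (.seq (.sub 2 2 1) (.seq (.sub 3 3 7) (.seq (.const 4 0)
      (.seq (.const 5 0) (.const 6 0))))) 9 0 (fun r m ψ => SearchRegs n k 0 0 0 r ∧ ψ = ψ₀ ∧
        ∀ j ≤ k, HasRow n m (j * (n + 1)) (eliminated n (k + 1) R w j)) := by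
    refine triple_of_wp ?_ (le_of_eq rfl)
    rintro r m ψ ⟨hr, hψ, -, hR, -⟩
    refine ⟨⟨⟨?_, ?_, ?_, ?_, ?_⟩, ?_, ?_, ?_, ?_, ?_⟩, hψ, fun j hj => ?_⟩
    · simp [hr.r0]
    · simp [hr.r1]
    · simp [hr.r7]
    · simp [hr.r8]
    · simp [hr.r9]
    · simp [hr.r2, hr.r1]
    · simp [hr.r3, hr.r7, Nat.succ_mul]
    · simp
    · simp
    · simp
    · have := hR j (by omega)
      rwa [if_pos ⟨Nat.zero_le j, hj⟩] at this
  refine ((h1.seq h2).seq h3).conseq (fun _ _ _ h => h) (fun _ _ _ h => h) ?_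
  change _ ≤ (n + 1) * (29 * n + 43 + 3) + 15
  have := Nat.mul_le_mul_right (29 * n + 43 + 3) (show k + 1 ≤ n + 1 by omega)
  omega

end EliminateProg

/-! ### The search schedule -/

/-- The number of amplification steps at level `j`: `2 * level j + 1 = 3 ^ j`. -/
def level : ℕ → ℕ
  | 0 => 0
  | j + 1 => 3 * level j + 1

lemma two_mul_level_add_one (j : ℕ) : 2 * level j + 1 = 3 ^ j := by
  induction j with
  | zero => rfl
  | succ j ih =>
    rw [level, pow_succ]
    omega

lemma level_strictMono : StrictMono level :=
  strictMono_nat_of_lt_succ fun j => by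
    rw [level]
    omega

/-- The search for a good sample proceeds in rounds `J = 0, 1, 2, …`; round `J` tries each of the
levels `j = 0, …, J` twice (`e = 0, 1`).  This is the successor of `(J, j, e)`. -/
def nextTrial (σ : ℕ × ℕ × ℕ) : ℕ × ℕ × ℕ :=
  if σ.2.2 = 0 then (σ.1, σ.2.1, 1)
  else if σ.2.1 < σ.1 then (σ.1, σ.2.1 + 1, 0) else (σ.1 + 1, 0, 0)

/-- The condition that `(J, j, e)` is a state of the search. -/
def IsTrial (σ : ℕ × ℕ × ℕ) : Prop := σ.2.1 ≤ σ.1 ∧ σ.2.2 ≤ 1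

lemma IsTrial.next {σ : ℕ × ℕ × ℕ} (h : IsTrial σ) : IsTrial (nextTrial σ) := by
  obtain ⟨h1, h2⟩ := h
  unfold nextTrial IsTrial
  split_ifs <;> simp <;> omega

/-- A potential for the search without the repetitions.  If level `q` succeeds with probability at
least `1 / 2`, the rounds from `q` on fail with probability at most `1 / 4`, and a round costs only
three times as much as the one before. -/
def roundPotential (q J j : ℕ) : ℝ :=
  if J < q then 33 * 3 ^ q - 3 * 3 ^ J - 2 * 3 ^ j
  else if j ≤ q then 30 * 3 ^ J - 2 * 3 ^ j
  else 96 * 3 ^ J - 2 * 3 ^ j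

/-- The bound for the failure probability at level `j`. -/
def failBound (q j : ℕ) : ℝ := if j = q then 1 / 2 else 1

lemma failBound_nonneg (q j : ℕ) : 0 ≤ failBound q j := by
  unfold failBound
  split_ifs <;> norm_num

/-- An upper bound for the expected number of further queries of the search. -/
def potential (q : ℕ) (σ : ℕ × ℕ × ℕ) : ℝ :=
  if σ.2.2 = 0 then roundPotential q σ.1 σ.2.1
  else 2 * 3 ^ σ.2.1 + failBound q σ.2.1 *
    (if σ.2.1 < σ.1 then roundPotential q σ.1 (σ.2.1 + 1) else roundPotential q (σ.1 + 1) 0)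

lemma pow_three_le {i j : ℕ} (h : i ≤ j) : (3 : ℝ) ^ i ≤ 3 ^ j :=
  pow_le_pow_right₀ (by norm_num) h

lemma roundPotential_nonneg {q J j : ℕ} (h : j ≤ J) : 0 ≤ roundPotential q J j := by
  have h1 := pow_three_le h
  have h2 : (0 : ℝ) < 3 ^ j := by positivity
  unfold roundPotential
  split_ifs with h3 h4
  · have := pow_three_le h3.le
    linarith
  · linarith
  · linarith

lemma potential_nonneg {q : ℕ} {σ : ℕ × ℕ × ℕ} (h : IsTrial σ) : 0 ≤ potential q σ := by
  have h0 := failBound_nonneg q σ.2.1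
  unfold potential
  split_ifs with h1 h2
  · exact roundPotential_nonneg h.1
  · have := mul_nonneg h0 (roundPotential_nonneg (q := q) (Nat.succ_le_of_lt h2))
    positivity
  · have := mul_nonneg h0 (roundPotential_nonneg (q := q) (Nat.zero_le (σ.1 + 1)))
    positivity

lemma roundPotential_step {q J j : ℕ} (h : j ≤ J) :
    2 * 3 ^ j + failBound q j * (2 * 3 ^ j + failBound q j *
      (if j < J then roundPotential q J (j + 1) else roundPotential q (J + 1) 0))
      ≤ roundPotential q J j := by
  have h2 : (0 : ℝ) < 3 ^ j := by positivity
  rcases h.eq_or_lt with rfl | hjJ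
  · rw [if_neg (lt_irrefl j)]
    rcases lt_trichotomy j q with hq | rfl | hq
    · rcases (Nat.succ_le_of_lt hq).eq_or_lt with rfl | hq'
      · simp [roundPotential, failBound, pow_succ]
        linarith
      · have hq'' : j + 1 < q := hq'
        simp [roundPotential, failBound, pow_succ, hq.ne, hq, hq'']
        linarith
    · simp [roundPotential, failBound, pow_succ]
      linarith
    · have h3 : ¬ j < q := by omega
      have h4 : ¬ j ≤ q := by omega
      have h5 : ¬ j + 1 < q := by omega
      simp [roundPotential, failBound, pow_succ, hq.ne', h3, h4, h5]
      linarith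
  · rw [if_pos hjJ]
    rcases lt_or_ge J q with hJ | hJ
    · have h3 : j ≠ q := by omega
      simp [roundPotential, failBound, pow_succ, hJ, h3]
      linarith
    · have h3 : ¬ J < q := by omega
      rcases lt_trichotomy j q with hq | rfl | hq
      · have h4 : j + 1 ≤ q := hq
        simp [roundPotential, failBound, pow_succ, h3, h4, hq.ne, hq.le]
        linarith
      · have := pow_three_le hjJ.le
        simp [roundPotential, failBound, pow_succ, h3]
        linarith
      · have h4 : ¬ j + 1 ≤ q := by omega
        have h5 : ¬ j ≤ q := by omega
        simp [roundPotential, failBound, pow_succ, h3, h4, h5, hq.ne']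
        linarith

lemma potential_step {q : ℕ} {σ : ℕ × ℕ × ℕ} (h : IsTrial σ) :
    2 * 3 ^ σ.2.1 + failBound q σ.2.1 * potential q (nextTrial σ) ≤ potential q σ := by
  obtain ⟨J, j, e⟩ := σ
  by_cases he : e = 0
  · subst he
    simpa [nextTrial, potential] using roundPotential_step (q := q) h.1
  · by_cases hj : j < J <;> simp [nextTrial, potential, he, hj]

lemma potential_zero_le (q : ℕ) : potential q (0, 0, 0) ≤ 33 * 3 ^ q := by
  have : (1 : ℝ) ≤ 3 ^ q := one_le_pow₀ (by norm_num)
  simp only [potential, roundPotential]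
  simp only [if_true]
  split_ifs <;> simp <;> linarith

/-- Some level of size `O (1 / sin θ)` has success probability at least `1 / 2`. -/
lemma exists_good_level {θ : ℝ} (h0 : 0 < θ) (h1 : θ ≤ Real.pi / 2) :
    ∃ q : ℕ, Real.cos (3 ^ q * θ) ^ 2 ≤ 1 / 2 ∧ 3 ^ q * Real.sin θ ≤ 3 := by
  have hex : ∃ q : ℕ, Real.pi / 4 ≤ 3 ^ q * θ := by
    obtain ⟨q, hq⟩ := pow_unbounded_of_one_lt (Real.pi / 4 / θ) (by norm_num : (1 : ℝ) < 3)
    exact ⟨q, by rw [div_lt_iff₀ h0] at hq; exact hq.le⟩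
  have hpi := Real.pi_lt_four
  have hsin := Real.sin_le h0.le
  classical
  refine ⟨Nat.find hex, ?_, ?_⟩
  · have h2 := Nat.find_spec hex
    have h3 : 3 ^ Nat.find hex * θ ≤ 3 * (Real.pi / 4) := by
      rcases Nat.eq_zero_or_pos (Nat.find hex) with h | h
      · rw [h]
        linarith [Real.pi_pos]
      · have := Nat.find_min hex (Nat.sub_lt h one_pos)
        obtain ⟨k, hk⟩ : ∃ k, Nat.find hex = k + 1 := ⟨_, (Nat.succ_pred_eq_of_pos h).symm⟩
        rw [hk] at this ⊢
        rw [Nat.add_sub_cancel, not_le] at this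
        rw [pow_succ]
        linarith
    rw [Real.cos_sq]
    have := Real.cos_nonpos_of_pi_div_two_le_of_le (x := 2 * (3 ^ Nat.find hex * θ))
      (by linarith) (by linarith)
    linarith
  · rcases Nat.eq_zero_or_pos (Nat.find hex) with h | h
    · rw [h]
      linarith [Real.sin_le_one θ]
    · have := Nat.find_min hex (Nat.sub_lt h one_pos)
      obtain ⟨k, hk⟩ : ∃ k, Nat.find hex = k + 1 := ⟨_, (Nat.succ_pred_eq_of_pos h).symm⟩
      rw [hk] at this ⊢
      rw [Nat.add_sub_cancel, not_le] at this
      have h4 : (3 : ℝ) ^ (k + 1) * Real.sin θ ≤ 3 ^ (k + 1) * θ := by gcongr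
      rw [pow_succ] at h4 ⊢
      linarith

/-! ### The algorithm -/

/-- Pass on to the next trial of the search. -/
def advanceProg : Prog :=
  .ite 6 (.seq (.const 6 0) (.seq (.sub 13 5 4) (.ite 13
      (.seq (.add 13 4 4) (.seq (.add 13 13 4) (.add 4 13 1)))
      (.seq (.const 4 0) (.seq (.add 13 5 5) (.seq (.add 13 13 5) (.add 5 13 1)))))))
    (.const 6 1)

/-- The classical part of a trial, after the measurement of the success flag. -/
def classicalPart : Prog := .seq (.seq resetFlag collect) (.ite 11 eliminateProg advanceProg)

/-- A trial: if it succeeds, row `k` is eliminated. -/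
def trial : Prog := .seq trialUnitary (.seq (.measure 11 7) classicalPart)

/-- The main loop. -/
def mainLoop : Prog := .while 2 trial

/-- Initialisation: row `0` is `(0, 1)`, and row `j + 1` is the unit vector at `j`. -/
def initProg : Prog :=
  .seq (.seq (.const 1 1) (.seq (.add 7 0 1) (.seq (.add 2 0 9) (.seq (.store 0 1)
    (.seq (.add 13 7 9) (.add 14 7 1)))))) (.seq
    (countdown 12 0 (.seq (.add 3 3 7) (.seq (.store 13 1) (.add 13 13 14))))
    (.add 8 3 7))

/-- The algorithm. -/
def algorithm : Prog := .seq initProg mainLoop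

/-- The invariant of the main loop. -/
structure Head {n : ℕ} (s : Cube n) (k : ℕ) (R : ℕ → ℕ → ZMod 2) (σ : ℕ × ℕ × ℕ)
    (r m : ℕ → ℕ) (ψ : QState) : Prop where
  regs : SearchRegs n k (level σ.2.1) (level σ.1) σ.2.2 r
  isTrial : IsTrial σ
  mem : ∀ j ≤ k, HasRow n m (j * (n + 1)) (R j)
  rows : Rows s k R
  le : k ≤ n
  state : ∃ a : ℂ, ψ = a • ket fun _ => 0

section Main

variable {n : ℕ} {f g : BoolFun n} {s : Cube n} {k : ℕ} {R : ℕ → ℕ → ZMod 2} {σ : ℕ × ℕ × ℕ}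
  {r₀ m₀ : ℕ → ℕ} {ψ₀ : QState}

lemma triple_advanceProg (hσ : IsTrial σ) :
    Triple f g (fun r m ψ => SearchRegs n k (level σ.2.1) (level σ.1) σ.2.2 r ∧ m = m₀ ∧ ψ = ψ₀)
      advanceProg 13 0
      (fun r m ψ => SearchRegs n k (level (nextTrial σ).2.1) (level (nextTrial σ).1)
        (nextTrial σ).2.2 r ∧ m = m₀ ∧ ψ = ψ₀) := by
  refine triple_of_wp ?_ (le_of_eq rfl)
  rintro r m ψ ⟨⟨⟨h0, h1, h7, h8, h9⟩, h2, h3, h4, h5, h6⟩, rfl, rfl⟩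
  obtain ⟨J, j, e⟩ := σ
  have hj : j ≤ J := hσ.1
  have he : e ≤ 1 := hσ.2
  simp only at h4 h5 h6
  have key : ∀ ρ B E, ∀ r' : ℕ → ℕ, (∀ a < 10, a ≠ 4 → a ≠ 5 → a ≠ 6 → r' a = r a) →
      r' 4 = ρ → r' 5 = B → r' 6 = E → SearchRegs n k ρ B E r' := by
    intro ρ B E r' hr e4 e5 e6
    exact ⟨⟨(hr 0 (by omega) (by omega) (by omega) (by omega)).trans h0,
      (hr 1 (by omega) (by omega) (by omega) (by omega)).trans h1,
      (hr 7 (by omega) (by omega) (by omega) (by omega)).trans h7,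
      (hr 8 (by omega) (by omega) (by omega) (by omega)).trans h8,
      (hr 9 (by omega) (by omega) (by omega) (by omega)).trans h9⟩,
      (hr 2 (by omega) (by omega) (by omega) (by omega)).trans h2,
      (hr 3 (by omega) (by omega) (by omega) (by omega)).trans h3, e4, e5, e6⟩
  refine ⟨fun h => ⟨fun h' => ⟨key _ _ _ _ ?_ ?_ ?_ ?_, rfl, rfl⟩,
    fun h' => ⟨key _ _ _ _ ?_ ?_ ?_ ?_, rfl, rfl⟩⟩, fun h => ⟨key _ _ _ _ ?_ ?_ ?_ ?_, rfl, rfl⟩⟩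
  any_goals
    intro a ha h4' h5' h6'
    have h13 : a ≠ 13 := by omega
    simp [h4', h5', h6', h13]
  all_goals rw [h6] at h
  · have hlt : j < J := by
      by_contra hc
      have : level J ≤ level j := level_strictMono.monotone (not_lt.1 hc)
      simp [h4, h5, this] at h'
    simp [nextTrial, h, hlt, level, h1, h4]
    ring
  · have hlt : j < J := by
      by_contra hc
      have : level J ≤ level j := level_strictMono.monotone (not_lt.1 hc)
      simp [h4, h5, this] at h'
    simp [nextTrial, h, hlt, h5]
  · have hlt : j < J := by
      by_contra hc
      have : level J ≤ level j := level_strictMono.monotone (not_lt.1 hc)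
      simp [h4, h5, this] at h'
    simp [nextTrial, h, hlt]
  · have hlt : ¬ j < J := by
      intro hc
      have : level j < level J := level_strictMono hc
      simp [h4, h5] at h'
      omega
    simp [nextTrial, h, hlt, level]
  · have hlt : ¬ j < J := by
      intro hc
      have : level j < level J := level_strictMono hc
      simp [h4, h5] at h'
      omega
    simp [nextTrial, h, hlt, level, h1, h5]
    ring
  · have hlt : ¬ j < J := by
      intro hc
      have : level j < level J := level_strictMono hc
      simp [h4, h5] at h'
      omega
    simp [nextTrial, h, hlt]
  · simp [nextTrial, h, h4]
  · simp [nextTrial, h, h5]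
  · simp [nextTrial, h]

/-- The vector of the first `n` coordinates of a row. -/
def rowVec (n : ℕ) (V : ℕ → ZMod 2) : Cube n := fun i => V i

/-- The state of the machine just before the measurement of the success flag. -/
def atMeasure (f g : BoolFun n) (r₀ m₀ : ℕ → ℕ) (V : ℕ → ZMod 2) (ρ : ℕ) (a : ℂ) (c : Config) :
    Prop :=
  c.stack = [.seq (.measure 11 7) classicalPart, mainLoop] ∧ SameBelow 10 c.reg r₀ ∧ c.mem = m₀ ∧
    c.state = a • emb (fun z => dot (rowVec n V) z.1)
      ((ampStep f g (rowVec n V))^[ρ] (sample f g))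

lemma runs_atMeasure (h : Head s k R σ r₀ m₀ ψ₀) {a : ℂ} (ha : ψ₀ = a • ket fun _ => 0) :
    Runs f g (atMeasure f g r₀ m₀ (R k) (level σ.2.1) a)
      ((level σ.2.1 + 1) * (47 * n + 74) + 1) (2 * 3 ^ σ.2.1) ⟨[trial, mainLoop], r₀, m₀, ψ₀⟩ := by
  refine runs_step (by simp [trial]) (by simp [trial]) fun c' hc' => ?_
  obtain rfl : c' = _ := by simpa [step, trial] using hc'
  have hV : HasRow n m₀ (r₀ 3) (R k) := by
    rw [h.regs.r3]
    exact h.mem k le_rfl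
  have := triple_trialUnitary (f := f) (g := g) h.regs.toLayout hV a
    [.seq (.measure 11 7) classicalPart, mainLoop] r₀ m₀ ψ₀ ⟨fun _ _ => rfl, rfl, ha⟩
  rw [h.regs.r4, two_mul_level_add_one] at this
  exact this

lemma Rows.rowVec_ne_zero (hR : Rows s (k + 1) R) (hk : k < n) : rowVec n (R (k + 1)) ≠ 0 := by
  intro h
  have h1 := congrFun h ⟨k, hk⟩
  rw [rowVec, hR.lead k (by omega)] at h1
  exact one_ne_zero h1

/-- The classical part of a failed trial. -/
lemma triple_classicalPart_zero (h : Head s k R σ r₀ m₀ ψ₀) (v : Cube n) (hk : k ≤ n) :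
    Triple f g (fun r m ψ => SameBelow 10 r r₀ ∧ r 11 = 0 ∧ m = m₀ ∧
        ∀ x, ψ x ≠ 0 → ∃ w : Cube n, x = lab w (dot w s) 0 ∧ dot v w = 0)
      classicalPart (11 * n + 32) 0 (Head s k R (nextTrial σ)) := by
  rintro K r m ψ ⟨hr, h11, rfl, hψ⟩
  have hregs := h.regs.of_sameBelow (by omega) hr
  have t1 := triple_readout (f := f) (g := g) (r₀ := r) (m₀ := m) hregs.toLayout s v (b := 0)
    (by simpa using h11)
  have t2 : Triple f g (fun r' m' ψ' => SameBelow 12 r' r ∧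
      (∀ a < (n + 1) * (n + 1), m' a = m a) ∧ (∃ a : ℂ, ψ' = a • ket fun _ => 0) ∧
      (ψ' ≠ 0 → ∃ w : Cube n, dot v w = 0 ∧
          (∀ i : Fin n, m' ((n + 1) * (n + 1) + i) = (w i).val) ∧
          m' ((n + 1) * (n + 1) + n) = (dot w s).val))
      (.ite 11 eliminateProg advanceProg) 14 0 (Head s k R (nextTrial σ)) := by
    refine Triple.ite (τ := 1) (τ' := 13) (fun K r' m' ψ' h' => ?_) fun K r' m' ψ' h' => ?_
    · exact absurd ((h'.1.1 11 (by omega)).trans h11) h'.2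
    · obtain ⟨⟨hr', hm', ha, -⟩, -⟩ := h'
      refine ((triple_advanceProg (f := f) (g := g) (n := n) (k := k) h.isTrial) K r' m' ψ'
        ⟨hregs.of_sameBelow (by omega) hr', rfl, rfl⟩).mono ?_
      rintro c ⟨hK, hc, hm, hψ'⟩
      refine ⟨hK, hc, h.isTrial.next, fun j hj l hl => ?_, h.rows, h.le, by rw [hψ']; exact ha⟩
      rw [hm, hm' _ (row_lt (by omega) hl), h.mem j hj l hl]
  exact (t1.seq t2).conseq (fun _ _ _ h => h) (fun _ _ _ h => h) (by omega) K r m ψ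
    ⟨fun _ _ => rfl, rfl, hψ⟩

/-- The classical part of a successful trial. -/
lemma triple_classicalPart_one (h : Head s (k + 1) R σ r₀ m₀ ψ₀) :
    Triple f g (fun r m ψ => SameBelow 10 r r₀ ∧ r 11 = 1 ∧ m = m₀ ∧
        ∀ x, ψ x ≠ 0 → ∃ w : Cube n, x = lab w (dot w s) 1 ∧ dot (rowVec n (R (k + 1))) w = 1)
      classicalPart ((n + 1) * (29 * n + 46) + 11 * n + 40) 0
      (fun r m ψ => ∃ R', Head s k R' (0, 0, 0) r m ψ) := by
  rintro K r m ψ ⟨hr, h11, rfl, hψ⟩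
  have hregs := h.regs.of_sameBelow (by omega) hr
  have hkn := h.le
  have t1 := triple_readout (f := f) (g := g) (r₀ := r) (m₀ := m) hregs.toLayout s
    (rowVec n (R (k + 1))) (b := 1) (by simpa [ZMod.val_one] using h11)
  have t2 : Triple f g (fun r' m' ψ' => SameBelow 12 r' r ∧
      (∀ a < (n + 1) * (n + 1), m' a = m a) ∧ (∃ a : ℂ, ψ' = a • ket fun _ => 0) ∧
      (ψ' ≠ 0 → ∃ w : Cube n, dot (rowVec n (R (k + 1))) w = 1 ∧
          (∀ i : Fin n, m' ((n + 1) * (n + 1) + i) = (w i).val) ∧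
          m' ((n + 1) * (n + 1) + n) = (dot w s).val))
      (.ite 11 eliminateProg advanceProg) ((n + 1) * (29 * n + 46) + 16) 0
      (fun r m ψ => ∃ R', Head s k R' (0, 0, 0) r m ψ) := by
    refine Triple.of_ne_zero ((Triple.ite (τ := (n + 1) * (29 * n + 46) + 15) (τ' := 1)
      (fun K r' m' ψ' h' => ?_) fun K r' m' ψ' h' => ?_).conseq (fun _ _ _ h => h)
      (fun _ _ _ h => h) (by omega))
    · obtain ⟨⟨hne, hr', hm', ha, hw⟩, -⟩ := h'
      obtain ⟨w, hvw, hw, hws⟩ := hw hne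
      set w' : ℕ → ZMod 2 := fun l => if h : l < n then w ⟨l, h⟩ else dot w s with hw'
      have hw'i : ∀ i : Fin n, w' i = w i := fun i => by simp [hw']
      have hw'n : w' n = dot w s := by simp [hw']
      refine ((triple_eliminateProg (f := f) (g := g) (ψ₀ := ψ') (R := R) (w := w') hkn) K r' m' ψ'
        ⟨hregs.of_sameBelow (by omega) hr', rfl, fun j hj l hl => ?_, fun l hl => ?_⟩).mono ?_
      · rw [hm' _ (row_lt (by omega) hl), h.mem j hj l hl]
      · rcases hl.eq_or_lt with rfl | hl
        · rw [hws, hw'n]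
        · simpa [hw', hl] using hw ⟨l, hl⟩
      · rintro c ⟨hK, hc, hψ', hm⟩
        refine ⟨hK, _, hc, ⟨le_rfl, Nat.zero_le _⟩, hm, h.rows.eliminate ?_ ?_, by omega,
          by rw [hψ']; exact ha⟩
        · rw [hw'n, dot]
          simp only [hw'i]
        · simp only [hw'i]
          exact hvw
    · exact absurd ((h'.1.2.1 11 (by omega)).trans h11) (by rw [h'.2]; simp)
  exact (t1.seq t2).conseq (fun _ _ _ h => h) (fun _ _ _ h => h) (by omega) K r m ψ
    ⟨fun _ _ => rfl, rfl, hψ⟩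

/-- The configuration is at the head of the main loop, with `k` rows left. -/
def AtHead (s : Cube n) (k : ℕ) (R : ℕ → ℕ → ZMod 2) (σ : ℕ × ℕ × ℕ) (c : Config) : Prop :=
  c.stack = [mainLoop] ∧ Head s k R σ c.reg c.mem c.state

/-- The two outcomes of the measurement of the success flag. -/
lemma runs_branches (hg : ∀ x, g x = f (x + s)) (h : Head s (k + 1) R σ r₀ m₀ ψ₀) {a : ℂ}
    {c : Config} (hc : atMeasure f g r₀ m₀ (R (k + 1)) (level σ.2.1) a c) :
    ∃ c₀ c₁ : Config,
      step f g ⟨.measure 11 7 :: [classicalPart, mainLoop], c.reg, c.mem, c.state⟩ = [c₀, c₁] ∧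
      Runs f g (AtHead s (k + 1) R (nextTrial σ)) (11 * n + 32) 0 c₀ ∧
      Runs f g (fun c => ∃ R', AtHead s k R' (0, 0, 0) c)
        ((n + 1) * (29 * n + 46) + 11 * n + 40) 0 c₁ ∧
      normSq c₀.state = ENNReal.ofReal (‖a‖ ^ 2 *
        Real.cos (3 ^ σ.2.1 * angle f g (rowVec n (R (k + 1)))) ^ 2) ∧
      normSq c₁.state = ENNReal.ofReal (‖a‖ ^ 2 *
        Real.sin (3 ^ σ.2.1 * angle f g (rowVec n (R (k + 1)))) ^ 2) := by
  obtain ⟨S, r, m, ψ⟩ := c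
  obtain ⟨-, hr, hm, hψ⟩ := hc
  simp only at hr hm hψ
  subst hm hψ
  have h7 : r 7 = n + 1 := (hr 7 (by omega)).trans h.regs.r7
  have hlev : (2 * (level σ.2.1 : ℝ) + 1) = 3 ^ σ.2.1 := by
    exact_mod_cast two_mul_level_add_one σ.2.1
  refine ⟨_, _, rfl, ?_, ?_, ?_, ?_⟩
  · refine (triple_classicalPart_zero h (rowVec n (R (k + 1))) h.le [mainLoop] _ _ _
      ⟨(sameBelow_update_iff (by omega)).2 hr, by simp, rfl, ?_⟩)
    intro x hx
    simp only [h7] at hx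
    exact exists_of_mem_support_project hg hx
  · refine (triple_classicalPart_one h [mainLoop] _ _ _
      ⟨(sameBelow_update_iff (by omega)).2 hr, by simp, rfl, ?_⟩).mono ?_
    · intro x hx
      simp only [h7] at hx
      exact exists_of_mem_support_project hg hx
    · rintro c ⟨hK, R', hc⟩
      exact ⟨R', hK, hc⟩
  · simp only [h7]
    rw [normSq_project_trial, if_pos rfl, hlev]
  · simp only [h7]
    rw [normSq_project_trial, if_neg one_ne_zero, hlev]

/-- A trial as a whole. -/
lemma runs_trial (hg : ∀ x, g x = f (x + s)) (h : Head s (k + 1) R σ r₀ m₀ ψ₀) :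
    Runs f g (fun c => ∃ k' R' σ', k ≤ k' ∧ AtHead s k' R' σ' c)
      ((level σ.2.1 + 1) * (47 * n + 74) + (n + 1) * (29 * n + 46) + 11 * n + 50) (2 * 3 ^ σ.2.1)
      ⟨[trial, mainLoop], r₀, m₀, ψ₀⟩ := by
  obtain ⟨a, ha⟩ := h.state
  refine ((runs_atMeasure h ha).bind (κ' := 0)
    (τ' := (n + 1) * (29 * n + 46) + 11 * n + 42) fun c hc => ?_).weaken (by omega)
  obtain ⟨c₀, c₁, hstep, h0, h1, -, -⟩ := runs_branches hg h hc
  obtain ⟨S, r, m, ψ⟩ := c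
  obtain rfl : S = _ := hc.1
  refine runs_step (by simp) (by simp) fun c' hc' => ?_
  obtain rfl : c' = _ := by simpa [step] using hc'
  refine runs_step (by simp) (by simp) fun c' hc' => ?_
  rw [hstep] at hc'
  obtain rfl | rfl : c' = c₀ ∨ c' = c₁ := by simpa using hc'
  · exact (h0.mono fun c hc => ⟨_, _, _, Nat.le_succ k, hc⟩).weaken (by omega)
  · exact (h1.mono fun c ⟨R', hc⟩ => ⟨_, _, _, le_rfl, hc⟩).weaken (by omega)

/-- The rows at the beginning. -/
def initRows (n : ℕ) : ℕ → ℕ → ZMod 2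
  | 0, l => if l = n then 1 else 0
  | j + 1, l => if l = j then 1 else 0

lemma rows_initRows (s : Cube n) : Rows s n (initRows n) := by
  refine ⟨fun j _ => by simp [initRows], fun j _ i hi => ?_, fun j hj => ?_, by simp [initRows],
    fun l => if h : l < n then s ⟨l, h⟩ else 0, fun i => ?_⟩
  · simp [initRows, hi.ne]
  · simp [initRows, hj.ne']
  · have hi := i.2.ne
    simp [initRows, hi]

/-- The addresses at which the memory holds a one after `d` steps of the initialisation. -/
def IsOneAddr (n d a : ℕ) : Prop := a = n ∨ ∃ j < d, a = (j + 1) * (n + 1) + j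

lemma isOneAddr_iff {j l : ℕ} (hj : j ≤ n) (hl : l ≤ n) :
    IsOneAddr n n (j * (n + 1) + l) ↔ initRows n j l = 1 := by
  have huniq : ∀ {j' l'}, l' ≤ n → j * (n + 1) + l = j' * (n + 1) + l' → j = j' ∧ l = l' := by
    intro j' l' hl' h
    rcases lt_trichotomy j j' with h' | rfl | h'
    · have := row_lt h' hl
      omega
    · exact ⟨rfl, by omega⟩
    · have := row_lt h' hl'
      omega
  constructor
  · rintro (h | ⟨d, hd, h⟩)
    · obtain ⟨rfl, rfl⟩ := huniq (j' := 0) le_rfl (by simpa using h)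
      simp [initRows]
    · obtain ⟨rfl, rfl⟩ := huniq hd.le h
      simp [initRows]
  · intro h
    rcases j with _ | j
    · left
      by_contra h'
      simp only [zero_mul, zero_add] at h'
      simp [initRows, h'] at h
    · right
      have : l = j := by
        by_contra h'
        simp [initRows, h'] at h
      exact ⟨j, by omega, by rw [this]⟩

open Classical in
/-- The program is at the head of the loop after initialisation. -/
lemma triple_initProg (s : Cube n) :
    Triple f g (fun r m ψ => r = Function.update (fun _ => 0) 0 n ∧ m = (fun _ => 0) ∧
        ψ = ket fun _ => 0)
      initProg (8 * n + 17) 0 (fun r m ψ => Head s n (initRows n) (0, 0, 0) r m ψ) := by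
  set I : ℕ → Assn := fun i r m ψ => ψ = (ket fun _ => 0) ∧ r 0 = n ∧ r 1 = 1 ∧ r 2 = n ∧
    r 4 = 0 ∧ r 5 = 0 ∧ r 6 = 0 ∧ r 7 = n + 1 ∧ r 9 = 0 ∧ r 14 = n + 2 ∧
    ∃ d, i + d = n ∧ r 3 = d * (n + 1) ∧ r 13 = (d + 1) * (n + 1) + d ∧
      ∀ a, m a = if IsOneAddr n d a then 1 else 0 with hI
  have h1 : Triple f g (fun r m ψ => r = Function.update (fun _ => 0) 0 n ∧ m = (fun _ => 0) ∧
        ψ = ket fun _ => 0) (.seq (.const 1 1) (.seq (.add 7 0 1) (.seq (.add 2 0 9)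
        (.seq (.store 0 1) (.seq (.add 13 7 9) (.add 14 7 1)))))) 11 0 (I n) := by
    refine triple_of_wp ?_ (le_of_eq rfl)
    rintro r m ψ ⟨rfl, rfl, rfl⟩
    simp [wp, hI, IsOneAddr, Function.update_apply]
  have h2 : Triple f g (I n) (countdown 12 0 (.seq (.add 3 3 7) (.seq (.store 13 1)
      (.add 13 13 14)))) (n * (5 + 3) + 3) (n * 0) (I 0) := by
    refine triple_countdown ?_ ?_ ?_ ?_
    · rintro r m ψ ⟨-, h0, -, -, -, -, -, -, h9, -⟩
      exact ⟨h0, h9⟩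
    · rintro i r m ψ ⟨-, -, h1, -⟩
      exact h1
    · rintro i r m ψ x h
      simpa [hI] using h
    · refine fun i hi => triple_of_wp ?_ (le_of_eq rfl)
      rintro r m ψ ⟨⟨hψ, h0, h1, h2, h4, h5, h6, h7, h9, h14, d, hd, h3, h13, hm⟩, h12⟩
      simp only [wp, hI, Function.update_self, Function.update_of_ne, ne_eq, hψ, h0, h1, h2, h3,
        h4, h5, h6, h7, h9, h12, h13, h14, true_and, and_true,
        OfNat.zero_ne_ofNat, OfNat.one_ne_ofNat, Nat.reduceEqDiff, not_false_eq_true]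
      refine ⟨d + 1, by omega, by ring, by ring, fun a => ?_⟩
      by_cases ha : a = (d + 1) * (n + 1) + d
      · have : IsOneAddr n (d + 1) a := Or.inr ⟨d, by omega, ha⟩
        rw [if_pos this, ha, Function.update_self]
      · rw [Function.update_of_ne ha, hm]
        refine if_congr ?_ rfl rfl
        unfold IsOneAddr
        refine or_congr Iff.rfl ⟨fun ⟨j, hj, h⟩ => ⟨j, by omega, h⟩, fun ⟨j, hj, h⟩ => ?_⟩
        rcases (Nat.lt_succ_iff.1 hj).eq_or_lt with rfl | hj
        · exact absurd h ha
        · exact ⟨j, hj, h⟩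
  have h3 : Triple f g (I 0) (.add 8 3 7) 1 0 (Head s n (initRows n) (0, 0, 0)) := by
    refine triple_of_wp ?_ (le_of_eq rfl)
    rintro r m ψ ⟨hψ, h0, hone, h2, h4, h5, h6, h7, h9, -, d, hd, h3, -, hm⟩
    obtain rfl : d = n := by omega
    refine ⟨⟨⟨?_, ?_, ?_, ?_, ?_⟩, ?_, ?_, ?_, ?_, ?_⟩, ⟨le_rfl, Nat.zero_le _⟩, ?_,
      rows_initRows s, le_rfl, 1, by simpa using hψ⟩
    · simp [h0]
    · simp [hone]
    · simp [h7]
    · simp [h3, h7]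
      ring
    · simp [h9]
    · simp [h2]
    · simp [h3]
    · simp [h4, level]
    · simp [h5, level]
    · simp [h6]
    · intro j hj l hl
      rw [hm, if_congr (isOneAddr_iff hj hl) rfl rfl]
      rcases zmod_two_cases (initRows d j l) with h | h <;> simp [h, ZMod.val_one]
  exact (h1.seq (h2.seq h3)).conseq (fun _ _ _ h => h) (fun _ _ _ h => h) (by omega)

end Main

/-! ### Analysis of the main loop -/

section Analysis

variable {n : ℕ} {f g : BoolFun n} {s : Cube n} {k : ℕ} {R : ℕ → ℕ → ZMod 2} {σ : ℕ × ℕ × ℕ}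
  {c : Config} {E : Config → Prop} {T : ℕ}

lemma partialCost_of_halted (h : c.Halted) (hE : ¬ E c) : partialCost f g E T c = 0 := by
  have hstep : step f g c = [c] := by
    obtain ⟨S, r, m, ψ⟩ := c
    obtain rfl : S = [] := h
    rfl
  have hmass : ∀ t, mass f g E t c = 0 := by
    intro t
    induction t with
    | zero => simp [mass_zero, hE]
    | succ t ih => simpa [mass_succ, hstep] using ih
  exact Finset.sum_eq_zero fun t _ => hmass t

lemma AtHead.not_halted (h : AtHead s k R σ c) : ¬ c.Halted := by
  simp [Config.Halted, h.1]

lemma AtHead.not_atQuery (h : AtHead s k R σ c) : ¬ c.AtQuery := by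
  rintro ⟨a, b, K, h' | h'⟩ <;> simp [h.1, mainLoop] at h'

lemma AtHead.step_zero (h : AtHead s 0 R σ c) :
    step f g c = [⟨[], c.reg, c.mem, c.state⟩] := by
  obtain ⟨S, r, m, ψ⟩ := c
  obtain ⟨hS, h⟩ := h
  obtain rfl : S = _ := hS
  have h2 := h.regs.r2
  simp only at h2
  simp [mainLoop, step, h2]

lemma AtHead.step_succ (h : AtHead s (k + 1) R σ c) :
    step f g c = [⟨[trial, mainLoop], c.reg, c.mem, c.state⟩] := by
  obtain ⟨S, r, m, ψ⟩ := c
  obtain ⟨hS, h⟩ := h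
  obtain rfl : S = _ := hS
  have h2 := h.regs.r2
  simp only at h2
  simp [mainLoop, step, h2]

/-- When the loop ends, the memory holds the hidden shift. -/
lemma AtHead.output (h : AtHead s 0 R σ c) : c.Output s := by
  intro i
  obtain ⟨a, ha⟩ := h.2.rows.span
  have h1 := h.2.mem 0 le_rfl i i.2.le
  rw [zero_mul, zero_add] at h1
  rw [h1, ha i]
  simp

/-- The program does not halt with a wrong output. -/
lemma AtHead.wrong_eq_zero (hg : ∀ x, g x = f (x + s)) (h : AtHead s k R σ c) (T : ℕ) :
    partialCost f g (fun c => c.Halted ∧ ¬ c.Output s) T c = 0 := by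
  induction T generalizing k R σ c with
  | zero => simp [partialCost]
  | succ T ih =>
    rw [partialCost_succ, mass_zero, if_neg (fun h' => h.not_halted h'.1), zero_add]
    rcases k with _ | k
    · rw [h.step_zero]
      have ho : (⟨[], c.reg, c.mem, c.state⟩ : Config).Output s := h.output
      have hh : (⟨[], c.reg, c.mem, c.state⟩ : Config).Halted := rfl
      simpa using partialCost_of_halted hh fun h' => h'.2 ho
    · rw [h.step_succ]
      simpa using (runs_trial hg h.2).halted_eq_zero fun c ⟨k', R', σ', _, hc⟩ => ih hc

/-- Every row costs at least one query. -/
lemma AtHead.le_queries (hg : ∀ x, g x = f (x + s)) {l : ℕ} (hl : l ≤ k)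
    (h : AtHead s k R σ c) : l * normSq c.state ≤ totalCost f g Config.AtQuery c := by
  induction l generalizing k R σ c with
  | zero => simp
  | succ l ih =>
    obtain ⟨k, rfl⟩ : ∃ k', k = k' + 1 := ⟨k - 1, by omega⟩
    rw [totalCost_eq, h.step_succ]
    have := (runs_trial hg h.2).le_totalCost (Φ := l) fun c ⟨k', R', σ', hk', hc⟩ =>
      ih (by omega) hc
    refine le_trans ?_ (le_trans this (by simp))
    have h1 : 1 ≤ 2 * 3 ^ σ.2.1 := Nat.one_le_iff_ne_zero.2 (by positivity)
    have h2 : (1 : ℝ≥0∞) ≤ ((2 * 3 ^ σ.2.1 : ℕ) : ℝ≥0∞) := by exact_mod_cast h1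
    have h3 : ((l + 1 : ℕ) : ℝ≥0∞) ≤ ((2 * 3 ^ σ.2.1 : ℕ) : ℝ≥0∞) + l := by
      push_cast at h2 ⊢
      rw [add_comm]
      exact add_le_add_left h2 _
    gcongr

/-- A bound for the number of steps per query, including the steps of the elimination. -/
def stepsPerQuery (n : ℕ) : ℕ := 29 * n ^ 2 + 133 * n + 171

/-- The expected time from the head of the loop on: as each trial makes queries, its time can be
charged to them.  The last summand is for the step that leaves the loop. -/
lemma AtHead.time_le (hg : ∀ x, g x = f (x + s)) (h : AtHead s k R σ c) (T : ℕ) :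
    partialCost f g (fun c => ¬ c.Halted) T c
      ≤ stepsPerQuery n * totalCost f g Config.AtQuery c + normSq c.state := by
  induction T generalizing k R σ c with
  | zero => simp [partialCost]
  | succ T ih =>
    rw [partialCost_succ]
    rcases k with _ | k
    · rw [h.step_zero]
      have : partialCost f g (fun c => ¬ c.Halted) T ⟨[], c.reg, c.mem, c.state⟩ = 0 :=
        partialCost_of_halted rfl (by simp [Config.Halted])
      simp only [List.map_cons, List.map_nil, List.sum_cons, List.sum_nil, this, add_zero]
      exact (mass_le 0 c).trans le_add_self
    · rw [totalCost_eq, h.step_succ]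
      have h1 := (runs_trial hg h.2).time_le (T := T) (A := stepsPerQuery n)
        fun c ⟨k', R', σ', _, hc⟩ => ih hc
      simp only [List.map_cons, List.map_nil, List.sum_cons, List.sum_nil, add_zero]
      set τ := (level σ.2.1 + 1) * (47 * n + 74) + (n + 1) * (29 * n + 46) + 11 * n + 50 with hτ
      set V := partialCost f g (fun c => ¬ c.Halted) T ⟨[trial, mainLoop], c.reg, c.mem, c.state⟩
      set W := totalCost f g Config.AtQuery ⟨[trial, mainLoop], c.reg, c.mem, c.state⟩
      have h2 : τ + 1 ≤ stepsPerQuery n * (2 * 3 ^ σ.2.1) := by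
        rw [← two_mul_level_add_one, stepsPerQuery, hτ]
        nlinarith [Nat.zero_le (level σ.2.1 * n), Nat.zero_le (level σ.2.1 * n ^ 2)]
      have h3 : ((τ + 1 : ℕ) : ℝ≥0∞) * normSq c.state
          ≤ stepsPerQuery n * ((2 * 3 ^ σ.2.1 : ℕ) : ℝ≥0∞) * normSq c.state := by
        gcongr
        exact_mod_cast h2
      have h4 : stepsPerQuery n * ((2 * 3 ^ σ.2.1 : ℕ) : ℝ≥0∞) * normSq c.state ≠ ⊤ :=
        ENNReal.mul_ne_top (ENNReal.mul_ne_top (ENNReal.natCast_ne_top _)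
          (ENNReal.natCast_ne_top _)) (normSq_ne_top _)
      have h5 : mass f g (fun c => ¬ c.Halted) 0 c + V
          ≤ stepsPerQuery n * W + normSq c.state := by
        refine (ENNReal.add_le_add_iff_right h4).1 ?_
        calc _ ≤ normSq c.state + (V
                + stepsPerQuery n * ((2 * 3 ^ σ.2.1 : ℕ) : ℝ≥0∞) * normSq c.state) := by
              rw [add_assoc]
              exact add_le_add_left (mass_le 0 c) _
          _ ≤ normSq c.state + (τ * normSq c.state
                + (stepsPerQuery n * W + normSq c.state)) := add_le_add_right h1 _
          _ = (stepsPerQuery n * W + normSq c.state)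
                + ((τ + 1 : ℕ) : ℝ≥0∞) * normSq c.state := by
              push_cast
              ring
          _ ≤ _ := add_le_add_right h3 _
      refine h5.trans ?_
      gcongr
      exact le_add_self

lemma partialCost_le_step (hc : ¬ c.AtQuery) :
    partialCost f g Config.AtQuery T c
      ≤ ((step f g c).map (partialCost f g Config.AtQuery T)).sum := by
  refine (partialCost_le_succ T c).trans ?_
  rw [partialCost_succ, mass_zero, if_neg hc, zero_add]

lemma not_atQuery_of_halted (h : c.Halted) : ¬ c.AtQuery := fun h' => h'.not_halted h

/-- The number of queries of the rest of the search, by the outcome of the measurement: in the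
first case the search goes on, in the second case it is over. -/
lemma partialCost_atMeasure_le (hg : ∀ x, g x = f (x + s)) {r₀ m₀ : ℕ → ℕ} {ψ₀ : QState}
    (h : Head s (k + 1) R σ r₀ m₀ ψ₀) {a : ℂ}
    (hc : atMeasure f g r₀ m₀ (R (k + 1)) (level σ.2.1) a c) {q : ℕ}
    (hq : Real.cos (3 ^ q * angle f g (rowVec n (R (k + 1)))) ^ 2 ≤ 1 / 2) {x y : ℝ}
    (hx : 0 ≤ x) (hy : 0 ≤ y)
    (hfail : ∀ c, AtHead s (k + 1) R (nextTrial σ) c →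
      partialCost f g Config.AtQuery T c ≤ ENNReal.ofReal (x + y) * normSq c.state)
    (hsucc : ∀ c R', AtHead s k R' (0, 0, 0) c →
      partialCost f g Config.AtQuery T c ≤ ENNReal.ofReal x * normSq c.state) :
    partialCost f g Config.AtQuery T c
      ≤ ENNReal.ofReal (x + failBound q σ.2.1 * y) * normSq c.state := by
  obtain ⟨c₀, c₁, hstep, h0, h1, hn0, hn1⟩ := runs_branches hg h hc
  obtain ⟨S, r, m, ψ⟩ := c
  obtain rfl : S = _ := hc.1
  have hnorm := sum_normSq_step f g ⟨.measure 11 7 :: [classicalPart, mainLoop], r, m, ψ⟩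
  simp only at hstep
  rw [hstep] at hnorm
  simp only [List.map_cons, List.map_nil, List.sum_cons, List.sum_nil, add_zero] at hnorm
  have hq1 : ¬ (⟨.seq (.measure 11 7) classicalPart :: [mainLoop], r, m, ψ⟩ : Config).AtQuery := by
    simp [Config.AtQuery]
  have hq2 : ¬ (⟨.measure 11 7 :: [classicalPart, mainLoop], r, m, ψ⟩ : Config).AtQuery := by
    simp [Config.AtQuery]
  refine (partialCost_le_step hq1).trans ?_
  simp only [step, List.map_cons, List.map_nil, List.sum_cons, List.sum_nil, add_zero]
  refine (partialCost_le_step hq2).trans ?_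
  rw [hstep]
  simp only [List.map_cons, List.map_nil, List.sum_cons, List.sum_nil, add_zero]
  have b0 := h0.queries_le (T := T) hfail
  have b1 := h1.queries_le (T := T) (Φ := ENNReal.ofReal x) fun c ⟨R', hc⟩ => hsucc c R' hc
  rw [Nat.cast_zero, zero_add] at b0 b1
  refine (add_le_add b0 b1).trans ?_
  rw [← hnorm, hn0, hn1]
  set θ := 3 ^ σ.2.1 * angle f g (rowVec n (R (k + 1))) with hθ
  have hcos : Real.cos θ ^ 2 ≤ failBound q σ.2.1 := by
    unfold failBound
    split_ifs with hj
    · rwa [hθ, hj]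
    · exact Real.cos_sq_le_one θ
  have hsc := Real.sin_sq_add_cos_sq θ
  have hB := failBound_nonneg q σ.2.1
  rw [← ENNReal.ofReal_mul (by positivity), ← ENNReal.ofReal_mul (by positivity),
    ← ENNReal.ofReal_add (by positivity) (by positivity),
    ← ENNReal.ofReal_add (by positivity) (by positivity),
    ← ENNReal.ofReal_mul (by positivity)]
  refine ENNReal.ofReal_le_ofReal ?_
  have : ‖a‖ ^ 2 * (y * Real.cos θ ^ 2) ≤ ‖a‖ ^ 2 * (y * failBound q σ.2.1) := by gcongr
  calc _ = ‖a‖ ^ 2 * (x * (Real.sin θ ^ 2 + Real.cos θ ^ 2)) + ‖a‖ ^ 2 * (y * Real.cos θ ^ 2) := by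
        ring
    _ ≤ ‖a‖ ^ 2 * (x * (Real.sin θ ^ 2 + Real.cos θ ^ 2))
          + ‖a‖ ^ 2 * (y * failBound q σ.2.1) := by gcongr
    _ = ‖a‖ ^ 2 * (Real.sin θ ^ 2 + Real.cos θ ^ 2) * (x + failBound q σ.2.1 * y)
          + ‖a‖ ^ 2 * (y * failBound q σ.2.1)
            * (1 - (Real.sin θ ^ 2 + Real.cos θ ^ 2)) := by ring
    _ = _ := by
        rw [hsc]
        linear_combination (-(‖a‖ ^ 2 * (x + failBound q σ.2.1 * y))) * hsc

/-- The expected number of queries of the current search is at most its potential, and each later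
search costs at most `M`. -/
lemma AtHead.queries_le_potential (hg : ∀ x, g x = f (x + s)) {M : ℝ} (hM0 : 0 ≤ M)
    (hM : ∀ v : Cube n, v ≠ 0 → ∃ q : ℕ, Real.cos (3 ^ q * angle f g v) ^ 2 ≤ 1 / 2 ∧
      33 * 3 ^ q ≤ M) (h : AtHead s (k + 1) R σ c) {q : ℕ}
    (hq : Real.cos (3 ^ q * angle f g (rowVec n (R (k + 1)))) ^ 2 ≤ 1 / 2) :
    partialCost f g Config.AtQuery T c
      ≤ ENNReal.ofReal (k * M + potential q σ) * normSq c.state := by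
  induction T generalizing k R σ c q with
  | zero => simp [partialCost]
  | succ T ih =>
    have hsucc : ∀ c R', AtHead s k R' (0, 0, 0) c →
        partialCost f g Config.AtQuery T c ≤ ENNReal.ofReal (k * M) * normSq c.state := by
      intro c R' hc
      rcases k with _ | k
      · have hh : (⟨[], c.reg, c.mem, c.state⟩ : Config).Halted := rfl
        have := partialCost_le_step (f := f) (g := g) (T := T) hc.not_atQuery
        rw [hc.step_zero] at this
        simp only [List.map_cons, List.map_nil, List.sum_cons, List.sum_nil, add_zero,
          partialCost_of_halted hh (not_atQuery_of_halted hh)] at this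
        exact this.trans zero_le
      · obtain ⟨q', hq', hqM⟩ := hM _ (hc.2.rows.rowVec_ne_zero hc.2.le)
        refine (ih hc hq').trans ?_
        gcongr
        have := potential_zero_le q'
        push_cast
        linarith
    rw [partialCost_succ, mass_zero, if_neg h.not_atQuery, zero_add, h.step_succ]
    simp only [List.map_cons, List.map_nil, List.sum_cons, List.sum_nil, add_zero]
    obtain ⟨a, ha⟩ := h.2.state
    have hpot := potential_nonneg (q := q) h.2.isTrial.next
    have hB := failBound_nonneg q σ.2.1
    refine ((runs_atMeasure h.2 ha).queries_le fun c' hc' =>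
      partialCost_atMeasure_le hg h.2 hc' hq (by positivity) hpot
        (fun c hc => ih hc hq) hsucc).trans ?_
    dsimp only
    gcongr
    have h2 : ((2 * 3 ^ σ.2.1 : ℕ) : ℝ≥0∞) = ENNReal.ofReal (2 * 3 ^ σ.2.1) := by
      rw [← ENNReal.ofReal_natCast]
      push_cast
      rfl
    rw [h2, ← ENNReal.ofReal_add (by positivity) (by positivity)]
    refine ENNReal.ofReal_le_ofReal ?_
    have := potential_step (q := q) h.2.isTrial
    linarith

/-- The expected number of queries: each search costs at most `M`, provided that each nonzero
vector has a level `q` of success probability at least `1 / 2` with `33 * 3 ^ q ≤ M`. -/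
lemma AtHead.queries_le (hg : ∀ x, g x = f (x + s)) {M : ℝ} (hM0 : 0 ≤ M)
    (hM : ∀ v : Cube n, v ≠ 0 → ∃ q : ℕ, Real.cos (3 ^ q * angle f g v) ^ 2 ≤ 1 / 2 ∧
      33 * 3 ^ q ≤ M) (h : AtHead s (k + 1) R (0, 0, 0) c) :
    partialCost f g Config.AtQuery T c
      ≤ ENNReal.ofReal ((k + 1 : ℕ) * M) * normSq c.state := by
  obtain ⟨q, hq, hqM⟩ := hM _ (h.2.rows.rowVec_ne_zero h.2.le)
  refine (h.queries_le_potential hg hM0 hM hq).trans ?_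
  gcongr
  have := potential_zero_le q
  push_cast
  linarith

/-- The program reaches the head of the main loop. -/
lemma runs_start (f g : BoolFun n) (s : Cube n) :
    Runs f g (AtHead s n (initRows n) (0, 0, 0)) (8 * n + 17 + 1) 0 (start algorithm n) := by
  refine runs_step (by simp [algorithm]) (by simp [algorithm]) fun c' hc' => ?_
  obtain rfl : c' = _ := by simpa [step, start, algorithm] using hc'
  exact triple_initProg s [mainLoop] _ _ _ ⟨rfl, rfl, rfl⟩

lemma normSq_start (P : Prog) (n : ℕ) : normSq (start P n).state = 1 := by
  simpa [start] using normSq_smul_ket 1 fun _ => 0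

end Analysis

/-! ### The minimum influence -/

section Influence

variable {n : ℕ} {f g : BoolFun n} {s : Cube n}

lemma influence_pos (hf : ∀ t : Cube n, (∀ x, f x = f (x + t)) → t = 0) {v : Cube n}
    (hv : v ≠ 0) : 0 < influence f v := by
  obtain ⟨x, hx⟩ : ∃ x, f x ≠ f (x + v) := by
    by_contra! h
    exact hv (hf v h)
  have : 0 < (Finset.univ.filter fun x : Cube n => f x ≠ f (x + v)).card :=
    Finset.card_pos.2 ⟨x, by simpa using hx⟩
  unfold influence
  positivity

lemma minInfluence_le (f : BoolFun n) {v : Cube n} (hv : v ≠ 0) :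
    minInfluence f ≤ influence f v :=
  ciInf_le (f := fun v : {v : Cube n // v ≠ 0} => influence f v.1)
    (Set.finite_range _).bddBelow ⟨v, hv⟩

lemma minInfluence_pos (hn : 1 ≤ n) (hf : ∀ t : Cube n, (∀ x, f x = f (x + t)) → t = 0) :
    0 < minInfluence f := by
  have : Nonempty {v : Cube n // v ≠ 0} :=
    ⟨fun _ => 1, fun h => one_ne_zero (congrFun h ⟨0, hn⟩)⟩
  obtain ⟨v, hv⟩ := exists_eq_ciInf_of_finite (f := fun v : {v : Cube n // v ≠ 0} =>
    influence f v.1)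
  rw [minInfluence, ← hv]
  exact influence_pos hf v.2

/-- A search for a good sample takes at most `99 / √γ` queries: `33 * 3 ^ q` by the bound for the
potential, and `3 ^ q * sin θ ≤ 3` at a good level, where `sin² θ` is the influence of `v`. -/
lemma exists_level_of_ne_zero (hn : 1 ≤ n) (h : IsInstance f g s) {v : Cube n} (hv : v ≠ 0) :
    ∃ q : ℕ, Real.cos (3 ^ q * angle f g v) ^ 2 ≤ 1 / 2 ∧
      33 * 3 ^ q ≤ 99 / Real.sqrt (minInfluence f) := by
  have hγ := minInfluence_pos hn h.aperiodic
  have hp : 0 < successProb f g v := by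
    rw [successProb_eq_influence h.shift]
    exact influence_pos h.aperiodic hv
  have hθ : 0 < angle f g v := Real.arcsin_pos.2 (Real.sqrt_pos.2 hp)
  have hθ' : angle f g v ≤ Real.pi / 2 := Real.arcsin_le_pi_div_two _
  obtain ⟨q, hq, hq'⟩ := exists_good_level hθ hθ'
  refine ⟨q, hq, ?_⟩
  have hsin : Real.sqrt (minInfluence f) ≤ Real.sin (angle f g v) := by
    refine Real.sqrt_le_iff.2 ⟨Real.sin_nonneg_of_nonneg_of_le_pi hθ.le (by linarith), ?_⟩
    rw [sin_angle_sq, successProb_eq_influence h.shift]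
    exact minInfluence_le f hv
  rw [le_div_iff₀ (Real.sqrt_pos.2 hγ)]
  have : (3 : ℝ) ^ q * Real.sqrt (minInfluence f) ≤ 3 ^ q * Real.sin (angle f g v) := by gcongr
  linarith

end Influence

/-! ### The performance of the algorithm -/

section Conclusion

variable {n : ℕ} {f g : BoolFun n} {s : Cube n}

lemma expectedQueries_algorithm_le (hn : 1 ≤ n) (h : IsInstance f g s) :
    expectedQueries algorithm f g
      ≤ ENNReal.ofReal (99 * (n / Real.sqrt (minInfluence f))) := by
  change totalCost f g Config.AtQuery (start algorithm n) ≤ _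
  rw [totalCost_eq_iSup]
  refine iSup_le fun T => ?_
  obtain ⟨k, rfl⟩ : ∃ k, n = k + 1 := ⟨n - 1, by omega⟩
  have := (runs_start f g s).queries_le (T := T) fun c hc =>
    AtHead.queries_le h.shift (by positivity) (fun v hv => exists_level_of_ne_zero hn h hv) hc
  rw [normSq_start, Nat.cast_zero, zero_add, mul_one] at this
  refine this.trans (le_of_eq ?_)
  congr 1
  ring

lemma le_expectedQueries_algorithm (h : IsInstance f g s) :
    (n : ℝ≥0∞) ≤ expectedQueries algorithm f g := by
  have := (runs_start f g s).le_totalCost (Φ := n) fun c hc =>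
    AtHead.le_queries h.shift le_rfl hc
  rw [normSq_start, Nat.cast_zero, zero_add, mul_one] at this
  exact this

lemma expectedTime_algorithm_le (h : IsInstance f g s) :
    expectedTime algorithm f g
      ≤ stepsPerQuery n * expectedQueries algorithm f g + (8 * n + 19) := by
  change totalCost f g _ (start algorithm n) ≤ _
  rw [totalCost_eq_iSup]
  refine iSup_le fun T => ?_
  have := (runs_start f g s).time_le (T := T) fun c hc => AtHead.time_le h.shift hc T
  rw [normSq_start, Nat.cast_zero, mul_zero, zero_mul, add_zero] at this
  refine this.trans (le_of_eq ?_)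
  change _ = stepsPerQuery n * totalCost f g Config.AtQuery (start algorithm n) + _
  push_cast
  ring

/-- The polynomial that bounds the running time in terms of the number of queries. -/
def timePolynomial : Polynomial ℕ :=
  (29 * .X ^ 2 + 133 * .X + 171) * .X + (8 * .X + 19)

lemma expectedTime_algorithm_le_eval₂ (h : IsInstance f g s) :
    expectedTime algorithm f g
      ≤ timePolynomial.eval₂ (Nat.castRingHom ℝ≥0∞) (expectedQueries algorithm f g) := by
  have hQ := le_expectedQueries_algorithm h
  refine (expectedTime_algorithm_le h).trans ?_
  rw [stepsPerQuery, timePolynomial]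
  simp only [Polynomial.eval₂_add, Polynomial.eval₂_mul, Polynomial.eval₂_pow,
    Polynomial.eval₂_X, Polynomial.eval₂_ofNat]
  push_cast
  gcongr

/-- The three events `E ∧ F`, `E ∧ ¬ F` and `¬ E` exhaust the probability. -/
lemma mass_split (E F : Config → Prop) (T : ℕ) (c : Config) :
    mass f g (fun c => E c ∧ F c) T c + mass f g (fun c => E c ∧ ¬ F c) T c
      + mass f g (fun c => ¬ E c) T c = normSq c.state := by
  induction T generalizing c with
  | zero => by_cases h : E c <;> by_cases h' : F c <;> simp [mass_zero, h, h']
  | succ T ih =>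
    rw [mass_succ, mass_succ, mass_succ, ← List.sum_map_add, ← List.sum_map_add, ← sum_normSq_step f g c]
    exact congrArg List.sum (List.map_congr_left fun c' _ => ih c')

lemma solves_algorithm (hn : 1 ≤ n) (h : IsInstance f g s) : Solves algorithm f g s := by
  have hQ : expectedQueries algorithm f g ≠ ⊤ :=
    ne_top_of_le_ne_top ENNReal.ofReal_ne_top (expectedQueries_algorithm_le hn h)
  have htime : expectedTime algorithm f g ≠ ⊤ := by
    refine ne_top_of_le_ne_top ?_ (expectedTime_algorithm_le h)
    exact ENNReal.add_ne_top.2 ⟨ENNReal.mul_ne_top (ENNReal.natCast_ne_top _) hQ,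
      by exact_mod_cast ENNReal.natCast_ne_top (8 * n + 19)⟩
  -- The expected time is finite, so the probability of not having halted tends to `0`.
  have hlim := ENNReal.tendsto_atTop_zero_of_tsum_ne_top htime
  have hwrong : ∀ T, prob algorithm f g T (fun c => c.Halted ∧ ¬ c.Output s) = 0 := by
    intro T
    have := (runs_start f g s).halted_eq_zero (T := T + 1) fun c hc =>
      AtHead.wrong_eq_zero h.shift hc (T + 1)
    exact Finset.sum_eq_zero_iff.1 this T (Finset.self_mem_range_succ T)
  have hsplit : ∀ T, prob algorithm f g T (fun c => c.Halted ∧ c.Output s)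
      = 1 - prob algorithm f g T (fun c => ¬ c.Halted) := by
    intro T
    have hs := mass_split (f := f) (g := g) Config.Halted (fun c => c.Output s) T
      (start algorithm n)
    change prob algorithm f g T _ + prob algorithm f g T _ + prob algorithm f g T _ = _ at hs
    rw [hwrong, add_zero, normSq_start] at hs
    exact ENNReal.eq_sub_of_add_eq
      (ne_top_of_le_ne_top ENNReal.one_ne_top (hs ▸ le_add_self)) hs
  simp only [Solves, hsplit]
  simpa using ENNReal.Tendsto.sub tendsto_const_nhds hlim (Or.inl ENNReal.one_ne_top)

end Conclusion

end

end HiddenShift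

theorem theorem1 :
    ∃ (P : HiddenShift.Prog) (C : ℝ) (p : Polynomial ℕ),
      ∀ (n : ℕ), 1 ≤ n → ∀ (f g : HiddenShift.BoolFun n) (s : HiddenShift.Cube n),
        HiddenShift.IsInstance f g s →
          HiddenShift.Solves P f g s ∧
          HiddenShift.expectedQueries P f g ≤
            ENNReal.ofReal (C * (n / Real.sqrt (HiddenShift.minInfluence f))) ∧
          HiddenShift.expectedTime P f g ≤
            p.eval₂ (Nat.castRingHom ENNReal) (HiddenShift.expectedQueries P f g) :=
  ⟨HiddenShift.algorithm, 99, HiddenShift.timePolynomial, fun _ hn _ _ _ h =>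
    ⟨HiddenShift.solves_algorithm hn h, HiddenShift.expectedQueries_algorithm_le hn h,
      HiddenShift.expectedTime_algorithm_le_eval₂ h⟩⟩
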